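/- **Types.** Let $T$ be one of the affine types $A_{n-1}^{(1)}$, $B_n^{(1)}$, $C_n^{(1)}$, $A_{2n-1}^{(2)}$, $D_{n+1}^{(2)}$ ($n\ge 2$), $D_n^{(1)}$ ($n\ge 3$), $A_{2n}^{(2)}$, $A_{2n}^{\prime(2)}$ ($n\ge 1$; $A_{2n}^{\prime(2)}$ is the transpose of $A_{2n}^{(2)}$). Put $g=\tilde\eta^\vee = n,\ 2n-1,\ 2n+2,\ 2n,\ 2n,\ 2n-2,\ 2n+1,\ 2n+1$ respectively (in the order just listed). The underlying finite root system is $A_{n-1}$ for $A_{n-1}^{(1)}$, $B_n$ for $B_n^{(1)},D_{n+1}^{(2)},A_{2n}^{\prime(2)}$, $C_n$ for $C_n^{(1)},A_{2n-1}^{(2)},A_{2n}^{(2)}$, and $D_n$ for $D_n^{(1)}$. It is realised in $\mathbb Q^n$ with orthonormal basis $\varepsilon_1,\dots,\varepsilon_n$, with simple roots $\varepsilon_i-\varepsilon_{i+1}$ ($1\le i<n$) and, in types $B_n,C_n,D_n$, additionally $\varepsilon_n$, $2\varepsilon_n$, $\varepsilon_{n-1}+\varepsilon_n$. Let $\mathring\rho$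 be the vector with $i$-th coordinate $\frac{n+1}2-i,\ n-i+\frac12,\ n-i+1,\ n-i$ in types $A_{n-1},B_n,C_n,D_n$. **Weyl groups.** $W$ is generated by the reflections $s_1,s_2,\dots$ in the simple roots. $W_a$ is generated by these and $s_0=t_\theta s_\theta$, where $t_\beta$ is translation by $\beta$, and $\theta=\varepsilon_1-\varepsilon_n$ for $A_{n-1}^{(1)}$, $\theta=\varepsilon_1+\varepsilon_2$ for $B_n^{(1)},D_n^{(1)},A_{2n-1}^{(2)}$, and $\theta=\varepsilon_1$ for the other four types. Its translation lattice $M^*$ is $\{\nu\in\mathbb Z^n:\sum\nu_i=0\}$, $\{\nu\in\mathbb Z^n:\sum\nu_i \text{ even}\}$, $\mathbb Z^n$ in these three cases. (For $C_n^{(1)}$ and $A_{2n}^{\prime(2)}$ the affine space is rescaled by $1/2$, which is compensated by $g$ being twice the dual Coxeter number.) The affine Grassmannian $W_a^0$ is the set of $c\in W_a$ of minimal length in $cW$. For $\nu\in M^*$, $W^\nu$ is the set of $u\in W$ of minimal length in $uW_\nu$, $W_\nu$ being the stabiliser of $\nu$ in $W$. Let $-P_+$ be the set of $\nu$ with $(\nu,\alpha)\le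 0$ for all simple roots $\alpha$. **Partitions.** For a partition $\mu$ with Durfee square of size $d$ and conjugate $\mu^{\rm tr}$, call $\mu$ *doubled distinct* if $\mu_i=\mu^{\rm tr}_i+1$ for $1\le i\le d$; it is then the double $\bar\lambda\bar\lambda$ of the partition $\bar\lambda$ with distinct parts $\bar\lambda_i=\mu_i-i$, $1\le i\le d$. If $\mu$ is self-conjugate, let $\bar\lambda$ have the distinct parts $\bar\lambda_i=\mu_i-i+1$, $1\le i\le d$, so that the diagonal hook lengths of $\mu$ are $2\bar\lambda_i-1$. Let $\mathcal C_T$ be the set of the following $\mu$: * $A_{n-1}^{(1)}$: the $n$-cores (partitions without hook length $n$); * $D_{n+1}^{(2)}$, $A_{2n}^{(2)}$: the self-conjugate $g$-cores; * $C_n^{(1)}$, $A_{2n}^{\prime(2)}$: the doubled distinct $\mu$ with no hook length $g$ strictly above the main diagonal and with no part $h$ of $\bar\lambda$ such that $2h=g$; * $B_n^{(1)}$, $A_{2n-1}^{(2)}$: the doubled distinct $\mu$ with no hook length $g$ strictly below the main diagonal and with no part $h$ of $\bar\lambda$ such that $2h=g$; * $D_n^{(1)}$: the doubled distinct $\mu$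 with no hook length $g$ strictly below the main diagonal. Let $\mathcal H_T$ be the multiset of all hook lengths of $\mu$ for $A_{n-1}^{(1)}$, and the multiset of the hook lengths of the boxes of $\mu$ strictly below the main diagonal for all other types. **Correspondence.** For a partition $\mu$ put $Z(\mu)=\{\mu_i-i: i\ge 1\}$ (with $\mu_i=0$ for large $i$) and $\varphi_i(\mu)=\min\{k\in\mathbb Z: kg+i\notin Z(\mu)\}$, $0\le i<g$ (the $g$-multicharge). An element $c\in W_a^0$, with $\beta=c(0)\in M^*$, corresponds to $\mu\in\mathcal C_T$ if the following holds: * $A_{n-1}^{(1)}$: $\varphi(\mu)=(\beta_1,\dots,\beta_n)$; * $D_{n+1}^{(2)}$: $\varphi(\mu)=(\beta_1,\dots,\beta_n,-\beta_n,\dots,-\beta_1)$; * $A_{2n}^{(2)}$: $\varphi(\mu)=(\beta_1,\dots,\beta_n,0,-\beta_n,\dots,-\beta_1)$; * $C_n^{(1)}$: $\varphi(\mu)=(0,\beta_1,\dots,\beta_n,0,-\beta_n,\dots,-\beta_1)$; * $A_{2n}^{\prime(2)}$: $\varphi(\mu)=(0,\beta_1,\dots,\beta_n,-\beta_n,\dots,-\beta_1)$;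 * $B_n^{(1)}$, $A_{2n-1}^{(2)}$, $D_n^{(1)}$: $\beta_1\in\{m,1-m\}$, where $m=\max\big(\{1\}\cup\{1+h/g: h \text{ a part of } \bar\lambda,\ g\mid h\}\big)$, and $\varphi(\mu^{\rm tr})$ equals, respectively, $(\beta_2,\dots,\beta_n,-\beta_n,\dots,-\beta_2,*)$, $(\beta_2,\dots,\beta_n,0,-\beta_n,\dots,-\beta_2,*)$, $(\beta_2,\dots,\beta_{n-1},*,-\beta_{n-1},\dots,-\beta_2,*)$, entries $*$ being unrestricted; for $D_n^{(1)}$, moreover, $|\beta_n|=\max\{k\in\mathbb Z:(k-1)g+n-2\in Z(\mu^{\rm tr})\}$. **Theorem.** Let $(X_k)_{k\in\mathbb Z}$ be independent formal variables and work in the field $\mathbb Q(X_k:k\in\mathbb Z)$. Let $c\in W_a^0$ be written as $c=ut_\nu$ with $\nu\in M^*\cap(-P_+)$ and $u\in W^\nu$, let $\mu\in\mathcal C_T$ correspond to $c$, and let $\mathbf r=(r_1,\dots,r_n)=\big(-g\nu+u^{-1}(\mathring\rho)-\mathring\rho\big)+\mathring\rho$ be the associated dominant weight shifted by $\mathring\rho$.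 Then $$\prod_{h\in\bar\lambda}F_T(h)\ \prod_{h\in\mathcal H_T}\frac{X_{h-g}X_{h+g}}{X_h^2}=\prod_{i=1}^{g-1}\left(\frac{X_{-i}}{X_i}\right)^{\alpha'_T(i)}\Delta_T(\mathbf r).$$ Here the factor over the parts of $\bar\lambda$ is absent ($F_T=1$) for $A_{n-1}^{(1)}$, and $$F_T(h)=\begin{cases}\dfrac{X_{2h-g}X_{h-g}}{X_{2h}X_h}& C_n^{(1)},A_{2n}^{\prime(2)},\\[2mm]\dfrac{X_{2h-1-g}}{X_{2h-1}}& D_{n+1}^{(2)},A_{2n}^{(2)},\\[2mm]\dfrac{X_{2h-g}X_{h+g}}{X_{2h}X_h}& B_n^{(1)},A_{2n-1}^{(2)},\\[2mm]\dfrac{X_{2h+g}X_{h+g}}{X_{2h}X_h}& D_n^{(1)}.\end{cases}$$ With $\alpha_T(i)=\#\{h\in\mathcal H_T:h=g-i\}$ (with multiplicity), $\alpha'_T(i)=\alpha_T(i)$ for $A_{n-1}^{(1)}$ and $D_n^{(1)}$; $\alpha'_T(i)=\alpha_T(i)+\#\{h\in\bar\lambda:2h=g-i\}+\#\{h\in\bar\lambda:h=g-i\}$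 for $C_n^{(1)},A_{2n}^{\prime(2)}$; $\alpha'_T(i)=\alpha_T(i)+\#\{h\in\bar\lambda:2h-1=g-i\}$ for $D_{n+1}^{(2)},A_{2n}^{(2)}$; and $\alpha'_T(i)=\alpha_T(i)+\#\{h\in\bar\lambda:2h=g-i\}$ for $B_n^{(1)},A_{2n-1}^{(2)}$. Finally, with $$\Pi_s(\mathbf r)=\prod_{1\le i<j\le n}\frac{X_{r_i-r_j}X_{r_i+r_j}}{X_{j-i}X_{s-i-j}},\qquad \Sigma(\mathbf r)=\prod_{i=1}^n\frac{X_{r_i}}{X_i},$$ the function $\Delta_T(\mathbf r)$ is $\prod_{i<j}X_{r_i-r_j}/X_{j-i}$ for $A_{n-1}^{(1)}$; $\Pi_{g+2}$ for $B_n^{(1)}$; $\Sigma\,\Pi_{g+2}$ for $A_{2n-1}^{(2)}$; $\Sigma\,\Pi_g$ for $C_n^{(1)}$; $\Pi_{g+1}$ for $D_{n+1}^{(2)}$; $\Sigma\,\Pi_{g+1}$ for $A_{2n}^{(2)}$; $\Pi_g$ for $A_{2n}^{\prime(2)}$; and for $D_n^{(1)}$ $$\prod_{i=1}^n\frac{X_{2|r_i|}}{X_{|r_i|}}\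 \prod_{i=1}^{n-1}\frac{X_i}{X_{2i}}\ \Pi_{g+2}(\mathbf r)\qquad\text{with } X_0/X_0=1 .$$ -/

import Mathlib

namespace AffineHook

/-! ## Affine types -/

/-- The families of classical affine types, in Kac's notation:
`A` is `A_{n-1}^{(1)}`, `B`, `C`, `D` are `B_n^{(1)}`, `C_n^{(1)}`, `D_n^{(1)}`,
`A2odd` is `A_{2n-1}^{(2)}`, `A2even` is `A_{2n}^{(2)}`, `A2evenDual` is its transpose `A'_{2n}^{(2)}`
and `D2` is `D_{n+1}^{(2)}`. -/
inductive AffType where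
  | A | B | C | D | A2odd | A2even | A2evenDual | D2

/-- The classical types of finite root systems (`A` stands for `A_{n-1}`, realised in `n` coordinates). -/
inductive FinType where
  | A | B | C | D

/-- The finite root system obtained by deleting the node `0`. -/
def AffType.fin : AffType → FinType
  | .A => .A
  | .B => .B
  | .C => .C
  | .D => .D
  | .A2odd => .C
  | .A2even => .C
  | .A2evenDual => .B
  | .D2 => .B

/-- The ranks for which the type is defined. -/
def AffType.RankOK : AffType → ℕ → Prop
  | .A, n => 2 ≤ n
  | .B, n => 2 ≤ n
  | .C, n => 2 ≤ n
  | .D, n => 3 ≤ n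
  | .A2odd, n => 2 ≤ n
  | .A2even, n => 1 ≤ n
  | .A2evenDual, n => 1 ≤ n
  | .D2, n => 2 ≤ n

/-- The integer `η̃^∨`: the dual Coxeter number `η^∨ = ∑ a_i^∨ / a_0^∨`, doubled in the types `C_n^{(1)}`
(`η^∨ = n + 1`) and `A'_{2n}^{(2)}` (`η^∨ = n + 1/2`). -/
def AffType.eta : AffType → ℕ → ℕ
  | .A, n => n
  | .B, n => 2 * n - 1
  | .C, n => 2 * n + 2
  | .D, n => 2 * n - 2
  | .A2odd, n => 2 * n
  | .A2even, n => 2 * n + 1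
  | .A2evenDual, n => 2 * n + 1
  | .D2, n => 2 * n

/-! ## Finite and affine Weyl groups in the coordinates `ε_1, …, ε_n` -/

/-- The space with its standard orthonormal basis `ε_1, …, ε_n` (indexed from `0` below). -/
abbrev V (n : ℕ) : Type := Fin n → ℚ

/-- The basis vector `ε_{i+1}`. -/
def e {n : ℕ} (i : Fin n) : V n := Pi.single i 1

/-- The orthogonal reflection in the hyperplane `α^⊥`. -/
def reflection {n : ℕ} (α : V n) : Equiv.Perm (V n) :=
  Function.Involutive.toPerm (fun x => x - (2 * (x ⬝ᵥ α) / (α ⬝ᵥ α)) • α) (by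
    intro x
    by_cases h : α ⬝ᵥ α = 0
    · simp [h]
    · simp only [sub_dotProduct, smul_dotProduct, smul_eq_mul]
      rw [sub_sub, ← add_smul]
      have : 2 * (x ⬝ᵥ α) / (α ⬝ᵥ α)
          + 2 * (x ⬝ᵥ α - 2 * (x ⬝ᵥ α) / (α ⬝ᵥ α) * (α ⬝ᵥ α)) / (α ⬝ᵥ α) = 0 := by
        field_simp
        ring
      rw [this, zero_smul, sub_zero])

/-- The translation `t_β : x ↦ x + β`. -/
def translation {n : ℕ} (β : V n) : Equiv.Perm (V n) := Equiv.addRight β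

/-- The simple roots `α_1, α_2, …` of the finite root system. -/
def simpleRoots (F : FinType) (n : ℕ) : Set (V n) :=
  {α | ∃ i j : Fin n, (j : ℕ) = i + 1 ∧ α = e i - e j} ∪
  match F with
  | .A => ∅
  | .B => {α | ∃ i : Fin n, (i : ℕ) + 1 = n ∧ α = e i}
  | .C => {α | ∃ i : Fin n, (i : ℕ) + 1 = n ∧ α = (2 : ℚ) • e i}
  | .D => {α | ∃ i j : Fin n, (i : ℕ) + 2 = n ∧ (j : ℕ) + 1 = n ∧ α = e i + e j}

/-- The vector `ρ̊`, half the sum of the positive roots of the finite root system. -/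
def rho (F : FinType) (n : ℕ) : V n := fun i =>
  match F with
  | .A => ((n : ℚ) - 1) / 2 - (i : ℕ)
  | .B => (n : ℚ) - (i : ℕ) - 1 / 2
  | .C => (n : ℚ) - (i : ℕ)
  | .D => (n : ℚ) - (i : ℕ) - 1

/-- The simple reflections `s_1, s_2, …`. -/
def finiteReflections (T : AffType) (n : ℕ) : Set (Equiv.Perm (V n)) :=
  reflection '' simpleRoots T.fin n

/-- The affine reflection `s_0 = t_{θ'} s_{θ'}`. In the types `C_n^{(1)}` and `A'_{2n}^{(2)}` the space is
rescaled by `1/2`, in accordance with `η̃^∨ = 2 η^∨`. -/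
def zeroReflection (T : AffType) (n : ℕ) : Set (Equiv.Perm (V n)) :=
  match T with
  | .A => {s | ∃ i j : Fin n, (i : ℕ) = 0 ∧ (j : ℕ) + 1 = n ∧
      s = translation (e i - e j) * reflection (e i - e j)}
  | .B | .D | .A2odd => {s | ∃ i j : Fin n, (i : ℕ) = 0 ∧ (j : ℕ) = 1 ∧
      s = translation (e i + e j) * reflection (e i + e j)}
  | .C | .A2even | .A2evenDual | .D2 => {s | ∃ i : Fin n, (i : ℕ) = 0 ∧
      s = translation (e i) * reflection (e i)}

/-- All simple reflections `s_0, s_1, s_2, …`. -/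
def affineReflections (T : AffType) (n : ℕ) : Set (Equiv.Perm (V n)) :=
  zeroReflection T n ∪ finiteReflections T n

/-- The finite Weyl group `W`. -/
def weylGroup (T : AffType) (n : ℕ) : Subgroup (Equiv.Perm (V n)) :=
  Subgroup.closure (finiteReflections T n)

/-- The affine Weyl group `W_a`. -/
def affineWeylGroup (T : AffType) (n : ℕ) : Subgroup (Equiv.Perm (V n)) :=
  Subgroup.closure (affineReflections T n)

/-- The length of a shortest word in the (involutive) generators `S` with product `w`. -/
noncomputable def wordLength {G : Type*} [Group G] (S : Set G) (w : G) : ℕ :=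
  sInf {k | ∃ l : List G, (∀ s ∈ l, s ∈ S) ∧ l.prod = w ∧ l.length = k}

/-- The affine Grassmannian `W_a^0`: the elements of minimal length in their left coset `c W`. -/
def affineGrassmannian (T : AffType) (n : ℕ) : Set (Equiv.Perm (V n)) :=
  {c | c ∈ affineWeylGroup T n ∧ ∀ w ∈ weylGroup T n,
    wordLength (affineReflections T n) c ≤ wordLength (affineReflections T n) (c * w)}

/-- The lattice `M^*` of the translations in `W_a` (rescaled by `1/2` in the types `C_n^{(1)}` and
`A'_{2n}^{(2)}`). -/
def translationLattice (T : AffType) (n : ℕ) : Set (V n) :=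
  {ν | ∃ z : Fin n → ℤ, (∀ i, ν i = z i) ∧
    match T with
    | .A => ∑ i, z i = 0
    | .B | .D | .A2odd => Even (∑ i, z i)
    | .C | .A2even | .A2evenDual | .D2 => True}

/-- `ν ∈ -P_+`. -/
def Antidominant (T : AffType) {n : ℕ} (ν : V n) : Prop :=
  ∀ α ∈ simpleRoots T.fin n, ν ⬝ᵥ α ≤ 0

/-- `u ∈ W^ν`: `u` is an element of `W` of minimal length in the coset `u W_ν`, with `W_ν` the stabiliser
of `ν` in `W`. -/
def IsMinimalCosetRep (T : AffType) {n : ℕ} (u : Equiv.Perm (V n)) (ν : V n) : Prop :=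
  u ∈ weylGroup T n ∧ ∀ w ∈ weylGroup T n, w ν = ν →
    wordLength (finiteReflections T n) u ≤ wordLength (finiteReflections T n) (u * w)

/-- The dominant weight `-η̃^∨ ν + u⁻¹(ρ̊) - ρ̊` attached to `c = u t_ν`. -/
def weight (T : AffType) {n : ℕ} (u : Equiv.Perm (V n)) (ν : V n) : V n :=
  -((T.eta n : ℚ) • ν) + u⁻¹ (rho T.fin n) - rho T.fin n

/-- The vector `r`: the dominant weight attached to `c = u t_ν`, shifted by `ρ̊`. -/
def rVector (T : AffType) {n : ℕ} (u : Equiv.Perm (V n)) (ν : V n) : V n :=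
  weight T u ν + rho T.fin n

/-! ## Partitions -/

/-- The hook length of the box `c` (row `c.1`, column `c.2`, both counted from `0`). -/
def hookLength (μ : YoungDiagram) (c : ℕ × ℕ) : ℕ :=
  (μ.rowLen c.1 - c.2) + (μ.colLen c.2 - c.1) - 1

/-- The multiset of all hook lengths. -/
def hooks (μ : YoungDiagram) : Multiset ℕ := μ.cells.val.map (hookLength μ)

/-- The multiset of the hook lengths of the boxes strictly above the main diagonal. -/
def hooksAbove (μ : YoungDiagram) : Multiset ℕ :=
  (μ.cells.filter (fun c => c.1 < c.2)).val.map (hookLength μ)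

/-- The multiset of the hook lengths of the boxes strictly below the main diagonal. -/
def hooksBelow (μ : YoungDiagram) : Multiset ℕ :=
  (μ.cells.filter (fun c => c.2 < c.1)).val.map (hookLength μ)

/-- `μ` is a `g`-core. -/
def IsCore (g : ℕ) (μ : YoungDiagram) : Prop := g ∉ hooks μ

def IsSelfConjugate (μ : YoungDiagram) : Prop := μ.transpose = μ

/-- `μ` is the double `λ̄λ̄` of a distinct partition `λ̄`: the `i`-th row is one box longer than the `i`-th
column, for `i` up to the size of the Durfee square. -/
def IsDoubledDistinct (μ : YoungDiagram) : Prop :=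
  ∀ i, (i, i) ∈ μ → μ.rowLen i = μ.colLen i + 1

/-- The parts of `λ̄` when `μ = λ̄λ̄`: the numbers of boxes of `μ` strictly to the right of the main
diagonal, in the rows which meet the diagonal. -/
def partsOfDouble (μ : YoungDiagram) : Multiset ℕ :=
  (μ.cells.filter (fun c => c.1 = c.2)).val.map (fun c => μ.rowLen c.1 - (c.1 + 1))

/-- The parts of the distinct partition `λ̄` of a self-conjugate partition `μ`: the numbers of boxes of `μ`
weakly to the right of the main diagonal. The diagonal hook lengths of `μ` are the numbers `2 λ̄_i - 1`. -/
def partsOfSelfConjugate (μ : YoungDiagram) : Multiset ℕ :=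
  (μ.cells.filter (fun c => c.1 = c.2)).val.map (fun c => μ.rowLen c.1 - c.1)

/-- The parts of `λ̄`, where `λ̄` is attached to the diagram `μ` according to the type (there is no `λ̄` in
type `A`). -/
def parts : AffType → YoungDiagram → Multiset ℕ
  | .A, _ => 0
  | .D2, μ | .A2even, μ => partsOfSelfConjugate μ
  | .C, μ | .A2evenDual, μ | .B, μ | .A2odd, μ | .D, μ => partsOfDouble μ

/-- The family `C_T` of partitions. A distinct partition `λ̄` is encoded by its double `μ = λ̄λ̄`:
`n`-cores in type `A`; self-conjugate `η̃^∨`-cores in types `D2`, `A2even`; the family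
`C_{η̃^∨}^{d,r}` in types `C`, `A2evenDual`; the family `C_{η̃^∨}^{d,tr,r}` in types `B`, `A2odd`;
the family `C_{η̃^∨}^{d,tr}` in type `D`. -/
def InFamily (T : AffType) (n : ℕ) (μ : YoungDiagram) : Prop :=
  match T with
  | .A => IsCore (T.eta n) μ
  | .D2 | .A2even => IsSelfConjugate μ ∧ IsCore (T.eta n) μ
  | .C | .A2evenDual => IsDoubledDistinct μ ∧ T.eta n ∉ hooksAbove μ ∧
      ∀ h ∈ partsOfDouble μ, 2 * h ≠ T.eta n
  | .B | .A2odd => IsDoubledDistinct μ ∧ T.eta n ∉ hooksBelow μ ∧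
      ∀ h ∈ partsOfDouble μ, 2 * h ≠ T.eta n
  | .D => IsDoubledDistinct μ ∧ T.eta n ∉ hooksBelow μ

/-- The letter of index `k` of the bi-infinite word `ψ(μ)` is `0`, i.e. `k` is one of the numbers
`μ_i - i`, `i ≥ 1`; otherwise it is `1`. -/
def IsZeroLetter (μ : YoungDiagram) (k : ℤ) : Prop :=
  ∃ i : ℕ, k = (μ.rowLen i : ℤ) - (i + 1)

/-- The entry of the `g`-multicharge of `μ` at the residue `i` is `m`:
`m = min {k | the letter of index k g + i of ψ(μ) is 1}`. -/
def HasCharge (g : ℕ) (μ : YoungDiagram) (i : ℤ) (m : ℤ) : Prop :=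
  IsLeast {k : ℤ | ¬ IsZeroLetter μ (k * g + i)} m

/-- The partition `μ` corresponds to the affine Grassmannian element `c` for which `β = c(0) ∈ M^*`.
Below, `φ_g` denotes the `g`-multicharge and `g = η̃^∨`.

* Type `A`: `φ_n(μ) = (β_1, …, β_n)`.
* Type `D2`: `φ_{2n}(μ) = (β_1, …, β_n, -β_n, …, -β_1)`.
* Type `A2even`: `φ_{2n+1}(μ) = (β_1, …, β_n, 0, -β_n, …, -β_1)`.
* Type `C`: `φ_{2n+2}(λ̄λ̄) = (0, β_1, …, β_n, 0, -β_n, …, -β_1)`.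
* Type `A2evenDual`: `φ_{2n+1}(λ̄λ̄) = (0, β_1, …, β_n, -β_n, …, -β_1)`.
* Types `B`, `A2odd`: the word of the transpose of `λ̄λ̄` has the multicharge
  `(β_2, …, β_n, -β_n, …, -β_2, *)` resp. `(β_2, …, β_n, 0, -β_n, …, -β_2, *)`, and
  `β_1 ∈ {m, 1 - m}` (the parity of `∑ β_i` decides which of the two) with
  `m = max ({1} ∪ {(g + λ̄_i) / g | g divides λ̄_i})`.
* Type `D`: likewise with `(β_2, …, β_{n-1}, *, -β_{n-1}, …, -β_2, *)`, the same `m`, and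
  `|β_n| = max {k + 1 | the letter of index k g + g / 2 - 1 is 0}`. -/
def Corresponds (T : AffType) {n : ℕ} (β : Fin n → ℤ) (μ : YoungDiagram) : Prop :=
  let g : ℕ := T.eta n
  let firstCoordinate : Prop := ∃ m : ℤ,
    IsGreatest ({1} ∪ {x : ℤ | ∃ h ∈ partsOfDouble μ, (g : ℤ) * x = g + h}) m ∧
      ∀ j : Fin n, (j : ℕ) = 0 → β j = m ∨ β j = 1 - m
  match T with
  | .A => ∀ j : Fin n, HasCharge g μ j (β j)
  | .D2 => ∀ j : Fin n, HasCharge g μ j (β j) ∧ HasCharge g μ (g - 1 - j) (-β j)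
  | .A2even => HasCharge g μ n 0 ∧
      ∀ j : Fin n, HasCharge g μ j (β j) ∧ HasCharge g μ (g - 1 - j) (-β j)
  | .C => HasCharge g μ 0 0 ∧ HasCharge g μ (n + 1) 0 ∧
      ∀ j : Fin n, HasCharge g μ (j + 1) (β j) ∧ HasCharge g μ (g - 1 - j) (-β j)
  | .A2evenDual => HasCharge g μ 0 0 ∧
      ∀ j : Fin n, HasCharge g μ (j + 1) (β j) ∧ HasCharge g μ (g - 1 - j) (-β j)
  | .B => firstCoordinate ∧ ∀ j : Fin n, 1 ≤ (j : ℕ) →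
      HasCharge g μ.transpose (j - 1) (β j) ∧ HasCharge g μ.transpose (g - 1 - j) (-β j)
  | .A2odd => firstCoordinate ∧ HasCharge g μ.transpose (n - 1) 0 ∧ ∀ j : Fin n, 1 ≤ (j : ℕ) →
      HasCharge g μ.transpose (j - 1) (β j) ∧ HasCharge g μ.transpose (g - 1 - j) (-β j)
  | .D => firstCoordinate ∧
      (∀ j : Fin n, 1 ≤ (j : ℕ) → (j : ℕ) + 1 < n →
        HasCharge g μ.transpose (j - 1) (β j) ∧ HasCharge g μ.transpose (g - 1 - j) (-β j)) ∧
      ∀ j : Fin n, (j : ℕ) + 1 = n →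
        IsGreatest {x : ℤ | IsZeroLetter μ.transpose ((x - 1) * g + (n - 2))} |β j|

/-! ## The two sides of the identity -/

/-- The field `ℚ(X_k : k ∈ ℤ)`. -/
abbrev K : Type := FractionRing (MvPolynomial ℤ ℚ)

/-- The formal variable `X_k`. -/
noncomputable def X (k : ℤ) : K := algebraMap (MvPolynomial ℤ ℚ) K (MvPolynomial.X k)

/-- The multiset `H(λ)_T`. -/
def hookMultiset : AffType → YoungDiagram → Multiset ℕ
  | .A, μ => hooks μ
  | .B, μ | .C, μ | .D, μ | .A2odd, μ | .A2even, μ | .A2evenDual, μ | .D2, μ => hooksBelow μ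

/-- The factor of the product over the parts `h` of `λ̄`, with `g = η̃^∨`. -/
noncomputable def partFactor (T : AffType) (g h : ℤ) : K :=
  match T with
  | .A => 1
  | .C | .A2evenDual => X (2 * h - g) * X (h - g) / (X (2 * h) * X h)
  | .D2 | .A2even => X (2 * h - 1 - g) / X (2 * h - 1)
  | .B | .A2odd => X (2 * h - g) * X (h + g) / (X (2 * h) * X h)
  | .D => X (2 * h + g) * X (h + g) / (X (2 * h) * X h)

/-- The hook length product (the left-hand side). -/
noncomputable def hookProduct (T : AffType) (n : ℕ) (μ : YoungDiagram) : K :=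
  ((parts T μ).map fun h => partFactor T (T.eta n) h).prod *
    ((hookMultiset T μ).map fun h =>
      X ((h : ℤ) - T.eta n) * X ((h : ℤ) + T.eta n) / X h ^ 2).prod

/-- The number `α_T(i)` of elements of `H(λ)_T` equal to `η̃^∨ - i`. -/
def alpha (T : AffType) (n : ℕ) (μ : YoungDiagram) (i : ℕ) : ℕ :=
  (hookMultiset T μ).countP (fun h => h + i = T.eta n)

/-- The exponent `α'_T(i)`. -/
def alpha' (T : AffType) (n : ℕ) (μ : YoungDiagram) (i : ℕ) : ℕ :=
  alpha T n μ i +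
    match T with
    | .A | .D => 0
    | .C | .A2evenDual => (parts T μ).countP (fun h => 2 * h + i = T.eta n) +
        (parts T μ).countP (fun h => h + i = T.eta n)
    | .D2 | .A2even => (parts T μ).countP (fun h => 2 * h + i = T.eta n + 1)
    | .B | .A2odd => (parts T μ).countP (fun h => 2 * h + i = T.eta n)

/-- The variable with index the number `q`, for an integer `q` given as a rational number. -/
noncomputable def Xq (q : ℚ) : K := X ⌊q⌋

/-- `∏_{1 ≤ i < j ≤ n} X_{r_i - r_j} X_{r_i + r_j} / (X_{j - i} X_{s - i - j})`. -/
noncomputable def pairProduct (s : ℤ) {n : ℕ} (r : V n) : K :=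
  ∏ i : Fin n, ∏ j ∈ Finset.Ioi i,
    Xq (r i - r j) * Xq (r i + r j) /
      (X ((j : ℤ) - i) * X (s - ((i : ℤ) + 1) - ((j : ℤ) + 1)))

/-- `∏_{1 ≤ i ≤ n} X_{r_i} / X_i`. -/
noncomputable def singleProduct {n : ℕ} (r : V n) : K :=
  ∏ i : Fin n, Xq (r i) / X ((i : ℤ) + 1)

/-- The Weyl type product `Δ_T(r)`. -/
noncomputable def weylProduct (T : AffType) {n : ℕ} (r : V n) : K :=
  match T with
  | .A => ∏ i : Fin n, ∏ j ∈ Finset.Ioi i, Xq (r i - r j) / X ((j : ℤ) - i)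
  | .B => pairProduct (T.eta n + 2) r
  | .A2odd => singleProduct r * pairProduct (T.eta n + 2) r
  | .C => singleProduct r * pairProduct (T.eta n) r
  | .A2evenDual => pairProduct (T.eta n) r
  | .D2 => pairProduct (T.eta n + 1) r
  | .A2even => singleProduct r * pairProduct (T.eta n + 1) r
  | .D => (∏ i : Fin n, Xq (2 * |r i|) / Xq |r i|) *
      (∏ i ∈ Finset.Icc 1 (n - 1), X i / X (2 * (i : ℤ))) * pairProduct (T.eta n + 2) r

end AffineHook

open AffineHook

namespace AffineHook

/-! ## Signed permutations -/

/-! Both sides are Laurent monomials in the variables `X k`, so it suffices to compare exponents.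
Put g = `T.eta n` and let χ = `letter μ` be the indicator function of the zero letters of the word
of μ. A box of hook length h is a pair consisting of a zero letter at z and a one letter at z - h,
so hooks are counted by the autocorrelation `corr χ h`. The exponent of X_k in ∏ X_{h-g} X_{h+g} /
X_h² is a second difference with step g of this count, and the second difference of an
autocorrelation is the autocorrelation of the first difference χ(z-g) - χ(z) (`corr_second_diff`).
For a core, the first difference is one point mass on each residue class mod g, placed by the
multicharge and hence by β. Its autocorrelation counts differences of coordinates of ρ̊ - gβ. Since
r = u⁻¹(ρ̊ - gβ) is a signed permutation of that vector (`rVector_signed`) and is strictly dominant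
(`rVector_dotProduct_pos`), these counts at k > 0 are the exponents in the numerator of Δ_T(r).

Two corrections remain. For 0 < k < g the second difference involves the autocorrelation at k - g <
0, whereas hook lengths are positive; as `corr χ (-h) - corr χ h` does not depend on χ
(`corr_neg_sub`), it can be traded for the value at g - k, and this produces the prefactor with
exponents α'. The constants that are left do not depend on μ. They are removed by subtracting the
same identity for the empty partition, for which r is replaced by ρ̊; this accounts for the
denominator of Δ_T.

Outside type A the word is antisymmetric about -s/2, with s = 1 for self-conjugate and s = 0 for
doubled distinct diagrams. Then `corr χ h` is twice the number of hooks below the diagonal plus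
terms for the parts of the distinct partition (`IsShiftSymmetric.corr_letter`), which is why the
exponents are compared after doubling. The factors F_T supply the part terms. The types differ by
fixed point masses of the first difference at the centre, at 0 and at g (`hasDiff_of_corresponds`),
and everything is combined in `exists_exponent_identity`. -/

/-- `u` permutes the coordinates and changes signs; in type `A` there are no sign changes. -/
def IsSigned (F : FinType) {n : ℕ} (u : Equiv.Perm (V n)) : Prop :=
  ∃ (σ : Equiv.Perm (Fin n)) (η : Fin n → ℤ), (∀ i, η i = 1 ∨ η i = -1) ∧
    (F = .A → ∀ i, η i = 1) ∧ ∀ x i, u x i = η i * x (σ i)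

theorem IsSigned.one {F : FinType} {n : ℕ} : IsSigned F (1 : Equiv.Perm (V n)) :=
  ⟨1, fun _ => 1, by simp, by simp, by simp⟩

theorem IsSigned.mul {F : FinType} {n : ℕ} {u v : Equiv.Perm (V n)} (hu : IsSigned F u)
    (hv : IsSigned F v) : IsSigned F (u * v) := by
  obtain ⟨σ, η, h1, h2, h3⟩ := hu
  obtain ⟨σ', η', h1', h2', h3'⟩ := hv
  refine ⟨σ' * σ, fun i => η i * η' (σ i), ?_, ?_, ?_⟩
  · intro i
    rcases h1 i with h | h <;> rcases h1' (σ i) with h' | h' <;> simp [h, h']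
  · intro hA i
    simp [h2 hA, h2' hA]
  · intro x i
    simp [h3, h3', mul_assoc]

theorem IsSigned.inv {F : FinType} {n : ℕ} {u : Equiv.Perm (V n)} (hu : IsSigned F u) :
    IsSigned F u⁻¹ := by
  obtain ⟨σ, η, h1, h2, h3⟩ := hu
  refine ⟨σ⁻¹, fun i => η (σ⁻¹ i), fun i => h1 _, fun hA i => h2 hA _, ?_⟩
  intro x i
  have := h3 (u⁻¹ x) (σ⁻¹ i)
  have e1 : u (u⁻¹ x) = x := u.apply_symm_apply x
  have e2 : σ (σ⁻¹ i) = i := σ.apply_symm_apply i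
  rw [e1, e2] at this
  rw [this, ← mul_assoc]
  have e3 : (η (σ⁻¹ i) : ℚ) * η (σ⁻¹ i) = 1 := by
    rcases h1 (σ⁻¹ i) with h | h <;> rw [h] <;> norm_num
  rw [e3, one_mul]

theorem IsSigned.map_sub_smul {F : FinType} {n : ℕ} {u : Equiv.Perm (V n)} (hu : IsSigned F u)
    (x y : V n) (q : ℚ) : u (x - q • y) = u x - q • u y := by
  obtain ⟨σ, η, h1, h2, h3⟩ := hu
  ext i
  simp [h3]
  ring

theorem IsSigned.dotProduct {F : FinType} {n : ℕ} {u : Equiv.Perm (V n)} (hu : IsSigned F u)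
    (x y : V n) : u x ⬝ᵥ u y = x ⬝ᵥ y := by
  obtain ⟨σ, η, h1, h2, h3⟩ := hu
  simp only [_root_.dotProduct, h3]
  rw [← Equiv.sum_comp σ (fun i => x i * y i)]
  refine Finset.sum_congr rfl fun i _ => ?_
  rcases h1 i with h | h <;> simp [h]

/-- Signed permutations are linear isometries, so they conjugate s_α into s_{uα}. The exchange
condition uses this to cancel a letter. -/
theorem IsSigned.reflection_apply {F : FinType} {n : ℕ} {u : Equiv.Perm (V n)} (hu : IsSigned F u)
    (α : V n) : reflection (u α) * u = u * reflection α := by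
  ext x : 1
  change u x - (2 * (u x ⬝ᵥ u α) / (u α ⬝ᵥ u α)) • u α = u (x - (2 * (x ⬝ᵥ α) / (α ⬝ᵥ α)) • α)
  rw [hu.map_sub_smul, hu.dotProduct, hu.dotProduct]

theorem reflection_mul_self {n : ℕ} (α : V n) : reflection α * reflection α = 1 := by
  ext x : 1
  exact Function.Involutive.toPerm_involutive _ x

theorem reflection_inv {n : ℕ} (α : V n) : (reflection α)⁻¹ = reflection α :=
  inv_eq_of_mul_eq_one_left (reflection_mul_self α)

theorem isSigned_reflection {F : FinType} {n : ℕ} {α : V n} (hα : α ∈ simpleRoots F n) :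
    IsSigned F (reflection α) := by
  have key : ∀ i j : Fin n, i ≠ j → IsSigned F (reflection (e i - e j)) := by
    intro i j hij
    refine ⟨Equiv.swap i j, fun _ => 1, by simp, by simp, ?_⟩
    intro x k
    change (x - (2 * (x ⬝ᵥ (e i - e j)) / ((e i - e j) ⬝ᵥ (e i - e j))) • (e i - e j)) k = _
    have h2 : (e i - e j : V n) ⬝ᵥ (e i - e j) = 2 := by
      simp [e, hij, hij.symm]; norm_num
    rw [h2]
    by_cases h : k = i
    · subst h; simp [e, dotProduct_sub, hij]
    · by_cases h' : k = j
      · subst h'; simp [e, dotProduct_sub, h]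
      · simp [e, h, h', Equiv.swap_apply_of_ne_of_ne]
  have key1 : ∀ (i : Fin n) (q : ℚ), q ≠ 0 → F ≠ .A → IsSigned F (reflection (q • e i)) := by
    intro i q hq hF
    refine ⟨1, fun k => if k = i then -1 else 1, ?_, fun h => absurd h hF, ?_⟩
    · intro k; by_cases h : k = i <;> simp [h]
    · intro x k
      change (x - (2 * (x ⬝ᵥ (q • e i)) / ((q • e i) ⬝ᵥ (q • e i))) • (q • e i)) k = _
      by_cases h : k = i
      · subst h; simp [e]; field_simp; ring
      · simp [e, h]
  have key2 : ∀ i j : Fin n, i ≠ j → F ≠ .A → IsSigned F (reflection (e i + e j)) := by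
    intro i j hij hF
    refine ⟨Equiv.swap i j, fun k => if k = i ∨ k = j then -1 else 1, ?_, fun h => absurd h hF, ?_⟩
    · intro k; by_cases h : k = i ∨ k = j <;> simp [h]
    intro x k
    change (x - (2 * (x ⬝ᵥ (e i + e j)) / ((e i + e j) ⬝ᵥ (e i + e j))) • (e i + e j)) k = _
    have h2 : (e i + e j : V n) ⬝ᵥ (e i + e j) = 2 := by
      simp [e, hij, hij.symm]; norm_num
    rw [h2]
    by_cases h : k = i
    · subst h; simp [e, dotProduct_add, hij]
    · by_cases h' : k = j
      · subst h'; simp [e, dotProduct_add, h]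
      · simp [e, h, h', Equiv.swap_apply_of_ne_of_ne]
  rcases hα with ⟨i, j, hij, rfl⟩ | hα
  · exact key i j (by rintro rfl; omega)
  · cases F with
    | A => exact absurd hα (Set.notMem_empty _)
    | B => obtain ⟨i, _, rfl⟩ := hα; simpa using key1 i 1 (by simp) (by simp)
    | C => obtain ⟨i, _, rfl⟩ := hα; exact key1 i 2 (by simp) (by simp)
    | D => obtain ⟨i, j, hi, hj, rfl⟩ := hα; exact key2 i j (by rintro rfl; omega) (by simp)

theorem isSigned_of_mem_weylGroup {T : AffType} {n : ℕ} {u : Equiv.Perm (V n)}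
    (hu : u ∈ weylGroup T n) : IsSigned T.fin u := by
  induction hu using Subgroup.closure_induction with
  | mem x hx => obtain ⟨α, hα, rfl⟩ := hx; exact isSigned_reflection hα
  | one => exact .one
  | mul x y _ _ hx hy => exact hx.mul hy
  | inv x _ hx => exact hx.inv

/-! ## Roots and the vector `ρ̊` -/

/-- The roots of the finite root system. -/
def roots (F : FinType) (n : ℕ) : Set (V n) :=
  {δ | ∃ (a b : Fin n) (η θ : ℤ), a ≠ b ∧ (η = 1 ∨ η = -1) ∧ (θ = 1 ∨ θ = -1) ∧
    (F = .A → θ = -η) ∧ δ = (η : ℚ) • e a + (θ : ℚ) • e b} ∪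
  match F with
  | .A => ∅
  | .B => {δ | ∃ (a : Fin n) (η : ℤ), (η = 1 ∨ η = -1) ∧ δ = (η : ℚ) • e a}
  | .C => {δ | ∃ (a : Fin n) (η : ℤ), (η = 2 ∨ η = -2) ∧ δ = (η : ℚ) • e a}
  | .D => ∅

theorem signed_apply_smul_e {n : ℕ} {u : Equiv.Perm (V n)}
    {σ : Equiv.Perm (Fin n)} {η : Fin n → ℤ} (h : ∀ x i, u x i = η i * x (σ i))
    (q q' : ℚ) (i j : Fin n) :
    u (q • e i + q' • e j) = (q * η (σ⁻¹ i)) • e (σ⁻¹ i) + (q' * η (σ⁻¹ j)) • e (σ⁻¹ j) := by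
  ext k
  have aux : ∀ l : Fin n, (e l : V n) (σ k) = (e (σ⁻¹ l) : V n) k := by
    intro l
    simp only [e, Pi.single_apply]
    congr 1
    rw [eq_iff_iff]
    constructor
    · rintro rfl; simp
    · rintro rfl; simp
  have aux' : ∀ l : Fin n, (η k : ℚ) * (e (σ⁻¹ l) : V n) k = η (σ⁻¹ l) * (e (σ⁻¹ l) : V n) k := by
    intro l
    by_cases hk : k = σ⁻¹ l
    · rw [hk]
    · rw [e, Pi.single_eq_of_ne hk, mul_zero, mul_zero]
  simp only [h, Pi.add_apply, Pi.smul_apply, smul_eq_mul, aux]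
  linear_combination q * aux' i + q' * aux' j

theorem IsSigned.apply_mem_roots {F : FinType} {n : ℕ} {u : Equiv.Perm (V n)} (hu : IsSigned F u)
    {α : V n} (hα : α ∈ simpleRoots F n) : u α ∈ roots F n := by
  obtain ⟨σ, η, h1, h2, h3⟩ := hu
  have hs := signed_apply_smul_e h3
  rcases hα with ⟨i, j, hij, rfl⟩ | hα
  · left
    refine ⟨σ⁻¹ i, σ⁻¹ j, η (σ⁻¹ i), -η (σ⁻¹ j), ?_, h1 _, ?_, ?_, ?_⟩
    · intro h; have := σ⁻¹.injective h; subst this; omega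
    · rcases h1 (σ⁻¹ j) with h | h <;> rw [h] <;> simp
    · intro hA; simp [h2 hA]
    · have := hs 1 (-1) i j
      simpa [sub_eq_add_neg] using this
  · cases F with
    | A => exact absurd hα (Set.notMem_empty _)
    | B =>
      obtain ⟨i, _, rfl⟩ := hα
      right
      refine ⟨σ⁻¹ i, η (σ⁻¹ i), h1 _, ?_⟩
      simpa using hs 1 0 i i
    | C =>
      obtain ⟨i, _, rfl⟩ := hα
      right
      refine ⟨σ⁻¹ i, 2 * η (σ⁻¹ i), ?_, ?_⟩
      · rcases h1 (σ⁻¹ i) with h | h <;> rw [h] <;> simp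
      · simpa using hs 2 0 i i
    | D =>
      obtain ⟨i, j, hi, hj, rfl⟩ := hα
      left
      refine ⟨σ⁻¹ i, σ⁻¹ j, η (σ⁻¹ i), η (σ⁻¹ j), ?_, h1 _, h1 _, by simp, ?_⟩
      · intro h; have := σ⁻¹.injective h; subst this; omega
      · simpa using hs 1 1 i j

/-- Twice the coordinates of `ρ̊` are the integers `rhoTop F n - 2 i`. -/
def rhoTop (F : FinType) (n : ℕ) : ℤ :=
  match F with
  | .A => n - 1
  | .B => 2 * n - 1
  | .C => 2 * n
  | .D => 2 * n - 2

theorem rho_eq (F : FinType) (n : ℕ) (i : Fin n) :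
    rho F n i = ((rhoTop F n - 2 * (i : ℕ) : ℤ) : ℚ) / 2 := by
  cases F <;> simp [rho, rhoTop] <;> ring

theorem e_apply {n : ℕ} (i j : Fin n) : (e i : V n) j = if j = i then 1 else 0 := by
  simp [e, Pi.single_apply]

theorem dotProduct_e {n : ℕ} (x : V n) (i : Fin n) : x ⬝ᵥ e i = x i := by simp [e]

/-- Pairing with ρ̊ measures the positivity of roots. With this normalisation s_γ lowers (ρ̊, δ) by
exactly (δ, γ), the form in which it enters `eq_simpleRoot`. -/
theorem simpleRoots_dotProduct {F : FinType} {n : ℕ} {α : V n} (hα : α ∈ simpleRoots F n) :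
    2 * (rho F n ⬝ᵥ α) = α ⬝ᵥ α ∧ 0 < α ⬝ᵥ α := by
  rcases hα with ⟨i, j, hij, rfl⟩ | hα
  · have h : i ≠ j := by rintro rfl; omega
    simp [dotProduct_sub, dotProduct_e, rho_eq, e_apply, h, h.symm, hij]
    ring
  · cases F with
    | A => exact absurd hα (Set.notMem_empty _)
    | B =>
      obtain ⟨i, hi, rfl⟩ := hα
      have : (n : ℚ) = (i : ℕ) + 1 := by exact_mod_cast hi.symm
      simp [dotProduct_e, rho_eq, e_apply, rhoTop, this]
      ring
    | C =>
      obtain ⟨i, hi, rfl⟩ := hα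
      have : (n : ℚ) = (i : ℕ) + 1 := by exact_mod_cast hi.symm
      simp [dotProduct_e, rho_eq, e_apply, rhoTop, this]
      ring
    | D =>
      obtain ⟨i, j, hi, hj, rfl⟩ := hα
      have h : i ≠ j := by rintro rfl; omega
      have h1 : (n : ℚ) = (i : ℕ) + 2 := by exact_mod_cast hi.symm
      have h2 : ((j : ℕ) : ℚ) = (i : ℕ) + 1 := by
        have : (j : ℕ) = i + 1 := by omega
        exact_mod_cast this
      simp [dotProduct_add, dotProduct_e, rho_eq, e_apply, h, h.symm, rhoTop, h1, h2]
      ring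

theorem ind_eq {n : ℕ} (a b : Fin n) :
    (if a = b then (1 : ℚ) else 0) = ((if (a : ℕ) = (b : ℕ) then 1 else 0 : ℤ) : ℚ) := by
  simp [Fin.ext_iff]

set_option maxHeartbeats 1000000 in
/-- The only positive root made negative by a simple reflection is the simple root itself. -/
theorem eq_simpleRoot {F : FinType} {n : ℕ} {γ δ : V n}
    (hγ : γ ∈ simpleRoots F n) (hδ : δ ∈ roots F n) (h0 : 0 < rho F n ⬝ᵥ δ)
    (h1 : rho F n ⬝ᵥ δ ≤ δ ⬝ᵥ γ) : δ = γ := by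
  rcases hδ with ⟨a, b, η, θ, hab, hη, hθ, hA, rfl⟩ | hδ
  -- Doubling turns the pairings into integers; the hypotheses become linear inequalities in the
  -- indices, and a finite check over signs and types leaves only δ = γ.
  · have h0' : 0 < η * (rhoTop F n - 2 * (a : ℕ)) + θ * (rhoTop F n - 2 * (b : ℕ)) := by
      simp only [dotProduct_add, dotProduct_smul, dotProduct_e, rho_eq, smul_eq_mul] at h0
      have h2 : (0 : ℚ) < ((η * (rhoTop F n - 2 * (a : ℕ)) + θ * (rhoTop F n - 2 * (b : ℕ)) : ℤ) : ℚ) := by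
        push_cast at h0 ⊢; linarith
      exact_mod_cast h2
    have hab' : (a : ℕ) ≠ b := fun h => hab (Fin.ext h)
    have ha := a.isLt
    have hb := b.isLt
    rcases hγ with ⟨i, j, hij, rfl⟩ | hγ
    · have h1' : η * (rhoTop F n - 2 * (a : ℕ)) + θ * (rhoTop F n - 2 * (b : ℕ)) ≤
          2 * (η * ((if (i : ℕ) = a then 1 else 0) - (if (j : ℕ) = a then 1 else 0)) +
            θ * ((if (i : ℕ) = b then 1 else 0) - (if (j : ℕ) = b then 1 else 0))) := by
        simp only [dotProduct_add, dotProduct_smul, dotProduct_sub, dotProduct_e, rho_eq,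
          smul_eq_mul, Pi.add_apply, Pi.smul_apply, e_apply, ind_eq] at h1
        have h2 : ((η * (rhoTop F n - 2 * (a : ℕ)) + θ * (rhoTop F n - 2 * (b : ℕ)) : ℤ) : ℚ) ≤
          ((2 * (η * ((if (i : ℕ) = a then 1 else 0) - (if (j : ℕ) = a then 1 else 0)) +
            θ * ((if (i : ℕ) = b then 1 else 0) - (if (j : ℕ) = b then 1 else 0))) : ℤ) : ℚ) := by
          push_cast at h1 ⊢; linarith
        exact_mod_cast h2
      have hj := j.isLt
      have key : ((i : ℕ) = a ∧ (j : ℕ) = b ∧ η = 1 ∧ θ = -1) ∨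
          ((i : ℕ) = b ∧ (j : ℕ) = a ∧ η = -1 ∧ θ = 1) := by
        rcases hη with rfl | rfl <;> rcases hθ with rfl | rfl <;> cases F <;>
          simp only [rhoTop] at h0' h1' hA <;> grind
      rcases key with ⟨h, h', rfl, rfl⟩ | ⟨h, h', rfl, rfl⟩
      · rw [Fin.ext h, Fin.ext h']; simp [sub_eq_add_neg]
      · rw [Fin.ext h, Fin.ext h']; simp [sub_eq_add_neg, add_comm]
    · cases F with
      | A => exact absurd hγ (Set.notMem_empty _)
      | B =>
        obtain ⟨i, hi, rfl⟩ := hγ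
        exfalso
        have h1' : η * (rhoTop .B n - 2 * (a : ℕ)) + θ * (rhoTop .B n - 2 * (b : ℕ)) ≤
            2 * (η * (if (i : ℕ) = a then 1 else 0) + θ * (if (i : ℕ) = b then 1 else 0)) := by
          simp only [dotProduct_add, dotProduct_smul, dotProduct_e, rho_eq,
            smul_eq_mul, Pi.add_apply, Pi.smul_apply, e_apply, ind_eq] at h1
          have h2 : ((η * (rhoTop .B n - 2 * (a : ℕ)) + θ * (rhoTop .B n - 2 * (b : ℕ)) : ℤ) : ℚ) ≤
            ((2 * (η * (if (i : ℕ) = a then 1 else 0) + θ * (if (i : ℕ) = b then 1 else 0)) : ℤ) : ℚ) := by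
            push_cast at h1 ⊢; linarith
          exact_mod_cast h2
        rcases hη with rfl | rfl <;> rcases hθ with rfl | rfl <;>
          simp only [rhoTop] at h0' h1' hA <;> grind
      | C =>
        obtain ⟨i, hi, rfl⟩ := hγ
        exfalso
        have h1' : η * (rhoTop .C n - 2 * (a : ℕ)) + θ * (rhoTop .C n - 2 * (b : ℕ)) ≤
            4 * (η * (if (i : ℕ) = a then 1 else 0) + θ * (if (i : ℕ) = b then 1 else 0)) := by
          simp only [dotProduct_add, dotProduct_smul, dotProduct_e, rho_eq,
            smul_eq_mul, Pi.add_apply, Pi.smul_apply, e_apply, ind_eq] at h1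
          have h2 : ((η * (rhoTop .C n - 2 * (a : ℕ)) + θ * (rhoTop .C n - 2 * (b : ℕ)) : ℤ) : ℚ) ≤
            ((4 * (η * (if (i : ℕ) = a then 1 else 0) + θ * (if (i : ℕ) = b then 1 else 0)) : ℤ) : ℚ) := by
            push_cast at h1 ⊢; linarith
          exact_mod_cast h2
        rcases hη with rfl | rfl <;> rcases hθ with rfl | rfl <;>
          simp only [rhoTop] at h0' h1' hA <;> grind
      | D =>
        obtain ⟨i, j, hi, hj, rfl⟩ := hγ
        have h1' : η * (rhoTop .D n - 2 * (a : ℕ)) + θ * (rhoTop .D n - 2 * (b : ℕ)) ≤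
          2 * (η * ((if (i : ℕ) = a then 1 else 0) + (if (j : ℕ) = a then 1 else 0)) +
            θ * ((if (i : ℕ) = b then 1 else 0) + (if (j : ℕ) = b then 1 else 0))) := by
          simp only [dotProduct_add, dotProduct_smul, dotProduct_e, rho_eq,
            smul_eq_mul, Pi.add_apply, Pi.smul_apply, e_apply, ind_eq] at h1
          have h2 : ((η * (rhoTop .D n - 2 * (a : ℕ)) + θ * (rhoTop .D n - 2 * (b : ℕ)) : ℤ) : ℚ) ≤
            ((2 * (η * ((if (i : ℕ) = a then 1 else 0) + (if (j : ℕ) = a then 1 else 0)) +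
            θ * ((if (i : ℕ) = b then 1 else 0) + (if (j : ℕ) = b then 1 else 0))) : ℤ) : ℚ) := by
            push_cast at h1 ⊢; linarith
          exact_mod_cast h2
        have key : ((i : ℕ) = a ∧ (j : ℕ) = b ∧ η = 1 ∧ θ = 1) ∨
          ((i : ℕ) = b ∧ (j : ℕ) = a ∧ η = 1 ∧ θ = 1) := by
          rcases hη with rfl | rfl <;> rcases hθ with rfl | rfl <;>
            simp only [rhoTop] at h0' h1' hA <;> grind
        rcases key with ⟨h, h', rfl, rfl⟩ | ⟨h, h', rfl, rfl⟩
        · rw [Fin.ext h, Fin.ext h']; simp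
        · rw [Fin.ext h, Fin.ext h']; simp [add_comm]
  -- The roots ±qε_a: q = 1 for the short roots of B, q = 2 for the long roots of C.
  · have main : ∀ (q : ℤ) (a : Fin n) (η : ℤ), 0 < q → F ≠ .A → F ≠ .D →
        (F = .B → q = 1) → (F = .C → q = 2) → (η = q ∨ η = -q) →
        δ = (η : ℚ) • e a → δ = γ := by
      rintro q a η hq hA hD hB hC hη rfl
      have h0' : 0 < η * (rhoTop F n - 2 * (a : ℕ)) := by
        simp only [dotProduct_smul, dotProduct_e, rho_eq, smul_eq_mul] at h0
        have h2 : (0 : ℚ) < ((η * (rhoTop F n - 2 * (a : ℕ)) : ℤ) : ℚ) := by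
          push_cast at h0 ⊢; linarith
        exact_mod_cast h2
      have ha := a.isLt
      rcases hγ with ⟨i, j, hij, rfl⟩ | hγ
      · exfalso
        have h1' : η * (rhoTop F n - 2 * (a : ℕ)) ≤
          2 * (η * ((if (i : ℕ) = a then 1 else 0) - (if (j : ℕ) = a then 1 else 0))) := by
          simp only [dotProduct_smul, dotProduct_sub, dotProduct_e, rho_eq,
            smul_eq_mul, Pi.smul_apply, e_apply, ind_eq] at h1
          have h2 : ((η * (rhoTop F n - 2 * (a : ℕ)) : ℤ) : ℚ) ≤
            ((2 * (η * ((if (i : ℕ) = a then 1 else 0) - (if (j : ℕ) = a then 1 else 0))) : ℤ) : ℚ) := by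
            push_cast at h1 ⊢; linarith
          exact_mod_cast h2
        have hj := j.isLt
        rcases hη with rfl | rfl <;> cases F <;> simp only [rhoTop] at h0' h1' <;> grind
      · cases F with
        | A => exact absurd rfl hA
        | D => exact absurd rfl hD
        | B =>
          obtain ⟨i, hi, rfl⟩ := hγ
          have := hB rfl
          subst this
          have h1' : η * (rhoTop .B n - 2 * (a : ℕ)) ≤ 2 * (η * (if (i : ℕ) = a then 1 else 0)) := by
            simp only [dotProduct_smul, dotProduct_e, rho_eq,
              smul_eq_mul, Pi.smul_apply, e_apply, ind_eq] at h1
            have h2 : ((η * (rhoTop .B n - 2 * (a : ℕ)) : ℤ) : ℚ) ≤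
              ((2 * (η * (if (i : ℕ) = a then 1 else 0)) : ℤ) : ℚ) := by
              push_cast at h1 ⊢; linarith
            exact_mod_cast h2
          have key : (i : ℕ) = a ∧ η = 1 := by
            rcases hη with rfl | rfl <;> simp only [rhoTop] at h0' h1' <;> grind
          obtain ⟨h, rfl⟩ := key
          rw [Fin.ext h]; simp
        | C =>
          obtain ⟨i, hi, rfl⟩ := hγ
          have := hC rfl
          subst this
          have h1' : η * (rhoTop .C n - 2 * (a : ℕ)) ≤ 4 * (η * (if (i : ℕ) = a then 1 else 0)) := by
            simp only [dotProduct_smul, dotProduct_e, rho_eq,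
              smul_eq_mul, Pi.smul_apply, e_apply, ind_eq] at h1
            have h2 : ((η * (rhoTop .C n - 2 * (a : ℕ)) : ℤ) : ℚ) ≤
              ((4 * (η * (if (i : ℕ) = a then 1 else 0)) : ℤ) : ℚ) := by
              push_cast at h1 ⊢; linarith
            exact_mod_cast h2
          have key : (i : ℕ) = a ∧ η = 2 := by
            rcases hη with rfl | rfl <;> simp only [rhoTop] at h0' h1' <;> grind
          obtain ⟨h, rfl⟩ := key
          rw [Fin.ext h]; simp
    cases F with
    | A => exact absurd hδ (Set.notMem_empty _)
    | D => exact absurd hδ (Set.notMem_empty _)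
    | B =>
      obtain ⟨a, η, hη, h⟩ := hδ
      exact main 1 a η (by simp) (by simp) (by simp) (by simp) (by simp) hη h
    | C =>
      obtain ⟨a, η, hη, h⟩ := hδ
      exact main 2 a η (by simp) (by simp) (by simp) (by simp) (by simp) hη h

end AffineHook

/-! ### Minimal coset representatives and strict dominance of r -/

namespace AffineHook

/-- The exchange condition. -/
theorem exists_shorter_word {T : AffType} {n : ℕ} {α : V n} (hα : α ∈ simpleRoots T.fin n)
    (l : List (Equiv.Perm (V n))) (hl : ∀ s ∈ l, s ∈ finiteReflections T n)
    (h : rho T.fin n ⬝ᵥ l.prod α ≤ 0) :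
    ∃ l' : List (Equiv.Perm (V n)), (∀ s ∈ l', s ∈ finiteReflections T n) ∧
      l'.prod = l.prod * reflection α ∧ l'.length + 1 = l.length := by
  induction l with
  | nil =>
    have := simpleRoots_dotProduct hα
    simp at h
    linarith
  | cons s l ih =>
    have hl' : ∀ s ∈ l, s ∈ finiteReflections T n := fun t ht => hl t (List.mem_cons_of_mem _ ht)
    -- Either the tail already makes α nonpositive and the letter to delete lies in it, or the first
    -- letter is responsible and is itself deleted.
    by_cases h' : rho T.fin n ⬝ᵥ l.prod α ≤ 0
    · obtain ⟨l', h1, h2, h3⟩ := ih hl' h'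
      refine ⟨s :: l', ?_, ?_, ?_⟩
      · intro t ht
        rcases List.mem_cons.1 ht with rfl | ht
        · exact hl _ List.mem_cons_self
        · exact h1 t ht
      · rw [List.prod_cons, h2, List.prod_cons, mul_assoc]
      · simp [h3]
    · obtain ⟨γ, hγ, rfl⟩ := hl s List.mem_cons_self
      have hw : l.prod ∈ weylGroup T n :=
        Subgroup.list_prod_mem _ fun t ht => Subgroup.subset_closure (hl' t ht)
      have hS := isSigned_of_mem_weylGroup hw
      have hγ' := simpleRoots_dotProduct hγ
      have key : l.prod α = γ := by
        refine eq_simpleRoot hγ (hS.apply_mem_roots hα) (not_le.1 h') ?_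
        rw [List.prod_cons] at h
        have h2 : rho T.fin n ⬝ᵥ (l.prod α - (2 * (l.prod α ⬝ᵥ γ) / (γ ⬝ᵥ γ)) • γ) ≤ 0 := h
        rw [dotProduct_sub, dotProduct_smul, smul_eq_mul, ← hγ'.1] at h2
        have h3 : rho T.fin n ⬝ᵥ γ ≠ 0 := by intro h0; rw [h0] at hγ'; linarith
        have h4 : 2 * (l.prod α ⬝ᵥ γ) / (2 * (rho T.fin n ⬝ᵥ γ)) * (rho T.fin n ⬝ᵥ γ)
          = l.prod α ⬝ᵥ γ := by field_simp
        linarith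
      -- As the tail w sends α to γ, s_γ w = w s_α; multiplying by s_α on the right leaves w.
      refine ⟨l, hl', ?_, by simp⟩
      have := hS.reflection_apply α
      rw [key] at this
      rw [List.prod_cons, this, mul_assoc, reflection_mul_self, mul_one]

/-- Otherwise the exchange condition makes u s_α shorter than u. Since (ν, α) = 0, s_α fixes ν, and
this contradicts the minimality of u in u W_ν. -/
theorem rho_dotProduct_pos {T : AffType} {n : ℕ} {u : Equiv.Perm (V n)} {ν α : V n}
    (hu : IsMinimalCosetRep T u ν) (hα : α ∈ simpleRoots T.fin n) (h : ν ⬝ᵥ α = 0) :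
    0 < rho T.fin n ⬝ᵥ u α := by
  by_contra! hneg
  have hne : {k | ∃ l : List (Equiv.Perm (V n)), (∀ s ∈ l, s ∈ finiteReflections T n) ∧
      l.prod = u ∧ l.length = k}.Nonempty := by
    have hu' := hu.1
    rw [weylGroup, ← Subgroup.mem_toSubmonoid, Subgroup.closure_toSubmonoid] at hu'
    obtain ⟨l, h1, h2⟩ := Submonoid.exists_list_of_mem_closure hu'
    refine ⟨l.length, l, fun s hs => ?_, h2, rfl⟩
    -- The generators are involutions, so words in generators and their inverses are words in
    -- generators.
    rcases h1 s hs with h | ⟨α, hα, h⟩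
    · exact h
    · refine ⟨α, hα, ?_⟩
      rw [← reflection_inv, h, inv_inv]
  obtain ⟨l, h1, h2, h3⟩ := Nat.sInf_mem hne
  subst h2
  obtain ⟨l', h1', h2', h3'⟩ := exists_shorter_word hα l h1 hneg
  have h4 := hu.2 (reflection α) (Subgroup.subset_closure ⟨α, hα, rfl⟩) (by
    change ν - (2 * (ν ⬝ᵥ α) / (α ⬝ᵥ α)) • α = ν
    simp [h])
  have h5 : wordLength (finiteReflections T n) (l.prod * reflection α) ≤ l'.length :=
    Nat.sInf_le ⟨l', h1', h2', rfl⟩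
  have h6 : l.length = wordLength (finiteReflections T n) l.prod := h3
  omega

/-- The factor `max 1 (δ ⬝ᵥ δ / 2)` is 2 for the roots ±2ε_i and 1 otherwise. It cannot be dropped:
for `A2odd`, g = 2n and (ρ̊, -2ε_1) = -2n. The same factor is recovered in
`dotProduct_simpleRoot_le`, because an integral ν pairs evenly with 2ε_n. -/
theorem neg_eta_lt_rho_dotProduct {T : AffType} {n : ℕ} (hn : T.RankOK n) {δ : V n}
    (hδ : δ ∈ roots T.fin n) : -(T.eta n * max 1 (δ ⬝ᵥ δ / 2) : ℚ) < rho T.fin n ⬝ᵥ δ := by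
  classical
  have hg : (0 : ℚ) ≤ T.eta n := Nat.cast_nonneg _
  rcases hδ with ⟨a, b, η, θ, hab, hη, hθ, hA, rfl⟩ | hδ
  · have hab' : (a : ℕ) ≠ b := fun h => hab (Fin.ext h)
    have ha := a.isLt
    have hb := b.isLt
    have key : - (2 * (T.eta n : ℤ)) <
        η * (rhoTop T.fin n - 2 * (a : ℕ)) + θ * (rhoTop T.fin n - 2 * (b : ℕ)) := by
      rcases hη with rfl | rfl <;> rcases hθ with rfl | rfl <;> cases T <;>
        simp only [rhoTop, AffType.fin, AffType.eta, AffType.RankOK] at hA hn ⊢ <;>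
        first | (exfalso; revert hA; simp; done) | omega
    have key' : ((- (2 * (T.eta n : ℤ)) : ℤ) : ℚ) <
      ((η * (rhoTop T.fin n - 2 * (a : ℕ)) + θ * (rhoTop T.fin n - 2 * (b : ℕ)) : ℤ) : ℚ) := by
      exact_mod_cast key
    refine (neg_le_neg (le_mul_of_one_le_right hg (le_max_left _ _))).trans_lt ?_
    simp only [dotProduct_add, dotProduct_smul, dotProduct_e, rho_eq, smul_eq_mul]
    push_cast at key' ⊢
    linarith
  · have main : ∀ (a : Fin n) (η : ℤ), T.fin ≠ .A → T.fin ≠ .D →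
        (T.fin = .B → η = 1 ∨ η = -1) → (T.fin = .C → η = 2 ∨ η = -2) →
        δ = (η : ℚ) • e a → -(T.eta n * max 1 (δ ⬝ᵥ δ / 2) : ℚ) < rho T.fin n ⬝ᵥ δ := by
      rintro a η hA hD hB hC rfl
      have ha := a.isLt
      have key : - (2 * (T.eta n : ℤ) * (if T.fin = .C then 2 else 1)) <
          η * (rhoTop T.fin n - 2 * (a : ℕ)) := by
        cases T <;> simp only [rhoTop, AffType.fin, AffType.eta, AffType.RankOK] at hA hD hB hC hn ⊢ <;>
          simp at hA hD hB hC ⊢ <;>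
          first | (rcases hB with rfl | rfl <;> omega) | (rcases hC with rfl | rfl <;> omega)
      have key' : ((- (2 * (T.eta n : ℤ) * (if T.fin = .C then 2 else 1)) : ℤ) : ℚ) <
          ((η * (rhoTop T.fin n - 2 * (a : ℕ)) : ℤ) : ℚ) := by
        exact_mod_cast key
      have hmax : ((if T.fin = .C then 2 else 1 : ℤ) : ℚ) ≤
          max 1 (((η : ℚ) • e a : V n) ⬝ᵥ ((η : ℚ) • e a) / 2) := by
        by_cases hF : T.fin = .C
        · refine le_max_of_le_right ?_
          rcases hC hF with rfl | rfl <;> simp [hF, dotProduct_e, e_apply]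
        · simp [hF]
      refine (neg_le_neg (mul_le_mul_of_nonneg_left hmax hg)).trans_lt ?_
      simp only [dotProduct_smul, dotProduct_e, rho_eq, smul_eq_mul]
      push_cast at key' ⊢
      linarith
    generalize hF : T.fin = F at *
    cases F with
    | A => exact absurd hδ (Set.notMem_empty _)
    | D => exact absurd hδ (Set.notMem_empty _)
    | B =>
      obtain ⟨a, η, hη, h⟩ := hδ
      exact main a η (by simp) (by simp) (by simpa using hη) (by simp) h
    | C =>
      obtain ⟨a, η, hη, h⟩ := hδ
      exact main a η (by simp) (by simp) (by simp) (by simpa using hη) h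

theorem rVector_dotProduct {T : AffType} {n : ℕ} {u : Equiv.Perm (V n)} (hu : u ∈ weylGroup T n)
    (ν α : V n) :
    rVector T u ν ⬝ᵥ α = -((T.eta n : ℚ) * (ν ⬝ᵥ α)) + rho T.fin n ⬝ᵥ u α := by
  have h := (isSigned_of_mem_weylGroup hu).dotProduct (u⁻¹ (rho T.fin n)) α
  have h' : u (u⁻¹ (rho T.fin n)) = rho T.fin n := u.apply_symm_apply _
  rw [h'] at h
  simp only [rVector, weight, sub_add_cancel, add_dotProduct, neg_dotProduct, smul_dotProduct,
    smul_eq_mul, h]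

theorem dotProduct_simpleRoot_le {F : FinType} {n : ℕ} {α ν : V n} (hα : α ∈ simpleRoots F n)
    {z : Fin n → ℤ} (hz : ∀ i, ν i = z i) (h : ν ⬝ᵥ α < 0) :
    ν ⬝ᵥ α ≤ -max 1 (α ⬝ᵥ α / 2) := by
  have aux : ∀ k : ℤ, (k : ℚ) < 0 → (k : ℚ) ≤ -1 := by
    intro k hk
    have h1 : k < 0 := by exact_mod_cast hk
    have h2 : k ≤ -1 := by omega
    exact_mod_cast h2
  rcases hα with ⟨i, j, hij, rfl⟩ | hα
  · have hne : i ≠ j := by rintro rfl; omega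
    have := aux (z i - z j)
    simp [dotProduct_sub, dotProduct_e, hz, e_apply, hne, hne.symm] at h this ⊢
    linarith [this h]
  · cases F with
    | A => exact absurd hα (Set.notMem_empty _)
    | B =>
      obtain ⟨i, hi, rfl⟩ := hα
      have := aux (z i)
      simp [dotProduct_e, hz, e_apply] at h this ⊢
      norm_num
      linarith [this h]
    | C =>
      obtain ⟨i, hi, rfl⟩ := hα
      have := aux (z i)
      simp [dotProduct_e, hz, e_apply] at h this ⊢
      linarith [this (by have h' : (z i : ℚ) < 0 := by linarith
                         exact_mod_cast h')]
    | D =>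
      obtain ⟨i, j, hi, hj, rfl⟩ := hα
      have hne : i ≠ j := by rintro rfl; omega
      have := aux (z i + z j)
      simp [dotProduct_add, dotProduct_e, hz, e_apply, hne, hne.symm] at h this ⊢
      linarith [this h]

/-- `r` is strictly dominant. -/
theorem rVector_dotProduct_pos {T : AffType} {n : ℕ} (hn : T.RankOK n) {u : Equiv.Perm (V n)}
    {ν : V n} (hν : ν ∈ translationLattice T n) (hν' : Antidominant T ν)
    (hu : IsMinimalCosetRep T u ν) {α : V n} (hα : α ∈ simpleRoots T.fin n) :
    0 < rVector T u ν ⬝ᵥ α := by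
  obtain ⟨z, hz, -⟩ := hν
  rw [rVector_dotProduct hu.1]
  -- Here (r, α) = -g(ν, α) + (ρ̊, uα). If (ν, α) = 0, the second term is positive by minimality of
  -- u; otherwise the first term is at least g max(1, (α, α)/2) and outweighs the second.
  rcases (hν' α hα).eq_or_lt with h | h
  · rw [h]; simpa using rho_dotProduct_pos hu hα h
  · have hS := isSigned_of_mem_weylGroup hu.1
    have h1 := neg_eta_lt_rho_dotProduct hn (hS.apply_mem_roots hα)
    rw [hS.dotProduct] at h1
    have h2 := dotProduct_simpleRoot_le hα hz h
    have h3 : (0 : ℚ) ≤ T.eta n := Nat.cast_nonneg _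
    nlinarith

theorem rVector_strictAnti {T : AffType} {n : ℕ} (hn : T.RankOK n) {u : Equiv.Perm (V n)}
    {ν : V n} (hν : ν ∈ translationLattice T n) (hν' : Antidominant T ν)
    (hu : IsMinimalCosetRep T u ν) : StrictAnti (rVector T u ν) := by
  cases n with
  | zero => intro i; exact i.elim0
  | succ m =>
    rw [Fin.strictAnti_iff_succ_lt]
    intro i
    have := rVector_dotProduct_pos hn hν hν' hu (α := e i.castSucc - e i.succ)
      (Or.inl ⟨i.castSucc, i.succ, by simp, rfl⟩)
    rw [dotProduct_sub, dotProduct_e, dotProduct_e] at this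
    linarith

theorem rVector_pos {T : AffType} {n : ℕ} (hn : T.RankOK n) {u : Equiv.Perm (V n)}
    {ν : V n} (hν : ν ∈ translationLattice T n) (hν' : Antidominant T ν)
    (hu : IsMinimalCosetRep T u ν) (hF : T.fin = .B ∨ T.fin = .C) (i : Fin n) :
    0 < rVector T u ν i := by
  have hi := i.isLt
  let j : Fin n := ⟨n - 1, by omega⟩
  have hj : 0 < rVector T u ν j := by
    have h := fun α => rVector_dotProduct_pos hn hν hν' hu (α := α)
    rcases hF with hF | hF
    · have := h (e j) (by rw [hF]; exact Or.inr ⟨j, by simp [j]; omega, rfl⟩)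
      rwa [dotProduct_e] at this
    · have := h ((2 : ℚ) • e j) (by rw [hF]; exact Or.inr ⟨j, by simp [j]; omega, rfl⟩)
      rw [dotProduct_smul, dotProduct_e, smul_eq_mul] at this
      linarith
  have : i ≤ j := Fin.le_def.2 (by simp [j]; omega)
  exact hj.trans_le ((rVector_strictAnti hn hν hν' hu).antitone this)

/-- In type D the last coordinate may be zero or negative; the simple root ε_{n-1} + ε_n controls
the smallest sum of two coordinates, and monotonicity gives the others. -/
theorem rVector_add_pos {T : AffType} {n : ℕ} (hn : T.RankOK n) {u : Equiv.Perm (V n)}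
    {ν : V n} (hν : ν ∈ translationLattice T n) (hν' : Antidominant T ν)
    (hu : IsMinimalCosetRep T u ν) (hF : T.fin ≠ .A) {i j : Fin n} (hij : i < j) :
    0 < rVector T u ν i + rVector T u ν j := by
  by_cases hBC : T.fin = .B ∨ T.fin = .C
  · exact add_pos (rVector_pos hn hν hν' hu hBC i) (rVector_pos hn hν hν' hu hBC j)
  have hD : T.fin = .D := by
    cases h : T.fin <;> simp_all
  have hj' := j.isLt
  have hij' := Fin.lt_def.1 hij
  let a : Fin n := ⟨n - 2, by omega⟩
  let b : Fin n := ⟨n - 1, by omega⟩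
  have h := rVector_dotProduct_pos hn hν hν' hu (α := e a + e b)
    (by rw [hD]; exact Or.inr ⟨a, b, by simp [a]; omega, by simp [b]; omega, rfl⟩)
  rw [dotProduct_add, dotProduct_e, dotProduct_e] at h
  have hanti := (rVector_strictAnti hn hν hν' hu).antitone
  have h1 : i ≤ a := Fin.le_def.2 (by simp [a]; omega)
  have h2 : j ≤ b := Fin.le_def.2 (by simp [b]; omega)
  linarith [hanti h1, hanti h2]

/-- `r` is in the orbit of `ρ̊ - g β`. -/
theorem rVector_signed {T : AffType} {n : ℕ} {c u : Equiv.Perm (V n)} {ν : V n}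
    (hu : u ∈ weylGroup T n) (hcu : c = u * translation ν) {β : Fin n → ℤ}
    (hβ : ∀ i, c 0 i = β i) :
    ∃ (σ : Equiv.Perm (Fin n)) (η : Fin n → ℤ), (∀ i, η i = 1 ∨ η i = -1) ∧
      (T.fin = .A → ∀ i, η i = 1) ∧
      ∀ i, rVector T u ν i = η i * (rho T.fin n (σ i) - T.eta n * β (σ i)) := by
  obtain ⟨σ, η, h1, h2, h3⟩ := (isSigned_of_mem_weylGroup hu).inv
  refine ⟨σ, η, h1, h2, fun i => ?_⟩
  -- From c(0) = u(ν) one gets ν = u⁻¹(β), hence r = u⁻¹(ρ̊ - gβ).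
  have hν : ν = u⁻¹ (fun i => (β i : ℚ)) := by
    have : u ν = fun i => (β i : ℚ) := by
      ext i
      rw [← hβ i, hcu]
      simp [translation]
    rw [← this]
    exact (u.symm_apply_apply ν).symm
  have h4 := h3 (fun i => (β i : ℚ)) i
  rw [← hν] at h4
  have h5 : rVector T u ν i = -(T.eta n * ν i) + u⁻¹ (rho T.fin n) i := by
    simp [rVector, weight]
  rw [h5, h3, h4]
  ring

end AffineHook

namespace AffineHook

/-! ## Maya diagrams and their autocorrelation -/

/-- The indicator function of a Maya diagram. -/
structure IsMaya (χ : ℤ → ℤ) : Prop where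
  bin : ∀ z, χ z = 0 ∨ χ z = 1
  bdd : ∃ N : ℤ, ∀ z, (z < -N → χ z = 1) ∧ (N < z → χ z = 0)

theorem finite_support_of_bdd {f : ℤ → ℤ} (N : ℤ) (h : ∀ z, z < -N ∨ N < z → f z = 0) :
    (Function.support f).Finite := by
  refine (Set.finite_Icc (-N) N).subset fun z hz => ?_
  by_contra hz'
  refine hz (h z ?_)
  rw [Set.mem_Icc] at hz'
  omega

/-- The number of pairs `(z, z - h)` with `z` in the diagram and `z - h` not in it. -/
noncomputable def corr (χ : ℤ → ℤ) (h : ℤ) : ℤ := ∑ᶠ z, χ z * (1 - χ (z - h))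

theorem IsMaya.finite_mul {χ : ℤ → ℤ} (hχ : IsMaya χ) (a b : ℤ) :
    (Function.support fun z => χ (z - a) * (1 - χ (z - b))).Finite := by
  obtain ⟨N, hN⟩ := hχ.bdd
  refine finite_support_of_bdd (|N| + |a| + |b|) fun z hz => ?_
  rcases hz with hz | hz
  · rw [(hN (z - b)).1 (by grind)]; simp
  · rw [(hN (z - a)).2 (by grind)]; simp

theorem finite_sub {χ χ' : ℤ → ℤ} (hχ : IsMaya χ) (hχ' : IsMaya χ') (a b : ℤ) :
    (Function.support fun z => χ (z - a) - χ' (z - b)).Finite := by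
  obtain ⟨N, hN⟩ := hχ.bdd
  obtain ⟨N', hN'⟩ := hχ'.bdd
  refine finite_support_of_bdd (|N| + |N'| + |a| + |b|) fun z hz => ?_
  rcases hz with hz | hz
  · rw [(hN (z - a)).1 (by grind), (hN' (z - b)).1 (by grind)]; simp
  · rw [(hN (z - a)).2 (by grind), (hN' (z - b)).2 (by grind)]; simp

theorem finsum_shift (f : ℤ → ℤ) (a : ℤ) : ∑ᶠ z, f (z - a) = ∑ᶠ z, f z :=
  finsum_comp_equiv (Equiv.subRight a) (f := f)

theorem corr_shift (χ : ℤ → ℤ) (h a : ℤ) :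
    corr χ h = ∑ᶠ z, χ (z - a) * (1 - χ (z - (a + h))) := by
  rw [corr, ← finsum_shift _ a]
  simp only [sub_sub]

theorem corr_zero {χ : ℤ → ℤ} (hχ : IsMaya χ) : corr χ 0 = 0 := by
  rw [corr, ← finsum_zero (M := ℤ) (α := ℤ)]
  congr 1
  ext z
  rcases hχ.bin z with h | h <;> simp [h]

/-- The second difference of the autocorrelation is the autocorrelation of the first difference. -/
theorem corr_second_diff {χ : ℤ → ℤ} (hχ : IsMaya χ) (g k : ℤ) :
    corr χ (k + g) + corr χ (k - g) - 2 * corr χ k =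
      ∑ᶠ z, (χ (z - g) - χ z) * (χ (z - k - g) - χ (z - k)) := by
  have e1 : corr χ (k + g) = ∑ᶠ z, χ (z - 0) * (1 - χ (z - (k + g))) := by
    rw [corr_shift χ _ 0, zero_add]
  have e2 : corr χ (k - g) = ∑ᶠ z, χ (z - g) * (1 - χ (z - k)) := by
    rw [corr_shift χ _ g, add_sub_cancel]
  -- The two copies of `corr χ k` are written with different shifts, 0 and g, so that the four
  -- summands factor into a product of two first differences.
  have e3 : corr χ k = ∑ᶠ z, χ (z - 0) * (1 - χ (z - k)) := by
    rw [corr_shift χ _ 0, zero_add]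
  have e4 : corr χ k = ∑ᶠ z, χ (z - g) * (1 - χ (z - (k + g))) := by
    rw [corr_shift χ _ g, add_comm]
  rw [two_mul]
  nth_rw 1 [e3]
  rw [e4, e1, e2, ← finsum_add_distrib (hχ.finite_mul _ _) (hχ.finite_mul _ _),
    ← finsum_add_distrib (hχ.finite_mul _ _) (hχ.finite_mul _ _), ← finsum_sub_distrib]
  · congr 1
    ext z
    rw [sub_zero, sub_sub]
    ring
  · exact ((hχ.finite_mul _ _).union (hχ.finite_mul _ _)).subset (Function.support_add _ _)
  · exact ((hχ.finite_mul _ _).union (hχ.finite_mul _ _)).subset (Function.support_add _ _)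

/-- The quadratic terms cancel in `corr χ (-h) - corr χ h`, leaving ∑ (χ(z-h) - χ(z)). For two
diagrams, χ - χ' has finite support, so its sum is unchanged by a shift and the two values agree. -/
theorem corr_neg_sub {χ χ' : ℤ → ℤ} (hχ : IsMaya χ) (hχ' : IsMaya χ') (h : ℤ) :
    corr χ (-h) - corr χ h = corr χ' (-h) - corr χ' h := by
  have key : ∀ {χ : ℤ → ℤ}, IsMaya χ →
      corr χ (-h) - corr χ h = ∑ᶠ z, (χ (z - h) - χ (z - 0)) := by
    intro χ hχ
    rw [corr_shift χ (-h) h, corr_shift χ h 0,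
      ← finsum_sub_distrib (hχ.finite_mul _ _) (hχ.finite_mul _ _)]
    congr 1
    ext z
    simp only [add_neg_cancel, zero_add, sub_zero]
    ring
  rw [key hχ, key hχ', ← sub_eq_zero, ← finsum_sub_distrib (finite_sub hχ hχ _ _)
    (finite_sub hχ' hχ' _ _)]
  have e : ∀ z, (χ (z - h) - χ (z - 0)) - (χ' (z - h) - χ' (z - 0)) =
      (χ (z - h) - χ' (z - h)) - (χ (z - 0) - χ' (z - 0)) := fun z => by ring
  rw [finsum_congr e, finsum_sub_distrib (finite_sub hχ hχ' _ _) (finite_sub hχ hχ' _ _), sub_eq_zero,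
    finsum_shift (fun z => χ z - χ' z), finsum_shift (fun z => χ z - χ' z)]

/-! ## First differences which are sums of point masses -/

/-- The number of `j` with `τ_j = z`. -/
def pointCount {n : ℕ} (τ : Fin n → ℤ) (z : ℤ) : ℤ := ∑ j, if z = τ j then 1 else 0

theorem finsum_pointCount_mul {n : ℕ} (τ : Fin n → ℤ) (F : ℤ → ℤ) :
    ∑ᶠ z, pointCount τ z * F z = ∑ j, F (τ j) := by
  have e : ∀ z, pointCount τ z * F z = ∑ j, (if z = τ j then 1 else 0) * F z := fun z => by
    rw [pointCount, Finset.sum_mul]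
  rw [finsum_congr e, finsum_sum_comm]
  · refine Finset.sum_congr rfl fun j _ => ?_
    rw [finsum_eq_single _ (τ j)]
    · simp
    · intro z hz; simp [hz]
  · intro j _
    refine (Set.finite_singleton (τ j)).subset fun z hz => ?_
    by_contra h
    simp only [Set.mem_singleton_iff] at h
    simp [h] at hz

theorem finite_pointCount {n : ℕ} (τ : Fin n → ℤ) : (Function.support (pointCount τ)).Finite := by
  refine (Set.finite_range τ).subset fun z hz => ?_
  by_contra h
  refine hz (Finset.sum_eq_zero fun j _ => ?_)
  rw [if_neg]
  rintro rfl
  exact h ⟨j, rfl⟩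

/-- The number of `(i, j)` and signs with `± t_i ± t_j = k`, one of each opposite pair of vectors
`(t_i, t_j)`, `(-t_j, -t_i)` counted for each order of `i` and `j`. -/
def pairCount {n : ℕ} (t : V n) (k : ℤ) : ℤ :=
  ∑ i, ∑ j, ((if t i - t j = k then 1 else 0) + (if t j - t i = k then 1 else 0) +
    (if t i + t j = k then 1 else 0) + (if -(t i + t j) = k then 1 else 0))

/-- The number of `j` and signs with `± t_j = q`. -/
def absCount {n : ℕ} (t : V n) (q : ℚ) : ℤ :=
  ∑ j, ((if t j = q then 1 else 0) + (if -t j = q then 1 else 0))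

/-- The first difference `χ(z - g) - χ(z)` of a Maya diagram symmetric about `-s/2`. -/
def symDiff (g s a b₀ b₁ : ℤ) {n : ℕ} (t : V n) (z : ℤ) : ℤ :=
  absCount t (z - ((g : ℚ) - s) / 2) + a * (if 2 * z = g - s then 1 else 0) +
    b₀ * (if z = 0 then 1 else 0) + b₁ * (if z = g then 1 else 0)

/-- The part of `symDiff` which does not depend on `t`. -/
def extraDiff (g s a b₀ b₁ z : ℤ) : ℤ :=
  a * (if 2 * z = g - s then 1 else 0) + b₀ * (if z = 0 then 1 else 0) +
    b₁ * (if z = g then 1 else 0)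

theorem finite_extraDiff (g s a b₀ b₁ : ℤ) : (Function.support (extraDiff g s a b₀ b₁)).Finite := by
  refine finite_support_of_bdd (|g| + |s|) fun z hz => ?_
  have h1 : 2 * z ≠ g - s := by grind
  have h2 : z ≠ 0 := by grind
  have h3 : z ≠ g := by grind
  simp [extraDiff, h1, h2, h3]

theorem if_congr_prop {p q : Prop} [Decidable p] [Decidable q] (h : p ↔ q) :
    (if p then (1 : ℤ) else 0) = if q then 1 else 0 := by simp [h]

/-- Each coordinate t_j stands for two point masses, at τ_j and at its mirror image g - s - τ_j;
measured from the centre (g-s)/2 they sit at -t_j and t_j. -/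
theorem absCount_eq_pointCount {n : ℕ} {g s : ℤ} {t : V n} {τ : Fin n → ℤ}
    (hτ : ∀ j, t j = ((g : ℚ) - s) / 2 - τ j) (z : ℤ) :
    absCount t (z - ((g : ℚ) - s) / 2) = pointCount τ z + pointCount (fun j => g - s - τ j) z := by
  rw [absCount, pointCount, pointCount, ← Finset.sum_add_distrib]
  refine Finset.sum_congr rfl fun j _ => ?_
  rw [add_comm]
  congr 1
  · refine if_congr_prop ?_
    rw [hτ]
    constructor
    · intro h; have : (z : ℚ) = τ j := by linarith
      exact_mod_cast this
    · rintro rfl; ring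
  · refine if_congr_prop ?_
    rw [hτ]
    constructor
    · intro h; have : (z : ℚ) = g - s - τ j := by linarith
      exact_mod_cast this
    · rintro rfl; push_cast; ring

theorem finsum_absCount_mul {n : ℕ} {g s : ℤ} {t : V n} {τ : Fin n → ℤ}
    (hτ : ∀ j, t j = ((g : ℚ) - s) / 2 - τ j) (F : ℤ → ℤ) :
    ∑ᶠ z : ℤ, absCount t (z - ((g : ℚ) - s) / 2) * F z = ∑ j, (F (τ j) + F (g - s - τ j)) := by
  have e : ∀ z : ℤ, absCount t (z - ((g : ℚ) - s) / 2) * F z =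
      pointCount τ z * F z + pointCount (fun j => g - s - τ j) z * F z := fun z => by
    rw [absCount_eq_pointCount hτ, add_mul]
  rw [finsum_congr e, finsum_add_distrib, finsum_pointCount_mul, finsum_pointCount_mul,
    Finset.sum_add_distrib]
  · exact (finite_pointCount _).subset (Function.support_mul_subset_left _ _)
  · exact (finite_pointCount _).subset (Function.support_mul_subset_left _ _)

theorem finite_absCount {n : ℕ} {g s : ℤ} {t : V n} {τ : Fin n → ℤ}
    (hτ : ∀ j, t j = ((g : ℚ) - s) / 2 - τ j) :
    (Function.support fun z : ℤ => absCount t (z - ((g : ℚ) - s) / 2)).Finite := by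
  have e : (fun z : ℤ => absCount t (z - ((g : ℚ) - s) / 2)) =
      fun z => pointCount τ z + pointCount (fun j => g - s - τ j) z :=
    funext (absCount_eq_pointCount hτ)
  rw [e]
  exact ((finite_pointCount _).union (finite_pointCount _)).subset (Function.support_add _ _)

/-- The autocorrelation of `symDiff`. -/
theorem finsum_symDiff_mul {n : ℕ} {g s a b₀ b₁ : ℤ} {t : V n} {τ : Fin n → ℤ}
    (hτ : ∀ j, t j = ((g : ℚ) - s) / 2 - τ j) (hb : s = 0 ∨ b₀ = 0 ∧ b₁ = 0) (k : ℤ) :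
    ∑ᶠ z, symDiff g s a b₀ b₁ t z * symDiff g s a b₀ b₁ t (z - k) =
      pairCount t k + 2 * a * absCount t k +
        (b₀ + b₁) * (absCount t (k - (g : ℚ) / 2) + absCount t (k + (g : ℚ) / 2)) +
        ∑ᶠ z, extraDiff g s a b₀ b₁ z * extraDiff g s a b₀ b₁ (z - k) := by
  -- R is the part carried by t and E the fixed part. R·R yields `pairCount`, the two cross terms
  -- yield the `absCount` terms, and E·E does not involve t.
  set R : ℤ → ℤ := fun z => absCount t (z - ((g : ℚ) - s) / 2) with hR
  set E := extraDiff g s a b₀ b₁ with hE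
  have e0 : ∀ z, symDiff g s a b₀ b₁ t z = R z + E z := fun z => by
    simp only [symDiff, hR, hE, extraDiff]; ring
  have fR : (Function.support R).Finite := finite_absCount hτ
  have fE : (Function.support E).Finite := finite_extraDiff _ _ _ _ _
  have e1 : ∀ z, symDiff g s a b₀ b₁ t z * symDiff g s a b₀ b₁ t (z - k) =
      R z * (R (z - k) + E (z - k)) + (E z * R (z - k) + E z * E (z - k)) := fun z => by
    rw [e0, e0]; ring
  have e2 : ∑ᶠ z, E z * R (z - k) = ∑ᶠ z, R z * E (z + k) := by
    rw [← finsum_shift (fun z => R z * E (z + k)) k]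
    refine finsum_congr fun z => ?_
    rw [sub_add_cancel, mul_comm]
  rw [finsum_congr e1, finsum_add_distrib, finsum_add_distrib, e2, ← add_assoc]
  · congr 1
    rw [finsum_absCount_mul hτ, finsum_absCount_mul hτ, ← Finset.sum_add_distrib]
    simp only [pairCount, absCount, Finset.mul_sum, ← Finset.sum_add_distrib]
    refine Finset.sum_congr rfl fun j _ => ?_
    have hR' : R (τ j - k) + R (g - s - τ j - k) = ∑ l, ((if t j - t l = k then 1 else 0) +
        (if t l - t j = k then 1 else 0) + (if t j + t l = k then 1 else 0) +
        (if -(t j + t l) = k then 1 else 0)) := by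
      simp only [hR, absCount, ← Finset.sum_add_distrib]
      refine Finset.sum_congr rfl fun l _ => ?_
      have h := hτ j
      have r1 : (if t l = ((τ j - k : ℤ) : ℚ) - ((g : ℚ) - s) / 2 then (1 : ℤ) else 0) = if -(t j + t l) = k then 1 else 0 := by
        refine if_congr_prop ?_
        push_cast; constructor <;> intro h' <;> linarith
      have r2 : (if -t l = ((τ j - k : ℤ) : ℚ) - ((g : ℚ) - s) / 2 then (1 : ℤ) else 0) = if t l - t j = k then 1 else 0 := by
        refine if_congr_prop ?_
        push_cast; constructor <;> intro h' <;> linarith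
      have r3 : (if t l = ((g - s - τ j - k : ℤ) : ℚ) - ((g : ℚ) - s) / 2 then (1 : ℤ) else 0) = if t j - t l = k then 1 else 0 := by
        refine if_congr_prop ?_
        push_cast; constructor <;> intro h' <;> linarith
      have r4 : (if -t l = ((g - s - τ j - k : ℤ) : ℚ) - ((g : ℚ) - s) / 2 then (1 : ℤ) else 0) = if t j + t l = k then 1 else 0 := by
        refine if_congr_prop ?_
        push_cast; constructor <;> intro h' <;> linarith
      rw [r1, r2, r3, r4]
      ring
    have h := hτ j
    have a1 : (if 2 * (τ j + k) = g - s then (1 : ℤ) else 0) = if t j = k then 1 else 0 := by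
      refine if_congr_prop ?_
      rw [← Int.cast_inj (α := ℚ)]; push_cast; constructor <;> intro h' <;> linarith
    have a2 : (if 2 * (g - s - τ j + k) = g - s then (1 : ℤ) else 0) = if -t j = k then 1 else 0 := by
      refine if_congr_prop ?_
      rw [← Int.cast_inj (α := ℚ)]; push_cast; constructor <;> intro h' <;> linarith
    have a3 : (if 2 * (τ j - k) = g - s then (1 : ℤ) else 0) = if -t j = k then 1 else 0 := by
      refine if_congr_prop ?_
      rw [← Int.cast_inj (α := ℚ)]; push_cast; constructor <;> intro h' <;> linarith
    have a4 : (if 2 * (g - s - τ j - k) = g - s then (1 : ℤ) else 0) = if t j = k then 1 else 0 := by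
      refine if_congr_prop ?_
      rw [← Int.cast_inj (α := ℚ)]; push_cast; constructor <;> intro h' <;> linarith
    -- For s = 0 the reflection z ↦ g - z preserves R and exchanges 0 and g, so the two masses
    -- contribute alike and only b₀ + b₁ matters.
    rcases hb with rfl | ⟨rfl, rfl⟩
    · have c1 : (if τ j + k = 0 then (1 : ℤ) else 0) = if t j = k + g / 2 then 1 else 0 := by
        refine if_congr_prop ?_
        rw [← Int.cast_inj (α := ℚ)]; push_cast at h ⊢; constructor <;> intro h' <;> linarith
      have c2 : (if τ j - k = 0 then (1 : ℤ) else 0) = if -t j = k - g / 2 then 1 else 0 := by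
        refine if_congr_prop ?_
        rw [← Int.cast_inj (α := ℚ)]; push_cast at h ⊢; constructor <;> intro h' <;> linarith
      have c3 : (if g - 0 - τ j + k = 0 then (1 : ℤ) else 0) = if -t j = k + g / 2 then 1 else 0 := by
        refine if_congr_prop ?_
        rw [← Int.cast_inj (α := ℚ)]; push_cast at h ⊢; constructor <;> intro h' <;> linarith
      have c4 : (if g - 0 - τ j - k = 0 then (1 : ℤ) else 0) = if t j = k - g / 2 then 1 else 0 := by
        refine if_congr_prop ?_
        rw [← Int.cast_inj (α := ℚ)]; push_cast at h ⊢; constructor <;> intro h' <;> linarith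
      have d1 : (if τ j + k = g then (1 : ℤ) else 0) = if t j = k - g / 2 then 1 else 0 := by
        refine if_congr_prop ?_
        rw [← Int.cast_inj (α := ℚ)]; push_cast at h ⊢; constructor <;> intro h' <;> linarith
      have d2 : (if τ j - k = g then (1 : ℤ) else 0) = if -t j = k + g / 2 then 1 else 0 := by
        refine if_congr_prop ?_
        rw [← Int.cast_inj (α := ℚ)]; push_cast at h ⊢; constructor <;> intro h' <;> linarith
      have d3 : (if g - 0 - τ j + k = g then (1 : ℤ) else 0) = if -t j = k - g / 2 then 1 else 0 := by
        refine if_congr_prop ?_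
        rw [← Int.cast_inj (α := ℚ)]; push_cast at h ⊢; constructor <;> intro h' <;> linarith
      have d4 : (if g - 0 - τ j - k = g then (1 : ℤ) else 0) = if t j = k + g / 2 then 1 else 0 := by
        refine if_congr_prop ?_
        rw [← Int.cast_inj (α := ℚ)]; push_cast at h ⊢; constructor <;> intro h' <;> linarith
      rw [← hR']
      simp only [hE, extraDiff, a1, a2, a3, a4, c1, c2, c3, c4, d1, d2, d3, d4]
      ring
    · rw [← hR']
      simp only [hE, extraDiff, a1, a2, a3, a4]
      ring
  · refine fE.subset fun z hz h => hz ?_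
    simp only [h, zero_mul]
  · refine fE.subset fun z hz h => hz ?_
    simp only [h, zero_mul]
  · refine fR.subset fun z hz h => hz ?_
    simp only [h, zero_mul]
  · refine fE.subset fun z hz h => hz ?_
    simp only [h, zero_mul, add_zero]

end AffineHook

/-! ### The word of a partition: boxes as pairs of letters -/

namespace AffineHook
open Classical in
/-- The indicator function of the letters `0` of the word of `μ`. -/
noncomputable def letter (μ : YoungDiagram) (k : ℤ) : ℤ := if IsZeroLetter μ k then 1 else 0

/-- The position of the letter `0` belonging to row `i`. -/
def rowPos (μ : YoungDiagram) (i : ℕ) : ℤ := (μ.rowLen i : ℤ) - (i + 1)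

/-- The position of the letter `1` belonging to column `j`. -/
def colPos (μ : YoungDiagram) (j : ℕ) : ℤ := (j : ℤ) - μ.colLen j

variable (μ : YoungDiagram)

theorem rowPos_strictAnti : StrictAnti (rowPos μ) := by
  intro i j h
  have := μ.rowLen_anti i j h.le
  simp only [rowPos]
  omega

theorem colPos_strictMono : StrictMono (colPos μ) := by
  intro i j h
  have := μ.colLen_anti i j h.le
  simp only [colPos]
  omega

/-- The difference of the two positions is (`μ.rowLen i` - j) + (`μ.colLen j` - i) - 1. Both
brackets are positive if the box lies in μ, and both are nonpositive otherwise; in the first case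
the difference is the hook length. -/
theorem colPos_lt_rowPos_iff {i j : ℕ} : colPos μ j < rowPos μ i ↔ (i, j) ∈ μ := by
  have h1 := μ.mem_iff_lt_rowLen (i := i) (j := j)
  have h2 := μ.mem_iff_lt_colLen (i := i) (j := j)
  simp only [rowPos, colPos]
  by_cases h : (i, j) ∈ μ
  · rw [iff_true_right h]
    have := h1.1 h; have := h2.1 h
    omega
  · rw [iff_false_right h]
    rw [h1, not_lt] at h
    have h' : ¬ i < μ.colLen j := by rw [← h2, h1]; omega
    omega

theorem rowPos_ne_colPos (i j : ℕ) : rowPos μ i ≠ colPos μ j := by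
  have h1 := μ.mem_iff_lt_rowLen (i := i) (j := j)
  have h2 := μ.mem_iff_lt_colLen (i := i) (j := j)
  simp only [rowPos, colPos]
  rw [h1] at h2
  omega

/-- Together with `rowPos_ne_colPos`, this shows that rows and columns label complementary sets of
integers. If i is the first row with `rowPos μ i ≤ k`, the column k + i has length exactly i. -/
theorem exists_colPos_of_not_isZeroLetter {k : ℤ} (hk : ¬ IsZeroLetter μ k) :
    ∃ j, colPos μ j = k := by
  have hex : ∃ i, rowPos μ i ≤ k := by
    refine ⟨(μ.rowLen 0 + k.natAbs), ?_⟩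
    have := μ.rowLen_anti 0 (μ.rowLen 0 + k.natAbs) (Nat.zero_le _)
    simp only [rowPos]
    omega
  have hne : ∀ i, rowPos μ i ≠ k := fun i h => hk ⟨i, h.symm⟩
  have h1 := Nat.find_spec hex
  have h2 : ∀ i' < Nat.find hex, k < rowPos μ i' := fun i' hi' => not_le.1 (Nat.find_min hex hi')
  generalize Nat.find hex = i at h1 h2
  have h3 := hne i
  simp only [rowPos] at h1 h2 h3
  obtain ⟨j, hj⟩ : ∃ j : ℕ, (j : ℤ) = k + i := ⟨(k + i).toNat, by omega⟩
  refine ⟨j, ?_⟩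
  have h4 : ¬ i < μ.colLen j := by
    rw [← μ.mem_iff_lt_colLen, μ.mem_iff_lt_rowLen]; omega
  have h5 : ∀ i' < i, i' < μ.colLen j := by
    intro i' hi'
    rw [← μ.mem_iff_lt_colLen, μ.mem_iff_lt_rowLen]
    have h6 := h2 (i - 1) (by omega)
    have h7 := μ.rowLen_anti i' (i - 1) (by omega)
    omega
  have h6 : μ.colLen j = i := by
    rcases Nat.eq_zero_or_pos i with h | h
    · omega
    · have := h5 (i - 1) (by omega); omega
  simp only [colPos]
  omega

theorem isZeroLetter_rowPos (i : ℕ) : IsZeroLetter μ (rowPos μ i) := ⟨i, rfl⟩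

theorem not_isZeroLetter_colPos (j : ℕ) : ¬ IsZeroLetter μ (colPos μ j) :=
  fun ⟨i, h⟩ => rowPos_ne_colPos μ i j h.symm

theorem letter_rowPos (i : ℕ) : letter μ (rowPos μ i) = 1 := if_pos (isZeroLetter_rowPos μ i)

theorem letter_colPos (j : ℕ) : letter μ (colPos μ j) = 0 := if_neg (not_isZeroLetter_colPos μ j)

theorem exists_rowPos_of_letter {k : ℤ} (h : letter μ k ≠ 0) : ∃ i, rowPos μ i = k := by
  by_contra hk
  refine h (if_neg ?_)
  rintro ⟨i, hi⟩
  exact hk ⟨i, hi.symm⟩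

theorem exists_colPos_of_letter {k : ℤ} (h : letter μ k ≠ 1) : ∃ j, colPos μ j = k :=
  exists_colPos_of_not_isZeroLetter μ fun hk => h (if_pos hk)

theorem isMaya_letter : IsMaya (letter μ) := by
  refine ⟨fun z => ?_, μ.rowLen 0 + μ.colLen 0, fun z => ⟨fun hz => ?_, fun hz => ?_⟩⟩
  · by_cases h : IsZeroLetter μ z
    · exact Or.inr (if_pos h)
    · exact Or.inl (if_neg h)
  · by_contra h
    obtain ⟨j, rfl⟩ := exists_colPos_of_letter μ h
    have := μ.colLen_anti 0 j (Nat.zero_le _)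
    simp only [colPos] at hz
    omega
  · by_contra h
    obtain ⟨i, rfl⟩ := exists_rowPos_of_letter μ h
    have := μ.rowLen_anti 0 i (Nat.zero_le _)
    simp only [rowPos] at hz
    omega

/-- Transposition exchanges rows and columns, that is, it reverses the word and swaps its two
letters. -/
theorem isZeroLetter_transpose (k : ℤ) : IsZeroLetter μ.transpose k ↔ ¬ IsZeroLetter μ (-1 - k) := by
  constructor
  · rintro ⟨i, hi⟩
    have : -1 - k = colPos μ i := by rw [hi, colPos, μ.rowLen_transpose]; ring
    rw [this]
    exact not_isZeroLetter_colPos μ i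
  · intro h
    obtain ⟨j, hj⟩ := exists_colPos_of_not_isZeroLetter μ h
    refine ⟨j, ?_⟩
    rw [μ.rowLen_transpose]
    simp only [colPos] at hj
    omega

variable {μ}

theorem hookLength_eq {i j : ℕ} (h : (i, j) ∈ μ) :
    (hookLength μ (i, j) : ℤ) = rowPos μ i - colPos μ j := by
  have h1 := μ.mem_iff_lt_rowLen.1 h
  have h2 := μ.mem_iff_lt_colLen.1 h
  simp only [hookLength, rowPos, colPos]
  omega

/-- The multiplicity of `x` in a multiset of natural numbers. -/
def mult (M : Multiset ℕ) (x : ℤ) : ℤ := ((M.countP fun m : ℕ => (m : ℤ) = x : ℕ) : ℤ)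

theorem mult_map (S : Finset (ℕ × ℕ)) (f : ℕ × ℕ → ℕ) (x : ℤ) :
    mult (S.val.map f) x = (S.filter fun c => (f c : ℤ) = x).card := by
  rw [mult, Multiset.countP_map, ← Finset.filter_val, Finset.card_val]

theorem mult_eq_zero_of_notMem {M : Multiset ℕ} {x : ℤ} (h : ∀ m ∈ M, (m : ℤ) ≠ x) : mult M x = 0 := by
  rw [mult, Multiset.countP_eq_zero.2 h, Nat.cast_zero]

/-- For boxes of a fixed hook length, p is the position of the row: the row then determines the
column, and f indicates the admissible positions. -/
theorem card_eq_finsum {α : Type*} [DecidableEq α] {S : Finset α} {f : ℤ → ℤ} (p : α → ℤ)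
    (hp : Set.InjOn p S) (h1 : ∀ c ∈ S, f (p c) = 1) (h2 : ∀ z, f z ≠ 0 → ∃ c ∈ S, p c = z) :
    (S.card : ℤ) = ∑ᶠ z, f z := by
  rw [finsum_eq_finsetSum_of_support_subset f (s := S.image p), ← Finset.card_image_of_injOn hp,
    Finset.card_eq_sum_ones, Nat.cast_sum]
  · refine Finset.sum_congr rfl fun z hz => ?_
    obtain ⟨c, hc, rfl⟩ := Finset.mem_image.1 hz
    simp [h1 c hc]
  · intro z hz
    obtain ⟨c, hc, rfl⟩ := h2 z hz
    exact Finset.mem_coe.2 (Finset.mem_image_of_mem _ hc)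

theorem injOn_rowPos_of_hookLength {S : Finset (ℕ × ℕ)} {x : ℤ}
    (hS : ∀ c ∈ S, c ∈ μ.cells ∧ (hookLength μ c : ℤ) = x) :
    Set.InjOn (fun c : ℕ × ℕ => rowPos μ c.1) S := by
  rintro ⟨i, j⟩ hc ⟨i', j'⟩ hc' h
  obtain ⟨h1, h2⟩ := hS _ hc
  obtain ⟨h1', h2'⟩ := hS _ hc'
  have hi := (rowPos_strictAnti μ).injective h
  subst hi
  rw [hookLength_eq h1] at h2
  rw [hookLength_eq h1'] at h2'
  have hj : colPos μ j = colPos μ j' := by linarith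
  rw [(colPos_strictMono μ).injective hj]

theorem mult_hooks {h : ℤ} (hh : 0 < h) : mult (hooks μ) h = corr (letter μ) h := by
  rw [hooks, mult_map, corr]
  refine card_eq_finsum (fun c => rowPos μ c.1)
    (injOn_rowPos_of_hookLength fun c hc => Finset.mem_filter.1 hc) ?_ ?_
  · rintro ⟨i, j⟩ hc
    obtain ⟨hc, hx⟩ := Finset.mem_filter.1 hc
    rw [hookLength_eq hc] at hx
    have : rowPos μ i - h = colPos μ j := by linarith
    simp [letter_rowPos, this, letter_colPos]
  · intro z hz
    obtain ⟨hz1, hz2⟩ := mul_ne_zero_iff.1 hz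
    obtain ⟨i, rfl⟩ := exists_rowPos_of_letter μ hz1
    obtain ⟨j, hj⟩ := exists_colPos_of_letter (k := rowPos μ i - h) μ (by intro h'; simp [h'] at hz2)
    have hm : (i, j) ∈ μ := (colPos_lt_rowPos_iff μ).1 (by omega)
    refine ⟨(i, j), Finset.mem_filter.2 ⟨hm, ?_⟩, rfl⟩
    rw [hookLength_eq hm]
    omega

end AffineHook

/-! ### Diagrams symmetric about the diagonal up to a shift -/

namespace AffineHook
variable {μ : YoungDiagram}

/-- Each row meeting the main diagonal has, up to the shift `s`, the length of the corresponding
column; `s = 1` for self-conjugate diagrams, `s = 0` for doubled distinct ones. -/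
structure IsShiftSymmetric (s : ℕ) (μ : YoungDiagram) : Prop where
  le_one : s ≤ 1
  rowLen_add : ∀ i, (i, i) ∈ μ → μ.rowLen i + s = μ.colLen i + 1

theorem IsSelfConjugate.isShiftSymmetric (h : IsSelfConjugate μ) : IsShiftSymmetric 1 μ :=
  ⟨le_rfl, fun i _ => by rw [← μ.rowLen_transpose, h]⟩

theorem IsDoubledDistinct.isShiftSymmetric (h : IsDoubledDistinct μ) : IsShiftSymmetric 0 μ :=
  ⟨zero_le_one, fun i hi => by rw [add_zero, h i hi]⟩

theorem diag_mem_iff_rowPos {i : ℕ} : (i, i) ∈ μ ↔ 0 ≤ rowPos μ i := by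
  rw [μ.mem_iff_lt_rowLen, rowPos]; omega

theorem diag_mem_iff_colPos {i : ℕ} : (i, i) ∈ μ ↔ colPos μ i < 0 := by
  rw [μ.mem_iff_lt_colLen, colPos]; omega

theorem finite_letter_mul (μ : YoungDiagram) (m : ℤ) : (Function.support fun z => letter μ z * letter μ (m - z)).Finite := by
  obtain ⟨N, hN⟩ := (isMaya_letter μ).bdd
  refine finite_support_of_bdd (|N| + |m|) fun z hz => ?_
  rcases hz with hz | hz
  · rw [(hN (m - z)).2 (by grind)]; simp
  · rw [(hN z).2 (by grind)]; simp

/-- The value of `f` at `m / 2`, or `0` if `m` is odd. -/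
def half (f : ℤ → ℤ) (m : ℤ) : ℤ := if 2 ∣ m then f (m / 2) else 0

namespace IsShiftSymmetric

variable {s : ℕ} (hs : IsShiftSymmetric s μ)
include hs

theorem colPos_eq {i : ℕ} (hi : (i, i) ∈ μ) : colPos μ i = -s - rowPos μ i := by
  have := hs.rowLen_add i hi
  simp only [colPos, rowPos]
  omega

theorem two_mul_rowPos {i : ℕ} : 0 < 2 * rowPos μ i + s ↔ (i, i) ∈ μ := by
  have h1 := hs.le_one
  constructor
  · intro h; rw [diag_mem_iff_rowPos]; omega
  · intro h
    have h2 := diag_mem_iff_rowPos.1 h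
    have h3 := hs.colPos_eq h
    have h4 := diag_mem_iff_colPos.1 h
    omega

theorem letter_neg_of_pos {x : ℤ} (hx : 0 < 2 * x + s) : letter μ (-s - x) = 1 - letter μ x := by
  have h1 := hs.le_one
  rcases (isMaya_letter μ).bin x with h | h
  · rw [h, sub_zero]
    by_contra h'
    obtain ⟨j, hj⟩ := exists_colPos_of_letter μ h'
    have hd : (j, j) ∈ μ := by rw [diag_mem_iff_colPos]; omega
    have := hs.colPos_eq hd
    have h2 : x = rowPos μ j := by omega
    rw [h2, letter_rowPos] at h
    omega
  · obtain ⟨i, rfl⟩ := exists_rowPos_of_letter μ (k := x) (by omega)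
    rw [← hs.colPos_eq (hs.two_mul_rowPos.1 hx), letter_colPos, h, sub_self]

/-- Reflection in -s/2 swaps the letters: a zero to the right of the centre belongs to a row meeting
the diagonal, a one to the left of it to a column meeting the diagonal, and row and column through
the same diagonal box are mirror images. -/
theorem letter_neg {x : ℤ} (hx : 2 * x + s ≠ 0) : letter μ (-s - x) = 1 - letter μ x := by
  rcases lt_or_gt_of_ne hx with h | h
  · have := hs.letter_neg_of_pos (x := -s - x) (by linarith)
    rw [sub_sub_cancel] at this
    omega
  · exact hs.letter_neg_of_pos h

/-- This concerns only s = 0 and x = 0, a fixed point of the reflection, where the antisymmetry of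
`letter_neg` necessarily fails. -/
theorem letter_center {x : ℤ} (hx : 2 * x + s = 0) : letter μ x = 0 := by
  by_contra h
  obtain ⟨i, rfl⟩ := exists_rowPos_of_letter μ h
  have h1 := hs.le_one
  have : (i, i) ∈ μ := by rw [diag_mem_iff_rowPos]; omega
  have := hs.two_mul_rowPos.2 this
  omega

/-- For a box (i, j) with j < i, column j meets the diagonal, so its letter mirrors that of row j
and the hook length is `rowPos μ i + rowPos μ j + s`. Hooks below the diagonal are thus pairs of
distinct zero letters with sum h - s; the condition 2z < h - s selects the smaller one, which is row
i. -/
theorem mult_hooksBelow {h : ℤ} (hh : 0 < h) : mult (hooksBelow μ) h =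
    ∑ᶠ z, if 2 * z < h - s then letter μ z * letter μ (h - s - z) else 0 := by
  rw [hooksBelow, mult_map]
  refine card_eq_finsum (fun c => rowPos μ c.1) (injOn_rowPos_of_hookLength (x := h) ?_) ?_ ?_
  · intro c hc
    simp only [Finset.mem_filter] at hc
    exact ⟨hc.1.1, hc.2⟩
  · rintro ⟨i, j⟩ hc
    simp only [Finset.mem_filter] at hc
    obtain ⟨⟨hm, hij⟩, hx⟩ := hc
    rw [hookLength_eq hm] at hx
    have hd : (j, j) ∈ μ := μ.up_left_mem hij.le le_rfl hm
    have h1 := hs.colPos_eq hd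
    have h2 := rowPos_strictAnti μ hij
    have h3 : h - s - rowPos μ i = rowPos μ j := by omega
    simp only [h3, letter_rowPos, mul_one]
    rw [if_pos (by omega)]
  · intro z hz
    split_ifs at hz with hlt
    · obtain ⟨hz1, hz2⟩ := mul_ne_zero_iff.1 hz
      obtain ⟨i, rfl⟩ := exists_rowPos_of_letter μ hz1
      obtain ⟨j, hj⟩ := exists_rowPos_of_letter μ hz2
      have hji : j < i := (rowPos_strictAnti μ).lt_iff_gt.1 (by omega)
      have hd : (j, j) ∈ μ := hs.two_mul_rowPos.1 (by omega)
      have h1 := hs.colPos_eq hd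
      have hm : (i, j) ∈ μ := (colPos_lt_rowPos_iff μ).1 (by omega)
      refine ⟨(i, j), ?_, rfl⟩
      simp only [Finset.mem_filter]
      refine ⟨⟨hm, hji⟩, ?_⟩
      rw [hookLength_eq hm]
      omega
    · exact absurd rfl hz

/-- The full sum sees each pair {z, h - s - z} of distinct letters twice and the degenerate pair 2z
= h - s, which is no box below the diagonal, once. -/
theorem two_mul_mult_hooksBelow {h : ℤ} (hh : 0 < h) :
    2 * mult (hooksBelow μ) h + half (letter μ) (h - s) =
      ∑ᶠ z, letter μ z * letter μ (h - s - z) := by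
  obtain ⟨m, hm⟩ : ∃ m, m = h - s := ⟨_, rfl⟩
  rw [← hm]
  have fin := finite_letter_mul μ m
  have hB := hs.mult_hooksBelow hh
  rw [← hm] at hB
  have hB' : mult (hooksBelow μ) h =
      ∑ᶠ z, if m < 2 * z then letter μ z * letter μ (m - z) else 0 := by
    rw [hB, ← finsum_comp_equiv (Equiv.subLeft m)]
    refine finsum_congr fun z => ?_
    simp only [Equiv.subLeft_apply, sub_sub_cancel]
    by_cases h : 2 * (m - z) < m
    · rw [if_pos h, if_pos (by omega), mul_comm]
    · rw [if_neg h, if_neg (by omega)]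
  have hH : half (letter μ) m = ∑ᶠ z, if 2 * z = m then letter μ z * letter μ (m - z) else 0 := by
    rw [half]
    split_ifs with hd
    · obtain ⟨q, rfl⟩ := hd
      rw [finsum_eq_single _ q]
      · rw [if_pos rfl, Int.mul_ediv_cancel_left _ two_ne_zero, two_mul, add_sub_cancel_right]
        rcases (isMaya_letter μ).bin q with h | h <;> simp [h]
      · intro z hz; rw [if_neg (by omega)]
    · refine (finsum_eq_zero_of_forall_eq_zero fun z => ?_).symm
      rw [if_neg]
      rintro rfl
      exact hd (dvd_mul_right _ _)
  have fin' : ∀ (p : ℤ → Prop) [DecidablePred p],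
      (Function.support fun z => if p z then letter μ z * letter μ (m - z) else 0).Finite := by
    intro p _
    refine fin.subset fun z hz h => hz ?_
    simp only at h ⊢
    rw [h, ite_self]
  rw [two_mul]
  nth_rw 1 [hB]
  rw [hB', hH, ← finsum_add_distrib (fin' _) (fin' _), ← finsum_add_distrib _ (fin' _)]
  · refine finsum_congr fun z => ?_
    rcases lt_trichotomy (2 * z) m with h | h | h
    · rw [if_pos h, if_neg (by omega), if_neg (by omega)]; ring
    · rw [if_neg (by omega), if_neg (by omega), if_pos h]; ring
    · rw [if_neg (by omega), if_pos h, if_neg (by omega)]; ring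
  · exact ((fin' _).union (fin' _)).subset (Function.support_add _ _)

/-- The hook lengths below the diagonal are counted by the autocorrelation. -/
theorem corr_letter {h : ℤ} (hh : 0 < h) : corr (letter μ) h =
    2 * mult (hooksBelow μ) h + half (letter μ) (h - s) + (1 - s) * letter μ h := by
  have hs1 := hs.le_one
  -- By antisymmetry χ(h-s-z) = 1 - χ(z-h), unless z - h is the centre, where both χ(h-s-z) and
  -- χ(z-h) vanish. For s = 0 this exception is the term z = h.
  have e : ∀ z, letter μ z * letter μ (h - s - z) =
      letter μ z * (1 - letter μ (z - h)) - letter μ z * (if 2 * (z - h) + s = 0 then 1 else 0) := by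
    intro z
    split_ifs with hz
    · rw [hs.letter_center hz, hs.letter_center (x := h - s - z) (by omega)]; ring
    · have : h - s - z = -s - (z - h) := by ring
      rw [this, hs.letter_neg hz]; ring
  have fin2 : (Function.support fun z => letter μ z * (if 2 * (z - h) + s = 0 then 1 else 0)).Finite := by
    refine finite_support_of_bdd (|h| + s) fun z hz => ?_
    rw [if_neg (by grind), mul_zero]
  have fin1 := (isMaya_letter μ).finite_mul 0 h
  simp only [sub_zero] at fin1
  rw [hs.two_mul_mult_hooksBelow hh, finsum_congr e, finsum_sub_distrib fin1 fin2, ← corr]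
  have : ∑ᶠ z, letter μ z * (if 2 * (z - h) + (s : ℤ) = 0 then 1 else 0) = (1 - s) * letter μ h := by
    rw [finsum_eq_single _ h]
    · have : s = 0 ∨ s = 1 := by omega
      rcases this with rfl | rfl <;> simp
    · intro z hz
      rw [if_neg (by omega), mul_zero]
  rw [this]
  ring

end IsShiftSymmetric

theorem notMem_iff_mult_eq_zero {M : Multiset ℕ} {x : ℕ} : x ∉ M ↔ mult M x = 0 := by
  constructor
  · intro h
    refine mult_eq_zero_of_notMem fun m hm h' => h ?_
    rwa [← Int.ofNat_inj.1 h']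
  · intro h hx
    have h' : M.countP (fun m : ℕ => (m : ℤ) = x) = 0 := Int.ofNat_eq_zero.1 h
    exact Multiset.countP_eq_zero.1 h' x hx rfl

/-- The parts of the distinct partition attached to a diagram. -/
def shiftParts (s : ℕ) (μ : YoungDiagram) : Multiset ℕ :=
  (μ.cells.filter (fun c => c.1 = c.2)).val.map (fun c => μ.rowLen c.1 + s - (c.1 + 1))

theorem partsOfDouble_eq : partsOfDouble μ = shiftParts 0 μ := rfl

theorem partsOfSelfConjugate_eq : partsOfSelfConjugate μ = shiftParts 1 μ :=
  Multiset.map_congr rfl fun c _ => by omega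

/-- The row through a diagonal box with part p has its letter at p - s, and these are all the zero
letters to the right of the centre. -/
theorem mem_shiftParts {s p : ℕ} (hs : IsShiftSymmetric s μ) :
    p ∈ shiftParts s μ ↔ s < 2 * p ∧ letter μ ((p : ℤ) - s) = 1 := by
  have hs1 := hs.le_one
  simp only [shiftParts, Multiset.mem_map, Finset.mem_val, Finset.mem_filter]
  constructor
  · rintro ⟨⟨i, j⟩, ⟨hm, hij⟩, hp⟩
    obtain rfl : i = j := hij
    have h1 := hs.two_mul_rowPos.2 hm
    have h2 := diag_mem_iff_rowPos.1 hm
    have h3 : (p : ℤ) - s = rowPos μ i := by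
      simp only [rowPos] at h1 h2 ⊢
      simp only at hp
      omega
    refine ⟨by omega, ?_⟩
    rw [h3, letter_rowPos]
  · rintro ⟨h1, h2⟩
    obtain ⟨i, hi⟩ := exists_rowPos_of_letter μ (k := (p : ℤ) - s) (by omega)
    have hm : (i, i) ∈ μ := hs.two_mul_rowPos.1 (by omega)
    refine ⟨(i, i), ⟨hm, rfl⟩, ?_⟩
    simp only [rowPos] at hi ⊢
    omega

theorem mult_shiftParts {s : ℕ} (hs : IsShiftSymmetric s μ) {x : ℤ} (hx : s < 2 * x) :
    mult (shiftParts s μ) x = letter μ (x - s) := by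
  have hs1 := hs.le_one
  have hnd : (shiftParts s μ).Nodup := by
    refine Multiset.Nodup.map_on ?_ (Finset.nodup _)
    rintro ⟨i, j⟩ hc ⟨i', j'⟩ hc' h
    simp only [Finset.mem_val, Finset.mem_filter] at hc hc' h
    obtain ⟨hm, rfl⟩ := hc
    obtain ⟨hm', rfl⟩ := hc'
    have h1 := diag_mem_iff_rowPos.1 hm
    have h2 := diag_mem_iff_rowPos.1 hm'
    have h3 : rowPos μ i = rowPos μ i' := by
      simp only [rowPos] at h1 h2 ⊢; omega
    rw [(rowPos_strictAnti μ).injective h3]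
  obtain ⟨p, rfl⟩ : ∃ p : ℕ, (p : ℤ) = x := ⟨x.toNat, by omega⟩
  have hc : mult (shiftParts s μ) p = ((shiftParts s μ).count p : ℕ) := by
    rw [mult, Multiset.count]
    congr 1
    refine Multiset.countP_congr rfl fun m _ => ?_
    rw [eq_iff_iff, Nat.cast_inj, eq_comm]
  rw [hc, Multiset.count_eq_of_nodup hnd]
  by_cases h : p ∈ shiftParts s μ
  · rw [if_pos h, ((mem_shiftParts hs).1 h).2]; rfl
  · rw [if_neg h]
    have : letter μ ((p : ℤ) - s) ≠ 1 := fun h' => h ((mem_shiftParts hs).2 ⟨by omega, h'⟩)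
    rcases (isMaya_letter μ).bin ((p : ℤ) - s) with h1 | h1
    · rw [h1]; rfl
    · exact absurd h1 this

/-! ### Conditions on hook lengths -/

theorem letter_sub_of_isCore {g : ℕ} (hg : 0 < g) (h : IsCore g μ) {z : ℤ} (hz : letter μ z = 1) :
    letter μ (z - g) = 1 := by
  by_contra h'
  obtain ⟨i, rfl⟩ := exists_rowPos_of_letter μ (k := z) (by omega)
  obtain ⟨j, hj⟩ := exists_colPos_of_letter μ h'
  have hm : (i, j) ∈ μ := (colPos_lt_rowPos_iff μ).1 (by omega)
  refine h (Multiset.mem_map.2 ⟨(i, j), hm, ?_⟩)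
  have := hookLength_eq hm
  omega

/-- If z - g carried a one, its mirror image g - s - z would carry a zero, and two distinct zeros
with sum g - s give a hook of length g below the diagonal. The two exceptions are z - g at the
centre and z equal to its own partner. -/
theorem letter_sub_of_hooksBelow {g s : ℕ} (hs : IsShiftSymmetric s μ) (hg : 0 < g)
    (h : g ∉ hooksBelow μ) {z : ℤ} (hz : letter μ z = 1) (h1 : 2 * (z - g) + s ≠ 0)
    (h2 : 2 * z ≠ g - s) : letter μ (z - g) = 1 := by
  have key : ∀ z, 2 * z < (g : ℤ) - s → letter μ z = 1 → letter μ (g - s - z) ≠ 1 := by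
    intro z hlt hz hz'
    obtain ⟨i, rfl⟩ := exists_rowPos_of_letter μ (k := z) (by omega)
    obtain ⟨j, hj⟩ := exists_rowPos_of_letter μ (k := g - s - rowPos μ i) (by omega)
    have hji : j < i := (rowPos_strictAnti μ).lt_iff_gt.1 (by omega)
    have hd : (j, j) ∈ μ := hs.two_mul_rowPos.1 (by omega)
    have h1 := hs.colPos_eq hd
    have hm : (i, j) ∈ μ := (colPos_lt_rowPos_iff μ).1 (by omega)
    refine h (Multiset.mem_map.2 ⟨(i, j), ?_, ?_⟩)
    · simp only [Finset.mem_val, Finset.mem_filter]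
      exact ⟨hm, hji⟩
    · have := hookLength_eq hm
      omega
  have h3 := hs.letter_neg h1
  have e : -(s : ℤ) - (z - g) = g - s - z := by ring
  rw [e] at h3
  have h4 : letter μ (g - s - z) ≠ 1 := by
    intro h'
    rcases lt_or_gt_of_ne h2 with hlt | hlt
    · exact key z hlt hz h'
    · exact key (g - s - z) (by omega) h' (by rwa [sub_sub_cancel])
  have := (isMaya_letter μ).bin (g - s - z)
  omega

/-- For 2z > g, a one at z - g gives a box (i, j) of hook length g. It lies above the diagonal,
since j ≤ i would make the positions of rows i and j, both greater than g/2, sum to g. The case 2z <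
g follows by the reflection z ↦ g - z, and 2z = g is the excluded part. -/
theorem letter_sub_of_hooksAbove {g : ℕ} (hs : IsShiftSymmetric 0 μ) (hg : 0 < g)
    (h : g ∉ hooksAbove μ) (hp : ∀ p ∈ shiftParts 0 μ, 2 * p ≠ g) {z : ℤ} (hz : letter μ z = 1) :
    letter μ (z - g) = 1 := by
  have key : ∀ i j : ℕ, i < j → rowPos μ i - g = colPos μ j → False := by
    intro i j hij hc
    have hm : (i, j) ∈ μ := (colPos_lt_rowPos_iff μ).1 (by omega)
    refine h (Multiset.mem_map.2 ⟨(i, j), ?_, ?_⟩)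
    · simp only [Finset.mem_val, Finset.mem_filter]
      exact ⟨hm, hij⟩
    · have := hookLength_eq hm
      omega
  have key2 : ∀ z, (g : ℤ) < 2 * z → letter μ z = 1 → letter μ (z - g) = 1 := by
    intro z hlt hz
    by_contra h'
    obtain ⟨i, rfl⟩ := exists_rowPos_of_letter μ (k := z) (by omega)
    obtain ⟨j, hj⟩ := exists_colPos_of_letter μ h'
    refine key i j ?_ hj.symm
    by_contra! hji
    have hi : (i, i) ∈ μ := diag_mem_iff_rowPos.2 (by omega)
    have hd : (j, j) ∈ μ := μ.up_left_mem hji hji hi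
    have h1 := hs.colPos_eq hd
    have h2 := (rowPos_strictAnti μ).antitone hji
    omega
  by_contra h'
  have hz0 := (isMaya_letter μ).bin (z - g)
  rcases lt_trichotomy (2 * z) g with hlt | heq | hlt
  · have h1 := hs.letter_neg (x := z - g) (by push_cast; omega)
    have h2 := key2 (-(0 : ℕ) - (z - g)) (by push_cast; omega) (by omega)
    by_cases h3 : z = 0
    · subst h3
      have := hs.letter_center (x := 0) (by simp)
      omega
    · have h4 := hs.letter_neg (x := z) (by push_cast; omega)
      have e : -((0 : ℕ) : ℤ) - (z - g) - g = -((0 : ℕ) : ℤ) - z := by ring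
      rw [e] at h2
      omega
  · obtain ⟨p, hp'⟩ : ∃ p : ℕ, (p : ℤ) = z := ⟨z.toNat, by omega⟩
    refine hp p ((mem_shiftParts hs).2 ⟨by omega, ?_⟩) (by omega)
    rw [hp', Nat.cast_zero, sub_zero, hz]
  · exact h' (key2 z hlt hz)

end AffineHook

/-! ### The exponent identity for symmetric diagrams -/

namespace AffineHook

/-- The first difference of the word of `μ` is determined by the vector `t`. -/
structure HasDiff (g s : ℕ) (a b₀ b₁ : ℤ) (μ : YoungDiagram) {n : ℕ} (t : V n) : Prop where
  symm : IsShiftSymmetric s μ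
  int : ∃ τ : Fin n → ℤ, ∀ j, t j = ((g : ℚ) - s) / 2 - τ j
  diff : ∀ z, letter μ (z - g) - letter μ z = symDiff g s a b₀ b₁ t z

/-- The number of parts `p` with `2 p - s = x`. -/
def doubleMult (s : ℕ) (μ : YoungDiagram) (x : ℤ) : ℤ := half (mult (shiftParts s μ)) (x + s)

/-- The number of hooks of length `x`, expressed by the hooks below the diagonal. -/
def hookCount (s : ℕ) (μ : YoungDiagram) (x : ℤ) : ℤ :=
  2 * mult (hooksBelow μ) x + doubleMult s μ x + (1 - s) * mult (shiftParts s μ) x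

/-- A signed count of the parts. -/
def partCount (s : ℕ) (ε₁ ε₂ : ℤ) (μ : YoungDiagram) (x : ℤ) : ℤ :=
  ε₁ * mult (shiftParts s μ) x + ε₂ * doubleMult s μ x

variable {μ : YoungDiagram}

theorem mult_hooksBelow_of_nonpos {x : ℤ} (hx : x ≤ 0) : mult (hooksBelow μ) x = 0 := by
  refine mult_eq_zero_of_notMem fun m hm h => ?_
  obtain ⟨⟨i, j⟩, hc, rfl⟩ := Multiset.mem_map.1 hm
  simp only [Finset.mem_val, Finset.mem_filter] at hc
  have h1 := hookLength_eq hc.1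
  have h2 := (colPos_lt_rowPos_iff μ).2 hc.1
  omega

namespace IsShiftSymmetric
variable {s : ℕ} (hs : IsShiftSymmetric s μ)
include hs

theorem mult_shiftParts_of_nonpos {x : ℤ} (hx : 2 * x ≤ s) : mult (shiftParts s μ) x = 0 := by
  refine mult_eq_zero_of_notMem fun m hm h => ?_
  have := ((mem_shiftParts hs).1 hm).1
  omega

theorem doubleMult_of_nonpos {x : ℤ} (hx : x ≤ 0) : doubleMult s μ x = 0 := by
  rw [doubleMult, half]
  split_ifs
  · exact hs.mult_shiftParts_of_nonpos (by omega)
  · rfl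

theorem doubleMult_eq {x : ℤ} (hx : 0 < x) : doubleMult s μ x = half (letter μ) (x - s) := by
  rw [doubleMult, half, half]
  by_cases h : (2 : ℤ) ∣ x + s
  · rw [if_pos h, if_pos (by omega), mult_shiftParts hs (by omega)]
    congr 1
    omega
  · rw [if_neg h, if_neg (by omega)]

theorem mult_shiftParts_eq {x : ℤ} (hx : 0 < x) :
    (1 - s) * mult (shiftParts s μ) x = (1 - s) * letter μ x := by
  have := hs.le_one
  have h : s = 0 ∨ s = 1 := by omega
  rcases h with rfl | rfl
  · rw [mult_shiftParts hs (by push_cast; omega), Nat.cast_zero, sub_zero, sub_zero]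
  · simp

theorem hookCount_eq {x : ℤ} (hx : 0 < x) : hookCount s μ x = corr (letter μ) x := by
  rw [hookCount, hs.corr_letter hx, hs.doubleMult_eq hx, hs.mult_shiftParts_eq hx]

theorem hookCount_of_nonpos {x : ℤ} (hx : x ≤ 0) : hookCount s μ x = 0 := by
  rw [hookCount, hs.doubleMult_of_nonpos hx, hs.mult_shiftParts_of_nonpos (by omega),
    mult_hooksBelow_of_nonpos hx]
  ring

theorem partCount_of_nonpos {ε₁ ε₂ x : ℤ} (hx : x ≤ 0) : partCount s ε₁ ε₂ μ x = 0 := by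
  rw [partCount, hs.doubleMult_of_nonpos hx, hs.mult_shiftParts_of_nonpos (by omega)]
  ring

theorem partCount_eq {ε₁ ε₂ x : ℤ} (hb : s = 0 ∨ ε₁ = 0) (hx : 0 < x) :
    partCount s ε₁ ε₂ μ x = ε₁ * letter μ x + ε₂ * half (letter μ) (x - s) := by
  rw [partCount, hs.doubleMult_eq hx]
  rcases hb with rfl | rfl
  · rw [mult_shiftParts hs (by push_cast; omega), Nat.cast_zero, sub_zero]
  · simp

theorem half_letter_neg {x : ℤ} (hx : x ≠ 0) : half (letter μ) (-x - s) =
    (if 2 ∣ x - s then 1 else 0) - half (letter μ) (x - s) := by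
  rw [half, half]
  by_cases h : (2 : ℤ) ∣ x - s
  · rw [if_pos h, if_pos h, if_pos (by omega), ← hs.letter_neg (by omega)]
    congr 1
    omega
  · rw [if_neg h, if_neg h, if_neg (by omega), sub_zero]

end IsShiftSymmetric

/-- The two sides of the exponent identity differ by a quantity which does not depend on `μ`. -/
theorem exists_exponent_identity (g s : ℕ) (a b₀ b₁ ε₂ : ℤ) (hb : s = 0 ∨ b₀ = 0 ∧ b₁ = 0) :
    ∃ C : ℤ → ℤ, ∀ (μ : YoungDiagram) (n : ℕ) (t : V n), HasDiff g s a b₀ b₁ μ t → ∀ k : ℤ, 0 < k →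
      hookCount s μ (k + g) + hookCount s μ (k - g) - 2 * hookCount s μ k +
        partCount s (b₀ + b₁) ε₂ μ (k + g) - partCount s (b₀ + b₁) ε₂ μ (k - g) +
        (if k < g then hookCount s μ (g - k) + partCount s (b₀ + b₁) ε₂ μ (g - k) else 0) =
      pairCount t k + 2 * a * absCount t k - ε₂ * absCount t ((k : ℚ) / 2) + C k := by
  set E := extraDiff g s a b₀ b₁ with hE
  -- C collects the contributions of the fixed masses and the constants arising from the passage
  -- from k - g to g - k. The word of the empty partition merely names the universal value of `corr
  -- χ h - corr χ (-h)`.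
  refine ⟨fun k => ∑ᶠ z, E z * E (z - k) - (b₀ + b₁) * (E k + E (k + g)) - ε₂ * half E (k + g - s) +
    if k < g then corr (letter ⊥) (g - k) - corr (letter ⊥) (-(g - k)) + (b₀ + b₁) +
      ε₂ * (if 2 ∣ k + g - s then 1 else 0) else 0, ?_⟩
  rintro μ n t ⟨hs, ⟨τ, hτ⟩, hD⟩ k hk
  have hb' : s = 0 ∨ b₀ + b₁ = 0 := by
    rcases hb with h | ⟨rfl, rfl⟩
    · exact Or.inl h
    · exact Or.inr rfl
  have hχ := isMaya_letter μ
  have hE' : ∀ z, symDiff g s a b₀ b₁ t z = absCount t (z - ((g : ℚ) - s) / 2) + E z := fun z => by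
    simp only [symDiff, hE, extraDiff, Int.cast_natCast]; ring
  have h2 := corr_second_diff hχ g k
  have e1 : ∀ z, (letter μ (z - g) - letter μ z) * (letter μ (z - k - g) - letter μ (z - k)) =
      symDiff g s a b₀ b₁ t z * symDiff g s a b₀ b₁ t (z - k) := fun z => by rw [hD, hD]
  rw [finsum_congr e1, finsum_symDiff_mul (by simpa using hτ)
    (by rcases hb with rfl | h; exacts [Or.inl rfl, Or.inr h]), ← hE] at h2
  -- For s = 0 the first differences at k and k + g telescope to χ(k-g) - χ(k+g). Counting the parts
  -- with weight b₀ + b₁ therefore cancels the cross terms of the masses at 0 and g.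
  have hP : (b₀ + b₁) * (letter μ (k + g) - letter μ (k - g)) = -((b₀ + b₁) *
      (absCount t (k - (g : ℚ) / 2) + absCount t (k + (g : ℚ) / 2) + (E k + E (k + g)))) := by
    rcases hb' with rfl | h
    · have d1 := hD k
      have d2 := hD (k + g)
      rw [hE', Nat.cast_zero, sub_zero] at d1 d2
      rw [add_sub_cancel_right] at d2
      have e2 : ((k + g : ℤ) : ℚ) - (g : ℚ) / 2 = k + (g : ℚ) / 2 := by push_cast; ring
      rw [e2] at d2
      linear_combination (b₀ + b₁) * (-d1 - d2)
    · rw [h]; ring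
  -- With q = (k+g-s)/2 the left side is minus the first difference at q, a point at distance k/2
  -- from the centre (g-s)/2. If k + g - s is odd, no t_j equals ±k/2.
  have hP2 : half (letter μ) (k + g - s) - half (letter μ) (k - g - s) =
      -(absCount t ((k : ℚ) / 2) + half E (k + g - s)) := by
    rw [half, half, half]
    by_cases hd : (2 : ℤ) ∣ k + g - s
    · rw [if_pos hd, if_pos (by omega), if_pos hd]
      obtain ⟨q, hq⟩ := hd
      have e3 : (k + g - s) / 2 = q := by omega
      have e4 : (k - g - s) / 2 = q - g := by omega
      have d := hD q
      have e5 : (q : ℚ) - ((g : ℚ) - s) / 2 = (k : ℚ) / 2 := by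
        have : ((k + g - s : ℤ) : ℚ) = ((2 * q : ℤ) : ℚ) := by rw [hq]
        push_cast at this
        linarith
      rw [hE', e5] at d
      rw [e3, e4]
      linarith
    · rw [if_neg hd, if_neg (by omega), if_neg hd]
      have : absCount t ((k : ℚ) / 2) = 0 := by
        refine Finset.sum_eq_zero fun j _ => ?_
        have h3 := hτ j
        rw [if_neg, if_neg, add_zero]
        · intro h
          refine hd ⟨τ j, ?_⟩
          have h4 : ((k + g - s : ℤ) : ℚ) = ((2 * τ j : ℤ) : ℚ) := by push_cast; linarith
          exact_mod_cast h4
        · intro h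
          refine hd ⟨g - s - τ j, ?_⟩
          have h4 : ((k + g - s : ℤ) : ℚ) = ((2 * (g - s - τ j) : ℤ) : ℚ) := by push_cast; linarith
          exact_mod_cast h4
      rw [this]; ring
  -- For k < g the counts vanish at k - g while the autocorrelation need not; `corr_neg_sub` and the
  -- antisymmetry of the word express the values at k - g by those at g - k.
  by_cases hkg : k < g
  · have h3 := corr_neg_sub hχ (isMaya_letter ⊥) (g - k)
    have e6 : letter μ (g - k) * (b₀ + b₁) = (b₀ + b₁) * (1 - letter μ (k - g)) := by
      rcases hb' with rfl | h
      · rw [← hs.letter_neg (x := k - g) (by push_cast; omega), mul_comm]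
        congr 2
        push_cast; ring
      · rw [h]; ring
    have e7 := hs.half_letter_neg (x := k - g) (by omega)
    have e8 : -(k - g : ℤ) - s = g - k - s := by ring
    have e9 : (if (2 : ℤ) ∣ k - g - s then (1 : ℤ) else 0) = if (2 : ℤ) ∣ k + g - s then 1 else 0 :=
      if_congr_prop (by omega)
    rw [e8, e9] at e7
    simp only [if_pos hkg]
    rw [hs.hookCount_eq (x := k + g) (by omega), hs.hookCount_of_nonpos (x := k - g) (by omega),
      hs.hookCount_eq hk, hs.partCount_eq hb' (x := k + g) (by omega),
      hs.partCount_of_nonpos (x := k - g) (by omega), hs.hookCount_eq (x := g - k) (by omega),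
      hs.partCount_eq hb' (x := g - k) (by omega), e7]
    rw [neg_sub] at h3 ⊢
    linear_combination h2 + hP + ε₂ * hP2 + e6 - h3
  · simp only [if_neg hkg]
    rw [hs.hookCount_eq (x := k + g) (by omega), hs.hookCount_eq hk,
      hs.partCount_eq hb' (x := k + g) (by omega)]
    -- For k = g the argument k - g is 0, where `corr` and the central letter vanish as well.
    rcases (not_lt.1 hkg).eq_or_lt with h | h
    · subst h
      rw [sub_self, hs.hookCount_of_nonpos le_rfl, hs.partCount_of_nonpos le_rfl]
      rw [sub_self, corr_zero hχ] at h2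
      rw [sub_self] at hP hP2
      have e10 : (b₀ + b₁) * letter μ 0 = 0 := by
        rcases hb' with rfl | h
        · rw [hs.letter_center (x := 0) (by simp), mul_zero]
        · rw [h]; ring
      have e11 : half (letter μ) (0 - s) = 0 := by
        rw [half]
        split_ifs with h
        · exact hs.letter_center (by omega)
        · rfl
      linear_combination h2 + hP + ε₂ * hP2 + e10 + ε₂ * e11
    · rw [hs.hookCount_eq (x := k - g) (by omega), hs.partCount_eq hb' (x := k - g) (by omega)]
      linear_combination h2 + hP + ε₂ * hP2

end AffineHook

/-! ### Runners: the word along a residue class -/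

namespace AffineHook
variable {μ : YoungDiagram}

theorem mul_add_eq_iff {g k i b r : ℤ} (hi : 0 ≤ i) (hi' : i < g) (hr : 0 ≤ r) (hr' : r < g) :
    k * g + i = g * b + r ↔ k = b ∧ i = r := by
  constructor
  · intro h
    have h1 : (k * g + i) % g = i := by
      rw [add_comm, Int.add_mul_emod_self_right, Int.emod_eq_of_lt hi hi']
    have h2 : (g * b + r) % g = r := by
      rw [add_comm, Int.add_mul_emod_self_left, Int.emod_eq_of_lt hr hr']
    have h3 : i = r := by rw [← h1, ← h2, h]
    subst h3
    refine ⟨?_, rfl⟩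
    have h4 : g * k = g * b := by linarith
    exact mul_left_cancel₀ (by omega) h4
  · rintro ⟨rfl, rfl⟩; ring

section pointCount
variable {n : ℕ} {g k i : ℤ} {b r : Fin n → ℤ}

theorem pointCount_eq_zero (hi : 0 ≤ i) (hi' : i < g) (hr : ∀ j, 0 ≤ r j ∧ r j < g)
    (h : ∀ j, r j ≠ i) : pointCount (fun j => g * b j + r j) (k * g + i) = 0 := by
  refine Finset.sum_eq_zero fun j _ => if_neg ?_
  rw [mul_add_eq_iff hi hi' (hr j).1 (hr j).2]
  exact fun h' => h j h'.2.symm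

theorem pointCount_eq_ite (hr : ∀ j, 0 ≤ r j ∧ r j < g) (hinj : Function.Injective r) {j : Fin n}
    (h : r j = i) :
    pointCount (fun j => g * b j + r j) (k * g + i) = if k = b j then 1 else 0 := by
  subst h
  rw [pointCount, Finset.sum_eq_single j]
  · refine if_congr_prop ?_
    rw [mul_add_eq_iff (hr j).1 (hr j).2 (hr j).1 (hr j).2]
    simp
  · intro l _ hl
    rw [if_neg]
    rw [mul_add_eq_iff (hr j).1 (hr j).2 (hr l).1 (hr l).2]
    exact fun h' => hl (hinj h'.2.symm)
  · simp

end pointCount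

theorem letter_eq_one_iff {z : ℤ} : letter μ z = 1 ↔ IsZeroLetter μ z := by
  rw [letter]; split_ifs with h <;> simp [h]

/-- Closure under subtracting g makes the zeros of the runner an initial segment, and the charge is
the first gap. The first difference on the runner is then a single point mass. -/
theorem letter_eq_ite_of_hasCharge {g : ℕ} {i m : ℤ} (h : HasCharge g μ i m)
    (hc : ∀ k : ℤ, letter μ (k * g + i) = 1 → letter μ ((k - 1) * g + i) = 1) (k : ℤ) :
    letter μ (k * g + i) = if k < m then 1 else 0 := by
  split_ifs with hk
  · rw [letter_eq_one_iff]
    by_contra h'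
    have := h.2 h'
    omega
  · have key : ∀ l : ℕ, letter μ ((m + l) * g + i) ≠ 1 := by
      intro l
      induction l with
      | zero =>
        rw [Ne, letter_eq_one_iff, Nat.cast_zero, add_zero]
        exact h.1
      | succ l ih =>
        intro h'
        refine ih ?_
        have := hc _ h'
        rwa [Nat.cast_succ, ← add_assoc, add_sub_cancel_right] at this
    have h1 := key (k - m).toNat
    rw [Int.toNat_of_nonneg (by omega), add_sub_cancel] at h1
    have := (isMaya_letter μ).bin (k * g + i)
    omega

theorem diff_of_hasCharge {g : ℕ} {i m : ℤ} (h : HasCharge g μ i m)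
    (hc : ∀ k : ℤ, letter μ (k * g + i) = 1 → letter μ ((k - 1) * g + i) = 1) (k : ℤ) :
    letter μ (k * g + i - g) - letter μ (k * g + i) = if k = m then 1 else 0 := by
  have e : k * g + i - g = (k - 1) * g + i := by ring
  rw [e, letter_eq_ite_of_hasCharge h hc, letter_eq_ite_of_hasCharge h hc]
  split_ifs <;> omega

/-- This reduces `HasDiff` to one residue class at a time: b and r are quotient and residue of τ_j,
while b' and r' are those of its mirror image g - s - τ_j. -/
theorem hasDiff_of_runners {g s : ℕ} {a b₀ b₁ : ℤ} {n : ℕ} {t : V n} (hs : IsShiftSymmetric s μ)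
    (hg : 0 < g) (b b' r r' : Fin n → ℤ)
    (ht : ∀ j, t j = ((g : ℚ) - s) / 2 - (g * b j + r j : ℤ))
    (hb' : ∀ j, (g : ℤ) - s - (g * b j + r j) = g * b' j + r' j)
    (h : ∀ k i : ℤ, 0 ≤ i → i < g → letter μ (k * g + i - g) - letter μ (k * g + i) =
      pointCount (fun j => g * b j + r j) (k * g + i) +
        pointCount (fun j => g * b' j + r' j) (k * g + i) + extraDiff g s a b₀ b₁ (k * g + i)) :
    HasDiff g s a b₀ b₁ μ t := by
  refine ⟨hs, ⟨_, ht⟩, fun z => ?_⟩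
  have hz : z = z / g * g + z % g := by rw [mul_comm]; exact (Int.mul_ediv_add_emod z g).symm
  have h1 := h (z / g) (z % g) (Int.emod_nonneg _ (by omega)) (Int.emod_lt_of_pos _ (by omega))
  rw [← hz] at h1
  have h2 := absCount_eq_pointCount (g := g) (s := s) (τ := fun j => g * b j + r j) ht z
  rw [h1, symDiff, h2, extraDiff]
  simp only [hb']
  ring

/-- Transposition reverses the word about -1/2, and a doubled distinct word is antisymmetric about
0. Composed, they show that the word of the transpose at x - 1 agrees with the word of μ at x for x
≠ 0. -/
theorem HasCharge.of_transpose {g : ℕ} {i m : ℤ} (hs : IsShiftSymmetric 0 μ)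
    (h : HasCharge g μ.transpose (i - 1) m) (h0 : ∀ k : ℤ, k * g + i ≠ 0) : HasCharge g μ i m := by
  have : {k : ℤ | ¬ IsZeroLetter μ.transpose (k * g + (i - 1))} =
      {k : ℤ | ¬ IsZeroLetter μ (k * g + i)} := by
    ext k
    rw [Set.mem_ofPred_eq, Set.mem_ofPred_eq, isZeroLetter_transpose, not_not, ← letter_eq_one_iff,
      ← letter_eq_one_iff]
    have h1 := hs.letter_neg (x := k * g + i) (by have := h0 k; push_cast; omega)
    have e : -1 - (k * g + (i - 1)) = -((0 : ℕ) : ℤ) - (k * g + i) := by push_cast; ring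
    rw [e, h1]
    have := (isMaya_letter μ).bin (k * g + i)
    omega
  rw [HasCharge, ← this]
  exact h

/-- The runner of residue `0` of a doubled distinct partition. -/
theorem diff_zero_runner {g : ℕ} (hg : 0 < g) (hs : IsShiftSymmetric 0 μ) {m : ℤ}
    (hm : IsGreatest ({1} ∪ {x : ℤ | ∃ h ∈ partsOfDouble μ, (g : ℤ) * x = g + h}) m)
    (hc : ∀ k : ℤ, k ≠ 1 → letter μ (k * g) = 1 → letter μ ((k - 1) * g) = 1) (k : ℤ) :
    letter μ (k * g - g) - letter μ (k * g) =
      (if k = m then 1 else 0) + (if k = 1 - m then 1 else 0) - (if k = 1 then 1 else 0) := by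
  have hg' : (0 : ℤ) < g := by omega
  have hm1 : 1 ≤ m := hm.2 (Or.inl rfl)
  have hpart : ∀ k : ℤ, 1 ≤ k → letter μ (k * g) = 1 → k + 1 ≤ m := by
    intro k hk h
    obtain ⟨p, hp⟩ : ∃ p : ℕ, (p : ℤ) = k * g := ⟨(k * g).toNat, Int.toNat_of_nonneg (by positivity)⟩
    refine hm.2 (Or.inr ⟨p, ?_, by rw [hp]; ring⟩)
    rw [partsOfDouble_eq, mem_shiftParts hs, hp, Nat.cast_zero, sub_zero]
    refine ⟨?_, h⟩
    have : 0 < k * g := by positivity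
    omega
  have htop : 1 < m → letter μ ((m - 1) * g) = 1 := by
    intro h1
    rcases hm.1 with h | ⟨p, hp, h⟩
    · have : m = 1 := h
      omega
    · rw [partsOfDouble_eq, mem_shiftParts hs, Nat.cast_zero, sub_zero] at hp
      exact (congrArg (letter μ) (by linarith)).trans hp.2
  have hdesc : ∀ l : ℕ, 1 ≤ m - 1 - l → letter μ ((m - 1 - l) * g) = 1 := by
    intro l
    induction l with
    | zero => intro h; simpa using htop (by omega)
    | succ l ih =>
      intro h
      push_cast at h
      have := hc _ (by omega) (ih (by omega))
      exact (congrArg (letter μ) (by push_cast; ring)).trans this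
  -- To the right of the centre the zeros are g, 2g, …, (m-1)g; by reflection those to the left are
  -- kg with k ≤ -m, and the centre is a one. The runner thus rises and falls again, and the
  -- possible rise from 0 to g accounts for the term -1 at k = 1.
  have hpos : ∀ k : ℤ, 1 ≤ k → letter μ (k * g) = if k ≤ m - 1 then 1 else 0 := by
    intro k hk
    split_ifs with h
    · have := hdesc (m - 1 - k).toNat (by omega)
      rwa [Int.toNat_of_nonneg (by omega), sub_sub_cancel] at this
    · have h1 := hpart k hk
      have := (isMaya_letter μ).bin (k * g)
      omega
  have h0 : letter μ (0 * g) = 0 := hs.letter_center (by simp)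
  have hneg : ∀ k : ℤ, k ≤ -1 → letter μ (k * g) = if k ≤ -m then 1 else 0 := by
    intro k hk
    have h1 := hs.letter_neg (x := -k * g) (by
      have : 0 < -k * g := mul_pos (by omega) hg'
      push_cast; omega)
    have e : -((0 : ℕ) : ℤ) - -k * g = k * g := by push_cast; ring
    rw [e, hpos (-k) (by omega)] at h1
    rw [h1]
    split_ifs <;> omega
  have e : k * g - g = (k - 1) * g := by ring
  rw [e]
  rcases lt_trichotomy k 0 with hk | rfl | hk
  · rw [hneg k (by omega), hneg (k - 1) (by omega)]
    split_ifs <;> omega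
  · rw [h0, hneg (0 - 1) (by omega)]
    split_ifs <;> omega
  · rw [hpos k (by omega)]
    rcases eq_or_ne k 1 with rfl | hk1
    · rw [sub_self, h0]
      split_ifs <;> omega
    · rw [hpos (k - 1) (by omega)]
      split_ifs <;> omega

/-- The runner of residue `g / 2` of a doubled distinct partition. -/
theorem diff_middle_runner {g q : ℕ} (hgq : g = 2 * q) (hq : 0 < q) (hs : IsShiftSymmetric 0 μ)
    {m : ℤ} (hm : IsGreatest {x : ℤ | IsZeroLetter μ.transpose ((x - 1) * g + (q - 1))} |m|)
    (hc : ∀ k : ℤ, k ≠ 0 → letter μ (k * g + q) = 1 → letter μ ((k - 1) * g + q) = 1) (k : ℤ) :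
    letter μ (k * g + q - g) - letter μ (k * g + q) =
      (if k = m then 1 else 0) + (if k = -m then 1 else 0) - (if k = 0 then 1 else 0) := by
  have hM0 := abs_nonneg m
  have hM1 := abs_choice m
  generalize |m| = M at hm hM0 hM1
  have hne : ∀ k : ℤ, k * g + q ≠ 0 := by
    intro k h
    rw [hgq] at h
    push_cast at h
    have : (q : ℤ) * (2 * k + 1) = 0 := by linarith
    rcases mul_eq_zero.1 this with h | h <;> omega
  have hsymm : ∀ k : ℤ, letter μ ((-1 - k) * g + q) = 1 - letter μ (k * g + q) := by
    intro k
    rw [← hs.letter_neg (x := k * g + q) (by have := hne k; push_cast; omega)]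
    congr 1
    rw [hgq]; push_cast; ring
  have hset : ∀ x : ℤ, IsZeroLetter μ.transpose ((x - 1) * g + (q - 1)) ↔
      letter μ ((x - 1) * g + q) = 1 := by
    intro x
    rw [isZeroLetter_transpose, ← letter_eq_one_iff]
    have h1 := hs.letter_neg (x := (x - 1) * g + q) (by have := hne (x - 1); push_cast; omega)
    have e : -1 - ((x - 1) * g + (q - 1) : ℤ) = -((0 : ℕ) : ℤ) - ((x - 1) * g + q) := by
      push_cast; ring
    rw [e, h1]
    have := (isMaya_letter μ).bin ((x - 1) * g + q)
    omega
  have htop := (hset _).1 hm.1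
  have hmax : ∀ k : ℤ, letter μ (k * g + q) = 1 → k + 1 ≤ M := by
    intro k hk
    refine hm.2 ((hset _).2 ?_)
    rwa [add_sub_cancel_right]
  have hdesc : ∀ l : ℕ, 0 ≤ M - 1 - l → letter μ ((M - 1 - l) * g + q) = 1 := by
    intro l
    induction l with
    | zero => intro _; simpa using htop
    | succ l ih =>
      intro h
      push_cast at h
      have := hc _ (by omega) (ih (by omega))
      exact (congrArg (letter μ) (by push_cast; ring)).trans this
  -- The zeros with k ≥ 0 are those with k < M; the antisymmetry under k ↦ -1 - k leaves k < -M on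
  -- the negative side, and the rise at k = 0 accounts for the term -1.
  have hpos : ∀ k : ℤ, 0 ≤ k → letter μ (k * g + q) = if k < M then 1 else 0 := by
    intro k hk
    split_ifs with h
    · have := hdesc (M - 1 - k).toNat (by omega)
      rwa [Int.toNat_of_nonneg (by omega), sub_sub_cancel] at this
    · have h1 := hmax k
      have := (isMaya_letter μ).bin (k * g + q)
      omega
  have hneg : ∀ k : ℤ, k < 0 → letter μ (k * g + q) = if k < -M then 1 else 0 := by
    intro k hk
    have h1 := hsymm k
    rw [hpos _ (by omega)] at h1
    have h2 : letter μ (k * g + q) = 1 - if -1 - k < M then 1 else 0 := by linarith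
    rw [h2]
    split_ifs <;> omega
  have e : k * g + q - g = (k - 1) * g + q := by ring
  rw [e]
  rcases le_or_gt k 0 with hk | hk
  · rw [hneg (k - 1) (by omega)]
    rcases hk.eq_or_lt with rfl | hk
    · rw [hpos 0 le_rfl]
      split_ifs <;> omega
    · rw [hneg k hk]
      split_ifs <;> omega
  · rw [hpos k hk.le, hpos (k - 1) (by omega)]
    split_ifs <;> omega

end AffineHook

/-! ### First differences type by type -/

namespace AffineHook
variable {μ : YoungDiagram}

theorem extraDiff_mul_add {g s a b₀ b₁ k i : ℤ} (hs : 0 ≤ s) (hs' : s ≤ 1) (hi : 0 ≤ i) (hi' : i < g) :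
    extraDiff g s a b₀ b₁ (k * g + i) = a * (if k = 0 ∧ 2 * i = g - s then 1 else 0) +
      b₀ * (if k = 0 ∧ i = 0 then 1 else 0) + b₁ * (if k = 1 ∧ i = 0 then 1 else 0) := by
  have h1 : 2 * (k * g + i) = g - s ↔ k = 0 ∧ 2 * i = g - s := by
    constructor
    · intro h
      have hk : k = 0 := by
        by_contra hk
        rcases lt_or_gt_of_ne hk with hk | hk
        · have : k * g ≤ -1 * g := mul_le_mul_of_nonneg_right (by omega) (by omega)
          omega
        · have : 1 * g ≤ k * g := mul_le_mul_of_nonneg_right (by omega) (by omega)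
          omega
      subst hk
      omega
    · rintro ⟨rfl, h⟩; omega
  have h2 : k * g + i = 0 ↔ k = 0 ∧ i = 0 := by
    have := mul_add_eq_iff (k := k) (b := 0) (r := 0) hi hi' le_rfl (by omega)
    simpa using this
  have h3 : k * g + i = g ↔ k = 1 ∧ i = 0 := by
    have := mul_add_eq_iff (k := k) (b := 1) (r := 0) hi hi' le_rfl (by omega)
    simpa using this
  rw [extraDiff, if_congr_prop h1, if_congr_prop h2, if_congr_prop h3]

/-- Common to `D2`, `A2even` (s = 1) and `C`, `A2evenDual` (s = 0). In order of residue there are: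
if s = 0, a runner of charge 0 giving the mass at position 0; n runners of charges β_j; if a = 1, a
central runner of charge 0; and the n mirror images. Together these are g = 2n + a + (1 - s)
runners. -/
theorem hasDiff_of_core {g s n : ℕ} {a : ℤ} (hs : IsShiftSymmetric s μ) (ha : a = 0 ∨ a = 1)
    (hg : (g : ℤ) = 2 * n + a + (1 - s)) (hg0 : 0 < g)
    (hc : ∀ z, letter μ z = 1 → letter μ (z - g) = 1) {β : Fin n → ℤ}
    (h : ∀ j : Fin n, HasCharge g μ (j + (1 - s)) (β j) ∧ HasCharge g μ (g - 1 - j) (-β j))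
    (h0 : s = 0 → HasCharge g μ 0 0) (h1 : a = 1 → HasCharge g μ (n + 1 - s) 0) :
    HasDiff g s a (1 - s) 0 μ (fun j : Fin n => ((g : ℚ) - s) / 2 - (g * β j + (j + (1 - s)) : ℤ)) := by
  have hs1 := hs.le_one
  have hcc : ∀ i k : ℤ, letter μ (k * g + i) = 1 → letter μ ((k - 1) * g + i) = 1 := by
    intro i k hk
    have e : (k - 1) * g + i = k * g + i - g := by ring
    rw [e]
    exact hc _ hk
  refine hasDiff_of_runners hs hg0 β (fun j => -β j) (fun j => (j : ℤ) + (1 - s))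
    (fun j => (g : ℤ) - 1 - j) (fun j => rfl) (fun j => by ring) ?_
  have hr : ∀ j : Fin n, 0 ≤ (j : ℤ) + (1 - s) ∧ (j : ℤ) + (1 - s) < g := fun j => by
    have := j.isLt; omega
  have hr' : ∀ j : Fin n, 0 ≤ (g : ℤ) - 1 - j ∧ (g : ℤ) - 1 - j < g := fun j => by
    have := j.isLt; omega
  have hinj : Function.Injective fun j : Fin n => (j : ℤ) + (1 - s) := fun j l hjl => by
    simp only at hjl; exact Fin.ext (by omega)
  have hinj' : Function.Injective fun j : Fin n => (g : ℤ) - 1 - j := fun j l hjl => by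
    simp only at hjl; exact Fin.ext (by omega)
  intro k i hi hi'
  rw [extraDiff_mul_add (by omega) (by omega) hi hi']
  by_cases c1 : i < 1 - s
  · obtain rfl : s = 0 := by omega
    obtain rfl : i = 0 := by omega
    rw [diff_of_hasCharge (h0 rfl) (hcc 0), pointCount_eq_zero le_rfl hi' hr (fun j => by omega),
      pointCount_eq_zero le_rfl hi' hr' (fun j => by have := j.isLt; omega)]
    simp
    omega
  by_cases c2 : i < n + 1 - s
  · obtain ⟨j, hj⟩ : ∃ j : Fin n, (j : ℤ) + (1 - s) = i := ⟨⟨(i - (1 - s)).toNat, by omega⟩, by simp; omega⟩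
    have hd := diff_of_hasCharge (h j).1 (hcc _) k
    rw [hj] at hd
    rw [hd, pointCount_eq_ite hr hinj hj, pointCount_eq_zero hi hi' hr' (fun j => by have := j.isLt; omega),
      if_neg (by omega : ¬ (k = 0 ∧ 2 * i = g - s))]
    rcases (by omega : s = 0 ∨ s = 1) with rfl | rfl
    · rw [if_neg (by omega : ¬ (k = 0 ∧ i = 0))]; simp
    · simp
  by_cases c3 : i < n + 1 - s + a
  · obtain rfl : a = 1 := by omega
    obtain rfl : i = n + 1 - s := by omega
    rw [diff_of_hasCharge (h1 rfl) (hcc _), pointCount_eq_zero hi hi' hr (fun j => by have := j.isLt; omega),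
      pointCount_eq_zero hi hi' hr' (fun j => by have := j.isLt; omega)]
    have e : (k = 0 ∧ 2 * ((n : ℤ) + 1 - s) = g - s) ↔ k = 0 := by omega
    rw [if_congr_prop e]
    rcases (by omega : s = 0 ∨ s = 1) with rfl | rfl
    · rw [if_neg (by omega : ¬ (k = 0 ∧ (n : ℤ) + 1 - (0 : ℕ) = 0))]; simp
    · simp
  · obtain ⟨j, hj⟩ : ∃ j : Fin n, (g : ℤ) - 1 - j = i := ⟨⟨(g - 1 - i).toNat, by omega⟩, by simp; omega⟩
    have hd := diff_of_hasCharge (h j).2 (hcc _) k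
    rw [hj] at hd
    rw [hd, pointCount_eq_ite hr' hinj' hj, pointCount_eq_zero hi hi' hr (fun j => by have := j.isLt; omega)]
    have e2 : ¬ (k = 0 ∧ i = 0) ∨ s = 1 := by omega
    have e1 : ¬ (k = 0 ∧ 2 * i = g - s) := by omega
    rw [if_neg e1]
    rcases e2 with e2 | rfl
    · rw [if_neg e2]; simp
    · simp

/-- Common to `B`, `A2odd` and `D`, with a = 0, 1, -1. The point gβ_1 and its mirror image g(1 -
β_1) lie on the same runner 0, so the two admissible values of β_1 give the same first difference;
the runner has an extra mass -1 at g. If a = -1, both points of the last coordinate share the middle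
runner, with an extra mass -1 at the centre; if a = 1, the middle runner has charge 0 and gives a
mass 1 there. -/
theorem hasDiff_of_doubled {g n : ℕ} {a : ℤ} (hs : IsShiftSymmetric 0 μ)
    (ha : a = 0 ∨ a = 1 ∨ a = -1) (hn : 2 ≤ n) (hn' : a = -1 → 3 ≤ n) (hg : (g : ℤ) = 2 * n - 1 + a)
    (hc : ∀ z, letter μ z = 1 → z ≠ g → (a ≠ -1 ∨ 2 * z ≠ g) → letter μ (z - g) = 1) {β : Fin n → ℤ}
    (hfirst : ∃ m : ℤ, IsGreatest ({1} ∪ {x : ℤ | ∃ h ∈ partsOfDouble μ, (g : ℤ) * x = g + h}) m ∧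
      ∀ j : Fin n, (j : ℕ) = 0 → β j = m ∨ β j = 1 - m)
    (h : ∀ j : Fin n, 1 ≤ (j : ℕ) → (a = -1 → (j : ℕ) + 1 < n) →
      HasCharge g μ.transpose (j - 1) (β j) ∧ HasCharge g μ.transpose (g - 1 - j) (-β j))
    (h1 : a = 1 → HasCharge g μ.transpose (n - 1) 0)
    (h2 : a = -1 → ∀ j : Fin n, (j : ℕ) + 1 = n →
      IsGreatest {x : ℤ | IsZeroLetter μ.transpose ((x - 1) * g + (n - 2))} |β j|) :
    HasDiff g 0 a 0 (-1) μ (fun j : Fin n => (g : ℚ) / 2 - (g * β j + j : ℤ)) := by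
  have hg0 : 0 < g := by omega
  have hcc : ∀ i k : ℤ, 0 < i → i < g → (a = -1 → 2 * i ≠ g ∨ k ≠ 0) →
      letter μ (k * g + i) = 1 → letter μ ((k - 1) * g + i) = 1 := by
    intro i k hi hi' hik hk
    have e : (k - 1) * g + i = k * g + i - g := by ring
    rw [e]
    have e2 := extraDiff_mul_add (g := g) (s := 0) (a := 1) (b₀ := 0) (b₁ := 0) (k := k) le_rfl
      zero_le_one hi.le hi'
    have e3 := extraDiff_mul_add (g := g) (s := 0) (a := 0) (b₀ := 0) (b₁ := 1) (k := k) le_rfl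
      zero_le_one hi.le hi'
    simp only [extraDiff, sub_zero] at e2 e3
    refine hc _ hk (fun h' => ?_) ?_
    · rw [if_pos h', if_neg (by omega : ¬ (k = 1 ∧ i = 0))] at e3
      omega
    · by_cases ha1 : a = -1
      · right
        intro h'
        rw [if_pos h', if_neg (by have := hik ha1; omega : ¬ (k = 0 ∧ 2 * i = g))] at e2
        omega
      · exact Or.inl ha1
  have hne : ∀ i k : ℤ, 0 < i → i < g → k * g + i ≠ 0 := by
    intro i k hi hi' h'
    have := mul_add_eq_iff (k := k) (b := 0) (r := 0) hi.le hi' le_rfl (by omega)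
    rw [mul_zero, add_zero] at this
    have := this.1 h'
    omega
  have hz : ((0 : ℕ) : ℚ) = 0 := Nat.cast_zero
  set b' : Fin n → ℤ := fun j => if (j : ℕ) = 0 then 1 - β j else -β j with hb'
  set r' : Fin n → ℤ := fun j => if (j : ℕ) = 0 then 0 else (g : ℤ) - j with hr'
  refine hasDiff_of_runners hs hg0 β b' (fun j => (j : ℤ)) r' (fun j => by rw [hz, sub_zero])
    (fun j => ?_) ?_
  · simp only [hb', hr']
    split_ifs with hj
    · rw [hj]; push_cast; ring
    · push_cast; ring
  have hr : ∀ j : Fin n, 0 ≤ (j : ℤ) ∧ (j : ℤ) < g := fun j => by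
    have := j.isLt; omega
  have hrr : ∀ j : Fin n, 0 ≤ r' j ∧ r' j < g := fun j => by
    have := j.isLt; simp only [hr']; split_ifs <;> omega
  have hinj : Function.Injective fun j : Fin n => (j : ℤ) := fun j l hjl => by
    simp only at hjl; exact Fin.ext (by omega)
  have hinj' : Function.Injective r' := fun j l hjl => by
    have := j.isLt
    have := l.isLt
    simp only [hr'] at hjl; exact Fin.ext (by split_ifs at hjl <;> omega)
  intro k i hi hi'
  rw [extraDiff_mul_add (by simp) (by simp) hi hi', zero_mul, add_zero, Nat.cast_zero, sub_zero]
  rcases hi.eq_or_lt with rfl | hi0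
  · obtain ⟨m, hm, hβ⟩ := hfirst
    let j : Fin n := ⟨0, by omega⟩
    have hj0 : r' j = 0 := if_pos rfl
    have hbj : b' j = 1 - β j := if_pos rfl
    have hj00 : ((j : ℕ) : ℤ) = 0 := rfl
    rw [pointCount_eq_ite hr hinj hj00, pointCount_eq_ite hrr hinj' hj0, hbj, add_zero,
      diff_zero_runner hg0 hs hm]
    · have e : ¬ (k = 0 ∧ 2 * 0 = (g : ℤ)) := by omega
      rw [if_neg e]
      rcases hβ j rfl with h' | h' <;> rw [h'] <;> split_ifs <;> omega
    · intro k hk1 hk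
      have e : (k - 1) * (g : ℤ) = k * g - g := by ring
      rw [e]
      refine hc _ hk (fun h' => hk1 ?_) (Or.inr fun h' => ?_)
      · have : (k - 1) * (g : ℤ) = 0 := by linarith
        rcases mul_eq_zero.1 this with h | h <;> omega
      · have : (2 * k - 1) * (g : ℤ) = 0 := by linarith
        rcases mul_eq_zero.1 this with h | h <;> omega
  rw [if_neg (by omega : ¬ (k = 1 ∧ i = 0)), mul_zero, add_zero]
  by_cases c1 : i < n ∧ (a = -1 → i + 1 < n)
  · obtain ⟨j, hj⟩ : ∃ j : Fin n, (j : ℤ) = i := ⟨⟨i.toNat, by omega⟩, by simp; omega⟩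
    have hd := diff_of_hasCharge (((h j) (by omega) (by omega)).1.of_transpose hs
      (fun k => hne _ k (by omega) (by omega))) (fun k => hcc _ k (by omega) (by omega) (by omega)) k
    rw [hj] at hd
    rw [hd, pointCount_eq_ite hr hinj hj, pointCount_eq_zero hi hi' hrr (fun j => by
      have := j.isLt; simp only [hr']; split_ifs <;> omega)]
    have e1 : a * (if k = 0 ∧ 2 * i = (g : ℤ) then 1 else 0) = 0 := by
      rw [if_neg (by omega), mul_zero]
    rw [e1]; ring
  by_cases c2 : 2 * i = g
  · rcases ha with rfl | rfl | rfl
    · omega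
    · obtain rfl : i = n := by omega
      have hd := diff_of_hasCharge ((h1 rfl).of_transpose hs
        (fun k => hne _ k (by omega) (by omega))) (fun k => hcc _ k (by omega) (by omega) (by omega)) k
      rw [hd, pointCount_eq_zero hi hi' hr (fun j => by have := j.isLt; omega),
        pointCount_eq_zero hi hi' hrr (fun j => by
          have := j.isLt; simp only [hr']; split_ifs <;> omega),
        if_congr_prop (by omega : (k = 0 ∧ 2 * (n : ℤ) = g) ↔ k = 0)]
      ring
    · let j : Fin n := ⟨n - 1, by omega⟩
      have hj : (j : ℤ) = i := by simp only [j]; omega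
      have hj' : r' j = i := by simp only [hr', j]; rw [if_neg (by omega)]; omega
      have hbj : b' j = -β j := by simp only [hb', j]; rw [if_neg (by omega)]
      obtain ⟨q, hq⟩ : ∃ q : ℕ, (q : ℤ) = i := ⟨n - 1, by omega⟩
      have hgr := h2 rfl j (by simp only [j]; omega)
      have e : ((n : ℤ) - 2) = q - 1 := by omega
      rw [e] at hgr
      have hd := diff_middle_runner (q := q) (by omega) (by omega) hs hgr
        (fun k hk => hcc _ k (by omega) (by omega) (fun _ => Or.inr hk)) k
      rw [hq] at hd
      rw [hd, pointCount_eq_ite hr hinj hj, pointCount_eq_ite hrr hinj' hj', hbj,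
        if_congr_prop (by omega : (k = 0 ∧ 2 * i = (g : ℤ)) ↔ k = 0)]
      ring
  · obtain ⟨j, hj⟩ : ∃ j : Fin n, (g : ℤ) - j = i := ⟨⟨(g - i).toNat, by omega⟩, by simp; omega⟩
    have hj' : r' j = i := by simp only [hr']; rw [if_neg (by omega)]; omega
    have hbj : b' j = -β j := by simp only [hb']; rw [if_neg (by omega)]
    have hch := ((h j) (by omega) (by omega)).2
    have e : (g : ℤ) - 1 - j = i - 1 := by omega
    rw [e] at hch
    have hd := diff_of_hasCharge (hch.of_transpose hs
      (fun k => hne _ k (by omega) (by omega))) (fun k => hcc _ k (by omega) (by omega) (by omega)) k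
    rw [hd, pointCount_eq_zero hi hi' hr (fun j => by have := j.isLt; omega),
      pointCount_eq_ite hrr hinj' hj', hbj, if_neg (by omega : ¬ (k = 0 ∧ 2 * i = (g : ℤ)))]
    ring

/-- The symmetry type of the diagrams attached to an affine type. -/
def AffType.shift : AffType → ℕ
  | .D2 | .A2even => 1
  | _ => 0

/-- The coefficient of the point mass at the center. -/
def AffType.centerCoeff : AffType → ℤ
  | .A2even | .C | .A2odd => 1
  | .D => -1
  | _ => 0

/-- The mass at position 0, present when the runner of residue 0 has charge 0. -/
def AffType.zeroCoeff : AffType → ℤ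
  | .C | .A2evenDual => 1
  | _ => 0

/-- The mass at position g, present when the runner of residue 0 is not an initial segment in
general. -/
def AffType.topCoeff : AffType → ℤ
  | .B | .A2odd | .D => -1
  | _ => 0

/-- In every type the residue of the j-th runner subtracted from (g-s)/2 is ρ̊_j, which is how ρ̊ -
gβ arises from the multicharge. -/
theorem hasDiff_of_corresponds {T : AffType} {n : ℕ} (hT : T ≠ .A) (hn : T.RankOK n)
    {β : Fin n → ℤ} (hμ : InFamily T n μ) (hc : Corresponds T β μ) :
    HasDiff (T.eta n) T.shift T.centerCoeff T.zeroCoeff T.topCoeff μ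
      (fun j : Fin n => rho T.fin n j - T.eta n * β j) := by
  cases T with
  | A => exact absurd rfl hT
  | D2 =>
    have hn : 2 ≤ n := hn
    have hg : ((AffType.D2.eta n : ℕ) : ℤ) = 2 * n := by simp [AffType.eta]
    have hgq : ((AffType.D2.eta n : ℕ) : ℚ) = 2 * n := by simp [AffType.eta]
    have hs := hμ.1.isShiftSymmetric
    have key := hasDiff_of_core (s := 1) (a := 0) hs (by simp) (g := AffType.D2.eta n)
      (by rw [hg]; push_cast; ring) (by omega)
      (fun z hz => letter_sub_of_isCore (by omega) hμ.2 hz)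
      (β := β) (fun j => by simpa using hc j) (by simp) (by simp)
    convert key using 2 with j <;>
      first
      | rfl
      | (push_cast; rw [hgq, AffType.fin, rho]; ring)
  | A2even =>
    have hn : 1 ≤ n := hn
    have hg : ((AffType.A2even.eta n : ℕ) : ℤ) = 2 * n + 1 := by simp [AffType.eta]
    have hgq : ((AffType.A2even.eta n : ℕ) : ℚ) = 2 * n + 1 := by simp [AffType.eta]
    have hs := hμ.1.isShiftSymmetric
    have key := hasDiff_of_core (s := 1) (a := 1) hs (by simp) (g := AffType.A2even.eta n)
      (by rw [hg]; push_cast; ring) (by omega)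
      (fun z hz => letter_sub_of_isCore (by omega) hμ.2 hz)
      (β := β) (fun j => by simpa using hc.2 j) (by simp) (fun _ => by simpa using hc.1)
    convert key using 2 with j <;>
      first
      | rfl
      | (push_cast; rw [hgq, AffType.fin, rho]; ring)
  | C =>
    have hn : 2 ≤ n := hn
    have hg : ((AffType.C.eta n : ℕ) : ℤ) = 2 * n + 2 := by simp [AffType.eta]
    have hgq : ((AffType.C.eta n : ℕ) : ℚ) = 2 * n + 2 := by simp [AffType.eta]
    have hs := hμ.1.isShiftSymmetric
    have key := hasDiff_of_core (s := 0) (a := 1) hs (by simp) (g := AffType.C.eta n)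
      (by rw [hg]; push_cast; ring) (by omega)
      (fun z hz => letter_sub_of_hooksAbove hs (by omega) hμ.2.1 hμ.2.2 hz)
      (β := β) (fun j => by simpa using hc.2.2 j) (fun _ => hc.1) (fun _ => by simpa using hc.2.1)
    convert key using 2 with j <;>
      first
      | rfl
      | (push_cast; rw [hgq, AffType.fin, rho]; ring)
  | A2evenDual =>
    have hn : 1 ≤ n := hn
    have hg : ((AffType.A2evenDual.eta n : ℕ) : ℤ) = 2 * n + 1 := by simp [AffType.eta]
    have hgq : ((AffType.A2evenDual.eta n : ℕ) : ℚ) = 2 * n + 1 := by simp [AffType.eta]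
    have hs := hμ.1.isShiftSymmetric
    have key := hasDiff_of_core (s := 0) (a := 0) hs (by simp) (g := AffType.A2evenDual.eta n)
      (by rw [hg]; push_cast; ring) (by omega)
      (fun z hz => letter_sub_of_hooksAbove hs (by omega) hμ.2.1 hμ.2.2 hz)
      (β := β) (fun j => by simpa using hc.2 j) (fun _ => hc.1) (by simp)
    convert key using 2 with j <;>
      first
      | rfl
      | (push_cast; rw [hgq, AffType.fin, rho]; ring)
  | B =>
    have hn : 2 ≤ n := hn
    have hg : ((AffType.B.eta n : ℕ) : ℤ) = 2 * n - 1 := by simp only [AffType.eta]; omega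
    have hgq : ((AffType.B.eta n : ℕ) : ℚ) = 2 * n - 1 := by
      exact_mod_cast congrArg (Int.cast (R := ℚ)) hg
    have hs := hμ.1.isShiftSymmetric
    have key := hasDiff_of_doubled (a := 0) hs (by simp) (by omega) (by omega) (g := AffType.B.eta n)
      (by rw [hg]; ring)
      (fun z hz hzg hz2 => letter_sub_of_hooksBelow hs (by omega) hμ.2.1 hz (by push_cast; omega) (by
        push_cast; omega))
      (β := β) hc.1 (fun j hj _ => hc.2 j hj) (by simp) (by simp)
    convert key using 2 with j <;>
      first
      | rfl
      | (push_cast; rw [hgq, AffType.fin, rho]; ring)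
  | A2odd =>
    have hn : 2 ≤ n := hn
    have hg : ((AffType.A2odd.eta n : ℕ) : ℤ) = 2 * n := by simp only [AffType.eta]; omega
    have hgq : ((AffType.A2odd.eta n : ℕ) : ℚ) = 2 * n := by
      exact_mod_cast congrArg (Int.cast (R := ℚ)) hg
    have hs := hμ.1.isShiftSymmetric
    have key := hasDiff_of_doubled (a := 1) hs (by simp) (by omega) (by omega) (g := AffType.A2odd.eta n)
      (by rw [hg]; ring)
      (fun z hz hzg hz2 => letter_sub_of_hooksBelow hs (by omega) hμ.2.1 hz (by push_cast; omega) (by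
        intro h'
        push_cast at h'
        obtain ⟨p, hp⟩ : ∃ p : ℕ, (p : ℤ) = z := ⟨z.toNat, by omega⟩
        refine hμ.2.2 p ?_ (by omega)
        rw [partsOfDouble_eq, mem_shiftParts hs, hp]
        exact ⟨by omega, by simpa using hz⟩))
      (β := β) hc.1 (fun j hj _ => hc.2.2 j hj) (fun _ => hc.2.1) (by simp)
    convert key using 2 with j <;>
      first
      | rfl
      | (push_cast; rw [hgq, AffType.fin, rho]; ring)
  | D =>
    have hn : 3 ≤ n := hn
    have hg : ((AffType.D.eta n : ℕ) : ℤ) = 2 * n - 2 := by simp only [AffType.eta]; omega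
    have hgq : ((AffType.D.eta n : ℕ) : ℚ) = 2 * n - 2 := by
      exact_mod_cast congrArg (Int.cast (R := ℚ)) hg
    have hs := hμ.1.isShiftSymmetric
    have key := hasDiff_of_doubled (a := -1) hs (by simp) (by omega) (by omega) (g := AffType.D.eta n)
      (by rw [hg]; ring)
      (fun z hz hzg hz2 => letter_sub_of_hooksBelow hs (by omega) hμ.2 hz (by push_cast; omega) (by
        push_cast; omega))
      (β := β) hc.1 (fun j hj hj' => hc.2.1 j hj (hj' rfl)) (by simp) (fun _ => hc.2.2)
    convert key using 2 with j <;>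
      first
      | rfl
      | (push_cast; rw [hgq, AffType.fin, rho]; ring)

end AffineHook

namespace AffineHook

/-! ## Laurent monomials in the variables `X_k` -/

theorem X_ne_zero (k : ℤ) : X k ≠ 0 := by
  rw [X, Ne, FaithfulSMul.algebraMap_eq_zero_iff]
  exact MvPolynomial.X_ne_zero k

/-- `x` is the Laurent monomial in which `X_k` has the exponent `a k`. -/
def HasExponents (x : K) (a : ℤ → ℤ) : Prop :=
  (Function.support a).Finite ∧ x = ∏ᶠ k, X k ^ a k

namespace HasExponents
variable {x y : K} {a b : ℤ → ℤ}

/-- Equal exponents give equal monomials. The converse is never needed, so of the variables only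
`X_ne_zero` is used. -/
theorem eq (hx : HasExponents x a) (hy : HasExponents y a) : x = y := hx.2.trans hy.2.symm

theorem finite_mulSupport (hx : HasExponents x a) :
    (Function.mulSupport fun k => X k ^ a k).Finite := by
  refine hx.1.subset fun k hk h => hk ?_
  simp only [h, zpow_zero]

theorem one : HasExponents 1 fun _ => 0 := ⟨by simp, by simp⟩

theorem X (m : ℤ) : HasExponents (X m) fun k => if m = k then 1 else 0 := by
  refine ⟨(Set.finite_singleton m).subset fun k hk => ?_, ?_⟩
  · by_contra h
    exact hk (if_neg fun h' => h h'.symm)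
  · rw [finprod_eq_single _ m]
    · simp
    · intro k hk
      simp [hk.symm]

theorem mul (hx : HasExponents x a) (hy : HasExponents y b) :
    HasExponents (x * y) fun k => a k + b k := by
  refine ⟨(hx.1.union hy.1).subset (Function.support_add _ _), ?_⟩
  rw [hx.2, hy.2, ← finprod_mul_distrib hx.finite_mulSupport hy.finite_mulSupport]
  exact finprod_congr fun k => (zpow_add₀ (X_ne_zero k) _ _).symm

theorem inv (hx : HasExponents x a) : HasExponents x⁻¹ fun k => -a k := by
  refine ⟨by simpa [Function.support_fun_neg] using hx.1, ?_⟩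
  rw [hx.2, ← finprod_inv_distrib]
  exact finprod_congr fun k => (zpow_neg _ _).symm

theorem div (hx : HasExponents x a) (hy : HasExponents y b) :
    HasExponents (x / y) fun k => a k - b k := by
  simpa only [div_eq_mul_inv, sub_eq_add_neg] using hx.mul hy.inv

theorem pow (hx : HasExponents x a) (m : ℕ) : HasExponents (x ^ m) fun k => m * a k := by
  induction m with
  | zero => simpa using one
  | succ m ih =>
    have h := ih.mul hx
    rw [← pow_succ] at h
    convert h using 2 with k
    push_cast; ring

theorem prod {ι : Type*} {s : Finset ι} {f : ι → K} {a : ι → ℤ → ℤ}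
    (h : ∀ i ∈ s, HasExponents (f i) (a i)) :
    HasExponents (∏ i ∈ s, f i) fun k => ∑ i ∈ s, a i k := by
  classical
  induction s using Finset.induction_on with
  | empty => simpa using one
  | insert i s hi ih =>
    simp only [Finset.prod_insert hi, Finset.sum_insert hi]
    exact (h i (by simp)).mul (ih fun j hj => h j (by simp [hj]))

theorem multiset_prod (M : Multiset ℕ) {f : ℕ → K} {a : ℕ → ℤ → ℤ}
    (h : ∀ i, HasExponents (f i) (a i)) :
    HasExponents (M.map f).prod fun k => (M.map fun i => a i k).sum := by
  induction M using Multiset.induction_on with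
  | empty => simpa using one
  | cons i M ih =>
    simp only [Multiset.map_cons, Multiset.prod_cons, Multiset.sum_cons]
    exact (h i).mul ih

end HasExponents

theorem hasExponents_Xq {q : ℚ} {m : ℤ} (h : q = m) :
    HasExponents (Xq q) fun k => if q = k then 1 else 0 := by
  subst h
  simpa [Xq] using HasExponents.X m

theorem sum_map_ite (M : Multiset ℕ) (x : ℤ) :
    (M.map fun m : ℕ => if (m : ℤ) = x then (1 : ℤ) else 0).sum = mult M x := by
  induction M using Multiset.induction_on with
  | empty => simp [mult]
  | cons m M ih =>
    rw [Multiset.map_cons, Multiset.sum_cons, ih, mult, mult, Multiset.countP_cons]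
    split_ifs <;> push_cast <;> ring

theorem sum_map_ite_of_iff (M : Multiset ℕ) {p : ℕ → Prop} [DecidablePred p] {x : ℤ}
    (h : ∀ m : ℕ, p m ↔ (m : ℤ) = x) : (M.map fun m => if p m then (1 : ℤ) else 0).sum = mult M x := by
  rw [← sum_map_ite]
  exact congrArg _ (Multiset.map_congr rfl fun m _ => if_congr_prop (h m))

theorem sum_map_ite_double (s : ℕ) (μ : YoungDiagram) {p : ℕ → Prop} [DecidablePred p] {x : ℤ}
    (h : ∀ m : ℕ, p m ↔ 2 * (m : ℤ) - s = x) :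
    ((shiftParts s μ).map fun m => if p m then (1 : ℤ) else 0).sum = doubleMult s μ x := by
  rw [doubleMult, half]
  split_ifs with hd
  · exact sum_map_ite_of_iff _ fun m => by rw [h]; omega
  · refine Multiset.sum_eq_zero fun y hy => ?_
    obtain ⟨m, -, rfl⟩ := Multiset.mem_map.1 hy
    refine if_neg fun hm => hd ?_
    rw [h] at hm
    omega

/-- The exponents of `∏ X_{h-g} X_{h+g} / X_h²`. -/
theorem hasExponents_hooks (M : Multiset ℕ) (g : ℤ) :
    HasExponents (M.map fun h : ℕ => X ((h : ℤ) - g) * X ((h : ℤ) + g) / X h ^ 2).prod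
      fun k => mult M (k + g) + mult M (k - g) - 2 * mult M k := by
  convert HasExponents.multiset_prod M fun h => ((HasExponents.X ((h : ℤ) - g)).mul
    (HasExponents.X ((h : ℤ) + g))).div ((HasExponents.X (h : ℤ)).pow 2) using 2 with k
  rw [Multiset.sum_map_sub, Multiset.sum_map_add, Multiset.sum_map_mul_left, sum_map_ite,
    sum_map_ite_of_iff M (x := k + g) fun m => by omega,
    sum_map_ite_of_iff M (x := k - g) fun m => by omega]
  rfl

/-- The coefficient of the parts with `2 p - s = x` in the exponent identity. -/
def AffType.doubleSign : AffType → ℤ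
  | .D => -1
  | _ => 1

/-- The coefficient of the parts `x` in the exponent identity. -/
def AffType.partSign (T : AffType) : ℤ := T.zeroCoeff + T.topCoeff

theorem parts_eq {T : AffType} (hT : T ≠ .A) (μ : YoungDiagram) : parts T μ = shiftParts T.shift μ := by
  cases T with
  | A => exact absurd rfl hT
  | D2 => exact partsOfSelfConjugate_eq
  | A2even => exact partsOfSelfConjugate_eq
  | _ => rfl

theorem hookMultiset_eq {T : AffType} (hT : T ≠ .A) (μ : YoungDiagram) :
    hookMultiset T μ = hooksBelow μ := by
  cases T with
  | A => exact absurd rfl hT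
  | _ => rfl

/-- Let P count the parts. A factor X_{h-g}/X_h has exponent P(k+g) - P(k), and twice this is the
second difference of P plus P(k+g) - P(k-g); for X_{h+g}/X_h the last difference changes sign. The
same holds with 2h or 2h-1 for h. The second differences complete the hooks below the diagonal to
`hookCount`, and the signs are `partSign` and `doubleSign`. -/
theorem exists_exponents_partFactor {T : AffType} (hT : T ≠ .A) (g : ℤ) (μ : YoungDiagram) :
    ∃ a : ℤ → ℤ, HasExponents ((parts T μ).map fun h : ℕ => partFactor T g h).prod a ∧
      ∀ k, 2 * a k + 2 * (mult (hooksBelow μ) (k + g) + mult (hooksBelow μ) (k - g) -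
          2 * mult (hooksBelow μ) k) =
        hookCount T.shift μ (k + g) + hookCount T.shift μ (k - g) - 2 * hookCount T.shift μ k +
        partCount T.shift T.partSign T.doubleSign μ (k + g) -
        partCount T.shift T.partSign T.doubleSign μ (k - g) := by
  rw [parts_eq hT]
  cases T with
  | A => exact absurd rfl hT
  | D2 | A2even =>
    refine ⟨_, HasExponents.multiset_prod _ fun h => (HasExponents.X (2 * h - 1 - g)).div
      (HasExponents.X (2 * (h : ℤ) - 1)), fun k => ?_⟩
    rw [Multiset.sum_map_sub, sum_map_ite_double _ _ (x := k + g),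
      sum_map_ite_double _ _ (x := k)]
    · simp only [hookCount, partCount, AffType.partSign, AffType.doubleSign, AffType.zeroCoeff,
        AffType.topCoeff, AffType.shift]
      push_cast; ring
    · intro m; simp only [AffType.shift]; push_cast; omega
    · intro m; simp only [AffType.shift]; push_cast; omega
  | C | A2evenDual =>
    refine ⟨_, HasExponents.multiset_prod _ fun h => ((HasExponents.X (2 * h - g)).mul
      (HasExponents.X (h - g))).div ((HasExponents.X (2 * (h : ℤ))).mul (HasExponents.X h)),
      fun k => ?_⟩
    rw [Multiset.sum_map_sub, Multiset.sum_map_add, Multiset.sum_map_add,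
      sum_map_ite_double _ _ (x := k + g),
      sum_map_ite_of_iff _ (x := k + g) fun m => by omega, sum_map_ite_double _ _ (x := k), sum_map_ite]
    · simp only [hookCount, partCount, AffType.partSign, AffType.doubleSign, AffType.zeroCoeff,
        AffType.topCoeff, AffType.shift]
      push_cast; ring
    · intro m; simp only [AffType.shift]; push_cast; omega
    · intro m; simp only [AffType.shift]; push_cast; omega
  | B | A2odd =>
    refine ⟨_, HasExponents.multiset_prod _ fun h => ((HasExponents.X (2 * h - g)).mul
      (HasExponents.X (h + g))).div ((HasExponents.X (2 * (h : ℤ))).mul (HasExponents.X h)),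
      fun k => ?_⟩
    rw [Multiset.sum_map_sub, Multiset.sum_map_add, Multiset.sum_map_add,
      sum_map_ite_double _ _ (x := k + g),
      sum_map_ite_of_iff _ (x := k - g) fun m => by omega, sum_map_ite_double _ _ (x := k), sum_map_ite]
    · simp only [hookCount, partCount, AffType.partSign, AffType.doubleSign, AffType.zeroCoeff,
        AffType.topCoeff, AffType.shift]
      push_cast; ring
    · intro m; simp only [AffType.shift]; push_cast; omega
    · intro m; simp only [AffType.shift]; push_cast; omega
  | D =>
    refine ⟨_, HasExponents.multiset_prod _ fun h => ((HasExponents.X (2 * h + g)).mul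
      (HasExponents.X (h + g))).div ((HasExponents.X (2 * (h : ℤ))).mul (HasExponents.X h)),
      fun k => ?_⟩
    rw [Multiset.sum_map_sub, Multiset.sum_map_add, Multiset.sum_map_add,
      sum_map_ite_double _ _ (x := k - g),
      sum_map_ite_of_iff _ (x := k - g) fun m => by omega, sum_map_ite_double _ _ (x := k), sum_map_ite]
    · simp only [hookCount, partCount, AffType.partSign, AffType.doubleSign, AffType.zeroCoeff,
        AffType.topCoeff, AffType.shift]
      push_cast; ring
    · intro m; simp only [AffType.shift]; push_cast; omega
    · intro m; simp only [AffType.shift]; push_cast; omega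

/-- In `hookProduct` the multisets of naturals are lifted to integers by a monadic bind; this makes
it an ordinary map. -/
theorem map_do_cast (M : Multiset ℕ) (f : ℤ → K) :
    Multiset.map f (do let a ← M; pure (a : ℤ)) = M.map fun a : ℕ => f a := by
  simp [Multiset.bind_def, Multiset.pure_def, Multiset.bind_singleton]

/-- The exponents of the hook length product. -/
theorem exists_exponents_hookProduct {T : AffType} (hT : T ≠ .A) (n : ℕ) (μ : YoungDiagram) :
    ∃ a : ℤ → ℤ, HasExponents (hookProduct T n μ) a ∧ ∀ k, 2 * a k =
        hookCount T.shift μ (k + T.eta n) + hookCount T.shift μ (k - T.eta n) -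
        2 * hookCount T.shift μ k + partCount T.shift T.partSign T.doubleSign μ (k + T.eta n) -
        partCount T.shift T.partSign T.doubleSign μ (k - T.eta n) := by
  obtain ⟨a, ha, h⟩ := exists_exponents_partFactor hT (T.eta n) μ
  rw [hookProduct, map_do_cast, map_do_cast]
  refine ⟨_, ha.mul (hasExponents_hooks (hookMultiset T μ) (T.eta n)), fun k => ?_⟩
  rw [← h, hookMultiset_eq hT, mul_add]

theorem countP_eq_mult (M : Multiset ℕ) {p : ℕ → Prop} [DecidablePred p] {x : ℤ}
    (h : ∀ m : ℕ, p m ↔ (m : ℤ) = x) : (M.countP p : ℤ) = mult M x := by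
  rw [mult]
  congr 1
  exact Multiset.countP_congr rfl fun m _ => propext (h m)

theorem countP_eq_doubleMult (s : ℕ) (μ : YoungDiagram) {p : ℕ → Prop} [DecidablePred p] {x : ℤ}
    (h : ∀ m : ℕ, p m ↔ 2 * (m : ℤ) - s = x) :
    ((shiftParts s μ).countP p : ℤ) = doubleMult s μ x := by
  rw [← sum_map_ite_double s μ h]
  induction shiftParts s μ using Multiset.induction_on with
  | empty => simp
  | cons m M ih =>
    rw [Multiset.map_cons, Multiset.sum_cons, ← ih, Multiset.countP_cons]
    split_ifs <;> push_cast <;> ring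

/-- The shape of α' comes from here: each kind of part occurs in `hookCount` once, and the signed
term of `partCount` either doubles or cancels it. -/
theorem two_mul_alpha' {T : AffType} (hT : T ≠ .A) (n : ℕ) (μ : YoungDiagram) (i : ℕ) :
    2 * (alpha' T n μ i : ℤ) = hookCount T.shift μ (T.eta n - i) +
      partCount T.shift T.partSign T.doubleSign μ (T.eta n - i) := by
  have hB : (alpha T n μ i : ℤ) = mult (hooksBelow μ) (T.eta n - i) := by
    rw [alpha, hookMultiset_eq hT]
    exact countP_eq_mult _ fun m => by omega
  obtain ⟨x, hx⟩ : ∃ x, x = (T.eta n : ℤ) - i := ⟨_, rfl⟩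
  rw [alpha'.eq_def, Nat.cast_add, hB, ← hx]
  cases T with
  | A => exact absurd rfl hT
  | D2 | A2even =>
    simp only [parts_eq hT]
    rw [countP_eq_doubleMult _ _ (x := x)]
    · simp only [hookCount, partCount, AffType.partSign, AffType.doubleSign, AffType.zeroCoeff,
        AffType.topCoeff, AffType.shift]
      push_cast; ring
    · intro m; simp only [AffType.shift]; push_cast; omega
  | C | A2evenDual =>
    simp only [parts_eq hT]
    rw [Nat.cast_add, countP_eq_doubleMult _ _ (x := x),
      countP_eq_mult _ (x := x) fun m => by omega]
    · simp only [hookCount, partCount, AffType.partSign, AffType.doubleSign, AffType.zeroCoeff,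
        AffType.topCoeff, AffType.shift]
      push_cast; ring
    · intro m; simp only [AffType.shift]; push_cast; omega
  | B | A2odd =>
    simp only [parts_eq hT]
    rw [countP_eq_doubleMult _ _ (x := x)]
    · simp only [hookCount, partCount, AffType.partSign, AffType.doubleSign, AffType.zeroCoeff,
        AffType.topCoeff, AffType.shift]
      push_cast; ring
    · intro m; simp only [AffType.shift]; push_cast; omega
  | D =>
    simp only [hookCount, partCount, AffType.partSign, AffType.doubleSign, AffType.zeroCoeff,
      AffType.topCoeff, AffType.shift]
    push_cast; ring

/-- The exponents of `∏ (X_{-i} / X_i)^{α(i)}`. -/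
theorem hasExponents_prefactor (g : ℕ) (α : ℕ → ℕ) :
    HasExponents (∏ i ∈ Finset.Icc 1 (g - 1), (X (-(i : ℤ)) / X i) ^ α i)
      fun k => if 0 < k ∧ k < g then -(α k.natAbs : ℤ) else
        if k < 0 ∧ -k < g then (α k.natAbs : ℤ) else 0 := by
  convert HasExponents.prod (s := Finset.Icc 1 (g - 1)) fun i _ =>
    ((HasExponents.X (-(i : ℤ))).div (HasExponents.X i)).pow (α i) using 2 with k
  by_cases hk : 0 < k.natAbs ∧ k.natAbs < g
  · rw [Finset.sum_eq_single_of_mem k.natAbs (by simp; omega)]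
    · rcases lt_or_gt_of_ne (show k ≠ 0 by omega) with h | h
      · rw [if_neg (by omega), if_pos (by omega), if_pos (by omega), if_neg (by omega)]; ring
      · rw [if_pos (by omega), if_neg (by omega), if_pos (by omega)]; ring
    · intro i hi hik
      rw [if_neg (by omega), if_neg (by omega)]; ring
  · rw [if_neg (by omega), if_neg (by omega)]
    refine (Finset.sum_eq_zero fun i hi => ?_).symm
    rw [Finset.mem_Icc] at hi
    rw [if_neg (by omega), if_neg (by omega)]; ring

end AffineHook

namespace AffineHook

/-! ## The Weyl type product -/

variable {n : ℕ}

/-- The properties of the dominant vectors `r` (for the types other than `A`). -/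
structure IsRegular (T : AffType) (r : V n) : Prop where
  anti : StrictAnti r
  add_pos : ∀ i j, i < j → 0 < r i + r j
  pos : T.fin = .C → ∀ i, 0 < r i
  half_int : ∃ (p : ℤ) (τ : Fin n → ℤ), ∀ j, r j = (p : ℚ) / 2 - τ j
  int : T.fin = .C ∨ T.fin = .D → ∀ i, ∃ m : ℤ, r i = m

noncomputable def pairNum (r : V n) : K :=
  ∏ i : Fin n, ∏ j ∈ Finset.Ioi i, Xq (r i - r j) * Xq (r i + r j)

/-- The product `Δ_T(r)` without its denominator. -/
noncomputable def weylNum (T : AffType) (r : V n) : K :=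
  match T with
  | .A => ∏ i : Fin n, ∏ j ∈ Finset.Ioi i, Xq (r i - r j)
  | .B | .A2evenDual | .D2 => pairNum r
  | .C | .A2odd | .A2even => (∏ i, Xq (r i)) * pairNum r
  | .D => (∏ i, Xq (2 * |r i|) / Xq |r i|) * pairNum r

theorem Xq_intCast (m : ℤ) : Xq m = X m := by simp [Xq]

theorem Xq_eq {q : ℚ} {m : ℤ} (h : q = m) : Xq q = X m := by rw [h, Xq_intCast]

theorem pairProduct_eq {s : ℤ} {ρ : V n} (h1 : ∀ i j, ρ i - ρ j = ((j : ℤ) - i : ℤ))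
    (h2 : ∀ i j, ρ i + ρ j = (s - ((i : ℤ) + 1) - ((j : ℤ) + 1) : ℤ)) (r : V n) :
    pairProduct s r = pairNum r / pairNum ρ := by
  simp only [pairProduct, pairNum, Finset.prod_div_distrib]
  congr 1
  refine Finset.prod_congr rfl fun i _ => Finset.prod_congr rfl fun j _ => ?_
  rw [Xq_eq (h1 i j), Xq_eq (h2 i j)]

theorem singleProduct_eq {ρ : V n} (h : ∀ i, ρ i = ((n : ℤ) - i : ℤ)) (r : V n) :
    singleProduct r = (∏ i, Xq (r i)) / ∏ i, Xq (ρ i) := by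
  rw [singleProduct, Finset.prod_div_distrib]
  congr 1
  rw [← Equiv.prod_comp Fin.revPerm]
  refine Finset.prod_congr rfl fun i _ => ?_
  rw [Xq_eq (h i), Fin.revPerm_apply, Fin.val_rev]
  congr 1
  omega

/-- In type D the coordinates of ρ̊ are n-1, …, 0; the last one contributes X_0/X_0 = 1, so the
product starts at 1. -/
theorem prod_X_two_mul_div {ρ : V n} (hn : 1 ≤ n) (h : ∀ i, ρ i = ((n : ℤ) - i - 1 : ℤ)) :
    ∏ i ∈ Finset.Icc 1 (n - 1), X i / X (2 * (i : ℤ)) = (∏ i, Xq (2 * |ρ i|) / Xq |ρ i|)⁻¹ := by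
  obtain ⟨m, rfl⟩ : ∃ m, n = m + 1 := ⟨n - 1, by omega⟩
  have e : ∀ i : Fin (m + 1), Xq (2 * |ρ i|) / Xq |ρ i| =
      X (2 * ((Fin.revPerm i : Fin (m + 1)) : ℤ)) / X ((Fin.revPerm i : Fin (m + 1)) : ℤ) := by
    intro i
    have h' : |ρ i| = (((Fin.revPerm i : Fin (m + 1)) : ℤ) : ℚ) := by
      rw [h i, Fin.revPerm_apply, Fin.val_rev, abs_of_nonneg]
      · congr 1; omega
      · have : (0 : ℤ) ≤ ((m + 1 : ℕ) : ℤ) - i - 1 := by omega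
        exact_mod_cast this
    rw [Xq_eq h', Xq_eq (m := 2 * ((Fin.revPerm i : Fin (m + 1)) : ℤ)) (by rw [h']; push_cast; ring)]
  rw [Finset.prod_congr rfl fun i _ => e i,
    Equiv.prod_comp Fin.revPerm fun i : Fin (m + 1) => X (2 * ((i : ℕ) : ℤ)) / X ((i : ℕ) : ℤ),
    Fin.prod_univ_eq_prod_range (fun i : ℕ => X (2 * (i : ℤ)) / X (i : ℤ)) (m + 1),
    Finset.prod_range_succ']
  simp only [Nat.cast_zero, mul_zero, div_self (X_ne_zero 0), mul_one, add_tsub_cancel_right]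
  rw [← Finset.prod_inv_distrib, Finset.range_eq_Ico, Finset.prod_Ico_add' (fun i : ℕ => (X (2 * (i : ℤ)) / X (i : ℤ))⁻¹)]
  refine Finset.prod_congr ?_ fun i _ => (inv_div _ _).symm
  ext i; simp

/-- The denominators are chosen so that Δ_T(ρ̊) = 1; their exponents are therefore given by the same
counts, taken at ρ̊. -/
theorem weylProduct_eq {T : AffType} (hn : T.RankOK n) (r : V n) :
    weylProduct T r = weylNum T r / weylNum T (rho T.fin n) := by
  have hρ : ∀ i j, rho T.fin n i - rho T.fin n j = ((j : ℤ) - i : ℤ) := by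
    intro i j
    cases T <;> simp only [AffType.fin, rho] <;> push_cast <;> ring
  cases T with
  | A =>
    simp only [weylProduct, weylNum, Finset.prod_div_distrib]
    congr 1
    refine Finset.prod_congr rfl fun i _ => Finset.prod_congr rfl fun j _ => ?_
    rw [Xq_eq (hρ i j)]
  | B =>
    have hn : 2 ≤ n := hn
    refine pairProduct_eq hρ (fun i j => ?_) r
    simp only [AffType.fin, rho, AffType.eta]
    push_cast [show 1 ≤ 2 * n by omega]
    ring
  | A2evenDual | D2 =>
    refine pairProduct_eq hρ (fun i j => ?_) r
    simp only [AffType.fin, rho, AffType.eta]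
    push_cast
    ring
  | C | A2odd | A2even =>
    simp only [weylProduct, weylNum]
    rw [mul_div_mul_comm, singleProduct_eq (fun i => ?_), pairProduct_eq hρ (fun i j => ?_)]
    · simp only [AffType.fin, rho, AffType.eta]
      push_cast
      ring
    · simp only [AffType.fin, rho]
      push_cast
      ring
  | D =>
    have hn : 3 ≤ n := hn
    simp only [weylProduct, weylNum]
    rw [mul_div_mul_comm, prod_X_two_mul_div (ρ := rho .D n) (by omega) (fun i => ?_),
      pairProduct_eq hρ (fun i j => ?_)]
    · rfl
    · simp only [AffType.fin, rho, AffType.eta]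
      push_cast [show 2 ≤ 2 * n by omega]
      ring
    · simp only [rho]
      push_cast
      ring

theorem sum_sum_eq_of_symm {f : Fin n → Fin n → ℤ} (hf : ∀ i j, f i j = f j i) :
    ∑ i, ∑ j, f i j = 2 * ∑ i, ∑ j ∈ Finset.Ioi i, f i j + ∑ i, f i i := by
  have h := Finset.sum_sum_Ioi_add_eq_sum_sum_off_diag f
  have e : ∀ i, ∑ j, f i j = ∑ j ∈ {i}ᶜ, f j i + f i i := fun i => by
    rw [← Finset.sum_compl_add_sum {i}, Finset.sum_singleton]
    exact congrArg (· + _) (Finset.sum_congr rfl fun j _ => hf _ _)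
  rw [Finset.sum_congr rfl fun i _ => e i, Finset.sum_add_distrib, ← h, Finset.mul_sum]
  congr 1
  refine Finset.sum_congr rfl fun i _ => ?_
  rw [Finset.mul_sum]
  exact Finset.sum_congr rfl fun j _ => by rw [hf j i]; ring

theorem ite_eq_zero_of_lt {x y : ℚ} (h : x < y) : (if x = y then (1 : ℤ) else 0) = 0 :=
  if_neg h.ne

theorem ite_eq_zero_of_gt {x y : ℚ} (h : y < x) : (if x = y then (1 : ℤ) else 0) = 0 :=
  if_neg h.ne'

/-- For k > 0 dominance removes two of the four terms of `pairCount` when i ≠ j, and ordered pairs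
count each remaining factor twice. The diagonal i = j contributes the solutions of ±2r_i = k, which
are subtracted. -/
theorem IsRegular.exists_exponents_pairNum {T : AffType} {r : V n} (hr : IsRegular T r) :
    ∃ a, HasExponents (pairNum r) a ∧ (∀ k ≤ 0, a k = 0) ∧
      ∀ k > 0, 2 * a k = pairCount r k - absCount r ((k : ℚ) / 2) := by
  obtain ⟨p, τ, hτ⟩ := hr.half_int
  refine ⟨_, HasExponents.prod fun i _ => HasExponents.prod fun j _ =>
    (hasExponents_Xq (m := τ j - τ i) (by rw [hτ, hτ]; push_cast; ring)).mul
    (hasExponents_Xq (m := p - τ i - τ j) (by rw [hτ, hτ]; push_cast; ring)), fun k hk => ?_,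
    fun k hk => ?_⟩
  · have hk' : (k : ℚ) ≤ 0 := by exact_mod_cast hk
    refine Finset.sum_eq_zero fun i _ => Finset.sum_eq_zero fun j hj => ?_
    have hij := Finset.mem_Ioi.1 hj
    have h1 := hr.anti hij
    have h2 := hr.add_pos i j hij
    rw [ite_eq_zero_of_gt (by linarith), ite_eq_zero_of_gt (by linarith), add_zero]
  · have hk' : (0 : ℚ) < k := by exact_mod_cast hk
    rw [pairCount, sum_sum_eq_of_symm, add_sub_assoc, absCount, ← Finset.sum_sub_distrib,
      Finset.sum_eq_zero (s := Finset.univ) (f := fun i => _ - _), add_zero]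
    · congr 1
      refine Finset.sum_congr rfl fun i _ => Finset.sum_congr rfl fun j hj => ?_
      have hij := Finset.mem_Ioi.1 hj
      have h1 := hr.anti hij
      have h2 := hr.add_pos i j hij
      rw [ite_eq_zero_of_lt (x := r j - r i) (by linarith),
        ite_eq_zero_of_lt (x := -(r i + r j)) (by linarith)]
      ring
    · intro i _
      rw [sub_self, ite_eq_zero_of_lt hk',
        if_congr_prop (show r i + r i = k ↔ r i = (k : ℚ) / 2 by constructor <;> intro h <;> linarith),
        if_congr_prop (show -(r i + r i) = k ↔ -r i = (k : ℚ) / 2 by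
          constructor <;> intro h <;> linarith)]
      ring
    · intro i j
      rw [add_comm (r j) (r i)]
      ring

theorem abs_eq_count {x q : ℚ} (hq : 0 < q) : (if |x| = q then (1 : ℤ) else 0) =
    (if x = q then 1 else 0) + (if -x = q then 1 else 0) := by
  rcases lt_or_ge x 0 with h | h
  · rw [abs_of_neg h, ite_eq_zero_of_lt (x := x) (by linarith), zero_add]
  · rw [abs_of_nonneg h, ite_eq_zero_of_lt (x := -x) (by linarith), add_zero]

/-- The exponents of the Weyl type product. -/
theorem IsRegular.exists_exponents_weylNum {T : AffType} (hT : T ≠ .A) {r : V n}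
    (hr : IsRegular T r) : ∃ a, HasExponents (weylNum T r) a ∧ (∀ k ≤ 0, a k = 0) ∧
      ∀ k > 0, 2 * a k = pairCount r k + 2 * T.centerCoeff * absCount r k -
        T.doubleSign * absCount r ((k : ℚ) / 2) := by
  obtain ⟨a, ha, h0, h1⟩ := hr.exists_exponents_pairNum
  cases T with
  | A => exact absurd rfl hT
  | B | A2evenDual | D2 =>
    refine ⟨a, ha, h0, fun k hk => ?_⟩
    simp only [h1 k hk, AffType.centerCoeff, AffType.doubleSign]
    ring
  | C | A2odd | A2even =>
    choose m hm using hr.int (Or.inl rfl)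
    have hpos := hr.pos rfl
    refine ⟨_, (HasExponents.prod fun i _ => hasExponents_Xq (hm i)).mul ha, fun k hk => ?_,
      fun k hk => ?_⟩
    · have hk' : (k : ℚ) ≤ 0 := by exact_mod_cast hk
      rw [h0 k hk, Finset.sum_eq_zero fun i _ => ite_eq_zero_of_gt (hk'.trans_lt (hpos i)), add_zero]
    · have hk' : (0 : ℚ) < k := by exact_mod_cast hk
      have e : absCount r k = ∑ i, if r i = k then 1 else 0 := by
        refine Finset.sum_congr rfl fun i _ => ?_
        rw [ite_eq_zero_of_lt (x := -r i) (by linarith [hpos i]), add_zero]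
      rw [mul_add, h1 k hk, e]
      simp only [AffType.centerCoeff, AffType.doubleSign]
      ring
  | D =>
    choose m hm using hr.int (Or.inr rfl)
    -- The factors X_{2|r_i|}/X_{|r_i|} add 2 `absCount r (k/2)` - 2 `absCount r k` to the doubled
    -- exponent, which explains the signs -1 of `centerCoeff` and `doubleSign` in type D. For r_i =
    -- 0 the exponents at k = 0 cancel.
    refine ⟨_, (HasExponents.prod fun i _ => (hasExponents_Xq (m := 2 * |m i|) ?_).div
      (hasExponents_Xq (m := |m i|) ?_)).mul ha, fun k hk => ?_, fun k hk => ?_⟩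
    · rw [hm]; push_cast; ring
    · rw [hm]; push_cast; ring
    · have hk' : (k : ℚ) ≤ 0 := by exact_mod_cast hk
      rw [h0 k hk, add_zero]
      refine Finset.sum_eq_zero fun i _ => ?_
      rw [sub_eq_zero]
      refine if_congr_prop ?_
      have := abs_nonneg (r i)
      constructor <;> intro h <;> linarith
    · have hk' : (0 : ℚ) < k := by exact_mod_cast hk
      have e : ∀ q > 0, absCount r q = ∑ i, if |r i| = q then 1 else 0 := fun q hq =>
        Finset.sum_congr rfl fun i _ => (abs_eq_count hq).symm
      rw [mul_add, h1 k hk, e k hk', e _ (half_pos hk'), Finset.sum_sub_distrib]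
      have e2 : ∀ i, (if 2 * |r i| = k then (1 : ℤ) else 0) = if |r i| = (k : ℚ) / 2 then 1 else 0 :=
        fun i => if_congr_prop (by constructor <;> intro h <;> linarith)
      simp only [e2, AffType.centerCoeff, AffType.doubleSign]
      ring

end AffineHook

namespace AffineHook

variable {n : ℕ}

/-! ## Invariance of the counts under signed permutations -/

theorem pairCount_signed {r t : V n} {σ : Equiv.Perm (Fin n)} {η : Fin n → ℤ}
    (hη : ∀ i, η i = 1 ∨ η i = -1) (h : ∀ i, r i = η i * t (σ i)) (k : ℤ) :
    pairCount r k = pairCount t k := by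
  -- The summand is symmetric in its two coordinates and even in each of them.
  obtain ⟨f, hf⟩ : ∃ f : ℚ → ℚ → ℤ, ∀ x y, f x y = (if x - y = k then 1 else 0) +
    (if y - x = k then 1 else 0) + (if x + y = k then 1 else 0) +
    (if -(x + y) = k then 1 else 0) := ⟨_, fun _ _ => rfl⟩
  have hswap : ∀ x y, f x y = f y x := fun x y => by
    rw [hf, hf, add_comm x y]; ring
  have hneg : ∀ x y, f (-x) y = f x y := fun x y => by
    rw [hf, hf, show -x - y = -(x + y) by ring, show y - -x = x + y by ring,
      show -x + y = y - x by ring, neg_sub]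
    ring
  have hsign : ∀ i x y, f (η i * x) y = f x y := fun i x y => by
    rcases hη i with h | h <;> rw [h]
    · rw [Int.cast_one, one_mul]
    · rw [Int.cast_neg, Int.cast_one, neg_one_mul, hneg]
  simp only [pairCount, ← hf]
  refine (Finset.sum_congr rfl fun i _ => ?_).trans (Equiv.sum_comp σ fun i => ∑ j, f (t i) (t j))
  refine (Finset.sum_congr rfl fun j _ => ?_).trans (Equiv.sum_comp σ fun j => f (t (σ i)) (t j))
  rw [h, h, hsign, hswap, hsign, hswap]

theorem absCount_signed {r t : V n} {σ : Equiv.Perm (Fin n)} {η : Fin n → ℤ}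
    (hη : ∀ i, η i = 1 ∨ η i = -1) (h : ∀ i, r i = η i * t (σ i)) (q : ℚ) :
    absCount r q = absCount t q := by
  refine (Finset.sum_congr rfl fun i _ => ?_).trans (Equiv.sum_comp σ fun i =>
    (if t i = q then (1 : ℤ) else 0) + (if -t i = q then 1 else 0))
  rw [h i]
  rcases hη i with hi | hi <;> rw [hi] <;> push_cast
  · rw [one_mul]
  · rw [neg_one_mul, neg_neg, add_comm]

/-! ## Regularity of the vectors `r` and `ρ` -/

theorem exists_int_rho {T : AffType} (hF : T.fin = .C ∨ T.fin = .D) (i : Fin n) :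
    ∃ m : ℤ, rho T.fin n i = m := by
  rcases hF with h | h <;> rw [h, rho]
  · exact ⟨n - i, by push_cast; ring⟩
  · exact ⟨n - i - 1, by push_cast; ring⟩

theorem isRegular_rho {T : AffType} (hT : T ≠ .A) (n : ℕ) : IsRegular T (rho T.fin n) where
  anti i j hij := by
    rw [rho_eq, rho_eq]
    have : ((rhoTop T.fin n - 2 * (j : ℕ) : ℤ) : ℚ) < ((rhoTop T.fin n - 2 * (i : ℕ) : ℤ) : ℚ) := by
      exact_mod_cast (by have : (i : ℕ) < j := hij; omega)
    linarith
  add_pos i j hij := by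
    have hij' : ((i : ℕ) : ℚ) + 1 ≤ (j : ℕ) := by exact_mod_cast hij
    have hj : ((j : ℕ) : ℚ) + 1 ≤ n := by exact_mod_cast j.isLt
    cases T with
    | A => exact absurd rfl hT
    | _ => simp only [AffType.fin, rho]; linarith
  pos hF i := by
    have hi : ((i : ℕ) : ℚ) + 1 ≤ n := by exact_mod_cast i.isLt
    rw [hF, rho]
    linarith
  half_int := ⟨rhoTop T.fin n, fun i => (i : ℕ), fun i => by rw [rho_eq]; push_cast; ring⟩
  int hF i := exists_int_rho hF i

theorem isRegular_rVector {T : AffType} (hT : T ≠ .A) (hn : T.RankOK n) {c u : Equiv.Perm (V n)}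
    {ν : V n} (hcu : c = u * translation ν) (hν : ν ∈ translationLattice T n)
    (hν' : Antidominant T ν) (hu : IsMinimalCosetRep T u ν) {β : Fin n → ℤ}
    (hβ : ∀ i, c 0 i = β i) : IsRegular T (rVector T u ν) := by
  have hA : T.fin ≠ .A := by
    cases T with
    | A => exact absurd rfl hT
    | _ => simp [AffType.fin]
  obtain ⟨σ, η, hη, -, hr⟩ := rVector_signed hu.1 hcu hβ
  refine ⟨rVector_strictAnti hn hν hν' hu, fun i j => rVector_add_pos hn hν hν' hu hA,
    fun hF => rVector_pos hn hν hν' hu (Or.inr hF), ?_, fun hF i => ?_⟩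
  · refine ⟨rhoTop T.fin n, fun i => if η i = 1 then (σ i : ℕ) + T.eta n * β (σ i) else
      rhoTop T.fin n - ((σ i : ℕ) + T.eta n * β (σ i)), fun i => ?_⟩
    rw [hr, rho_eq]
    beta_reduce
    rcases hη i with h | h
    · rw [if_pos h, h]; push_cast; ring
    · rw [if_neg (by omega), h]; push_cast; ring
  · obtain ⟨m, hm⟩ := exists_int_rho hF (σ i)
    exact ⟨η i * (m - T.eta n * β (σ i)), by rw [hr, hm]; push_cast; ring⟩

/-! ## The empty partition -/

theorem isZeroLetter_bot {k : ℤ} : IsZeroLetter ⊥ k ↔ k < 0 := by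
  constructor
  · rintro ⟨i, rfl⟩
    have : (⊥ : YoungDiagram).rowLen i = 0 := by
      by_contra h
      exact YoungDiagram.notMem_bot (i, 0) (YoungDiagram.mem_iff_lt_rowLen.2 (by omega))
    omega
  · intro h
    have h0 : (⊥ : YoungDiagram).rowLen (-k - 1).toNat = 0 := by
      by_contra h
      exact YoungDiagram.notMem_bot ((-k - 1).toNat, 0)
        (YoungDiagram.mem_iff_lt_rowLen.2 (by omega))
    exact ⟨(-k - 1).toNat, by rw [h0]; omega⟩

theorem hasCharge_bot {g : ℕ} {i : ℤ} (h0 : 0 ≤ i) (h1 : i < g) : HasCharge g ⊥ i 0 := by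
  constructor
  · simp only [Set.mem_ofPred_eq, isZeroLetter_bot]; omega
  · intro k hk
    simp only [Set.mem_ofPred_eq, isZeroLetter_bot] at hk
    by_contra h
    nlinarith

theorem inFamily_bot (T : AffType) (n : ℕ) : InFamily T n ⊥ := by
  have h1 : hooks ⊥ = 0 := rfl
  have h2 : hooksAbove ⊥ = 0 := rfl
  have h3 : hooksBelow ⊥ = 0 := rfl
  have h4 : partsOfDouble ⊥ = 0 := rfl
  have h5 : IsSelfConjugate ⊥ := YoungDiagram.transpose_eq_iff_eq_transpose.2 rfl
  have h6 : IsDoubledDistinct ⊥ := fun i hi => absurd hi (YoungDiagram.notMem_bot _)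
  cases T <;> simp [InFamily, IsCore, h1, h2, h3, h4, h5, h6]

theorem corresponds_bot {T : AffType} (hn : T.RankOK n) :
    Corresponds T (fun _ : Fin n => 0) ⊥ := by
  have ht : (⊥ : YoungDiagram).transpose = ⊥ := YoungDiagram.transpose_eq_iff_eq_transpose.2 rfl
  have hp : partsOfDouble ⊥ = 0 := rfl
  -- For the empty partition m = 1, and β_1 = 0 is the alternative 1 - m.
  have hf : ∀ g : ℤ, ∃ m : ℤ, IsGreatest ({1} ∪ {x : ℤ | ∃ h ∈ partsOfDouble ⊥, g * x = g + h}) m ∧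
      ∀ j : Fin n, (j : ℕ) = 0 → (0 : ℤ) = m ∨ (0 : ℤ) = 1 - m := fun g =>
    ⟨1, by simp [hp], fun _ _ => Or.inr rfl⟩
  have hc : ∀ {g : ℕ} {i : ℤ}, 0 ≤ i → i < g → HasCharge g ⊥ i (-0) := fun h0 h1 => by
    rw [neg_zero]; exact hasCharge_bot h0 h1
  cases T with
  | A => exact fun j => hasCharge_bot (by omega) (by simp [AffType.eta])
  | D2 =>
    refine fun j => ⟨hasCharge_bot ?_ ?_, hc ?_ ?_⟩ <;> first | omega | (simp only [AffType.eta]; omega)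
  | A2even =>
    refine ⟨hasCharge_bot ?_ ?_, fun j => ⟨hasCharge_bot ?_ ?_, hc ?_ ?_⟩⟩ <;>
      first
      | omega
      | (simp only [AffType.eta]; omega)
  | C =>
    refine ⟨hasCharge_bot ?_ ?_, hasCharge_bot ?_ ?_, fun j => ⟨hasCharge_bot ?_ ?_, hc ?_ ?_⟩⟩ <;>
      first
      | omega
      | (simp only [AffType.eta]; omega)
  | A2evenDual =>
    refine ⟨hasCharge_bot ?_ ?_, fun j => ⟨hasCharge_bot ?_ ?_, hc ?_ ?_⟩⟩ <;>
      first
      | omega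
      | (simp only [AffType.eta]; omega)
  | B =>
    have hn : 2 ≤ n := hn
    refine ⟨hf _, fun j hj => ?_⟩
    rw [ht]
    refine ⟨hasCharge_bot ?_ ?_, hc ?_ ?_⟩ <;> first | omega | (simp only [AffType.eta]; omega)
  | A2odd =>
    have hn : 2 ≤ n := hn
    refine ⟨hf _, ?_, fun j hj => ?_⟩ <;> rw [ht]
    · refine hasCharge_bot ?_ ?_ <;> first | omega | (simp only [AffType.eta]; omega)
    · refine ⟨hasCharge_bot ?_ ?_, hc ?_ ?_⟩ <;> first | omega | (simp only [AffType.eta]; omega)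
  | D =>
    have hn : 3 ≤ n := hn
    refine ⟨hf _, fun j hj hj' => ?_, fun j hj => ?_⟩ <;> rw [ht]
    · refine ⟨hasCharge_bot ?_ ?_, hc ?_ ?_⟩ <;> first | omega | (simp only [AffType.eta]; omega)
    · have hg : ((AffType.D.eta n : ℕ) : ℤ) = 2 * n - 2 := by simp only [AffType.eta]; omega
      simp only [isZeroLetter_bot, hg]
      refine ⟨?_, fun x hx => ?_⟩
      · simp only [Set.mem_ofPred_eq, abs_zero]; omega
      · simp only [Set.mem_ofPred_eq, abs_zero] at hx ⊢
        by_contra h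
        nlinarith

theorem hookCount_bot (s : ℕ) (x : ℤ) : hookCount s ⊥ x = 0 := by
  have h1 : hooksBelow ⊥ = 0 := rfl
  have h2 : shiftParts s ⊥ = 0 := rfl
  simp [hookCount, doubleMult, half, mult, h1, h2]

theorem partCount_bot (s : ℕ) (ε₁ ε₂ x : ℤ) : partCount s ε₁ ε₂ ⊥ x = 0 := by
  have h2 : shiftParts s ⊥ = 0 := rfl
  simp [partCount, doubleMult, half, mult, h2]

/-! ## The identity for the types other than `A` -/

theorem mult_nonneg (M : Multiset ℕ) (x : ℤ) : 0 ≤ mult M x := Int.natCast_nonneg _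

theorem doubleMult_nonneg (s : ℕ) (μ : YoungDiagram) (x : ℤ) : 0 ≤ doubleMult s μ x := by
  rw [doubleMult, half]
  split_ifs
  · exact mult_nonneg _ _
  · exact le_rfl

theorem corr_eq_zero {χ : ℤ → ℤ} (hχ : IsMaya χ) {g : ℤ} (h : ∀ z, χ z = 1 → χ (z - g) = 1) :
    corr χ g = 0 := by
  rw [corr, ← finsum_zero (M := ℤ) (α := ℤ)]
  congr 1
  ext z
  rcases hχ.bin z with h' | h'
  · rw [h', zero_mul]
  · rw [h z h', sub_self, mul_zero]

theorem eta_pos {T : AffType} (hn : T.RankOK n) : 0 < T.eta n := by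
  cases T <;> simp only [AffType.RankOK, AffType.eta] at hn ⊢ <;> omega

/-- This is twice the exponent of X_0, to which the other side contributes nothing. The conditions
defining the family enter here. In types `B`, `A2odd` and `D` a part g may occur, but `hookCount`
and `partCount` count it with opposite signs. -/
theorem counts_eta_eq_zero {T : AffType} (hT : T ≠ .A) (hn : T.RankOK n) {μ : YoungDiagram}
    (hs : IsShiftSymmetric T.shift μ) (hμ : InFamily T n μ) :
    hookCount T.shift μ (T.eta n) + partCount T.shift T.partSign T.doubleSign μ (T.eta n) = 0 := by
  have hg := eta_pos hn
  have hB := mult_nonneg (hooksBelow μ) (T.eta n)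
  have hP := mult_nonneg (shiftParts T.shift μ) (T.eta n)
  have hP2 := doubleMult_nonneg T.shift μ (T.eta n)
  have key : (∀ z, letter μ z = 1 → letter μ (z - T.eta n) = 1) →
      hookCount T.shift μ (T.eta n) = 0 := fun h => by
    rw [hs.hookCount_eq (by omega), corr_eq_zero (isMaya_letter μ) h]
  have h2 : ∀ x : ℤ, (∀ h ∈ partsOfDouble μ, 2 * (h : ℤ) ≠ x) → doubleMult 0 μ x = 0 :=
    fun x hx => by
      rw [doubleMult, half]
      split_ifs with hd
      · exact mult_eq_zero_of_notMem fun m hm h => hx m hm (by omega)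
      · rfl
  cases T with
  | A => exact absurd rfl hT
  | D2 | A2even =>
    have h := key fun z hz => letter_sub_of_isCore hg hμ.2 hz
    simp only [hookCount, partCount, AffType.partSign, AffType.doubleSign, AffType.zeroCoeff,
      AffType.topCoeff, AffType.shift] at *
    push_cast at *
    linarith
  | C | A2evenDual =>
    have h := key fun z hz => letter_sub_of_hooksAbove hs hg hμ.2.1 hμ.2.2 hz
    simp only [hookCount, partCount, AffType.partSign, AffType.doubleSign, AffType.zeroCoeff,
      AffType.topCoeff, AffType.shift] at *
    push_cast at *
    linarith
  | B | A2odd =>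
    have h1 := notMem_iff_mult_eq_zero.1 hμ.2.1
    simp only [hookCount, partCount, AffType.partSign, AffType.doubleSign, AffType.zeroCoeff,
      AffType.topCoeff, AffType.shift]
    rw [h1, h2 _ fun m hm h => hμ.2.2 m hm (by omega)]
    push_cast
    ring
  | D =>
    have h1 := notMem_iff_mult_eq_zero.1 hμ.2
    simp only [hookCount, partCount, AffType.partSign, AffType.doubleSign, AffType.zeroCoeff,
      AffType.topCoeff, AffType.shift]
    rw [h1]
    push_cast
    ring

theorem shift_eq_zero_or (T : AffType) : T.shift = 0 ∨ T.zeroCoeff = 0 ∧ T.topCoeff = 0 := by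
  cases T <;> simp [AffType.shift, AffType.zeroCoeff, AffType.topCoeff]

theorem hookProduct_eq_of_ne {T : AffType} (hT : T ≠ .A) (hn : T.RankOK n)
    {β : Fin n → ℤ} {μ : YoungDiagram} (hμ : InFamily T n μ) (hc : Corresponds T β μ) {r : V n}
    (hr : IsRegular T r) {σ : Equiv.Perm (Fin n)} {η : Fin n → ℤ} (hη : ∀ i, η i = 1 ∨ η i = -1)
    (hrt : ∀ i, r i = η i * (rho T.fin n (σ i) - T.eta n * β (σ i))) :
    hookProduct T n μ =
      (∏ i ∈ Finset.Icc 1 (T.eta n - 1), (X (-(i : ℤ)) / X i) ^ alpha' T n μ i) *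
        weylProduct T r := by
  obtain ⟨a, ha, hak⟩ := exists_exponents_hookProduct hT n μ
  obtain ⟨w, hw, hw0, hw1⟩ := hr.exists_exponents_weylNum hT
  obtain ⟨w', hw', hw0', hw1'⟩ := (isRegular_rho hT n).exists_exponents_weylNum hT
  obtain ⟨C, hC⟩ := exists_exponent_identity (T.eta n) T.shift T.centerCoeff T.zeroCoeff T.topCoeff
    T.doubleSign (shift_eq_zero_or T)
  have hD := hasDiff_of_corresponds hT hn hμ hc
  -- The empty partition has β = 0 and t = ρ̊, and all its counts vanish, so its identity evaluates
  -- the constant C.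
  have hD' := hasDiff_of_corresponds hT hn (inFamily_bot T n) (corresponds_bot hn)
  simp only [Int.cast_zero, mul_zero, sub_zero] at hD'
  change HasDiff _ _ _ _ _ _ (rho T.fin n) at hD'
  set t : V n := fun j => rho T.fin n j - T.eta n * β j with ht
  have hs := hD.symm
  have hg := eta_pos hn
  have hz := counts_eta_eq_zero hT hn hs hμ
  rw [weylProduct_eq hn]
  have hrhs := (hasExponents_prefactor (T.eta n) (alpha' T n μ)).mul (hw.div hw')
  refine ha.eq ?_
  convert hrhs using 2 with k
  -- For k < 0 only the counts at k + g survive, and they sum to 2α'(-k); at k = 0 there is `hz`;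
  -- for k > 0 the identities of μ and of the empty partition are subtracted.
  have h2 : 2 * a k = 2 * ((if 0 < k ∧ k < T.eta n then -(alpha' T n μ k.natAbs : ℤ) else
        if k < 0 ∧ -k < T.eta n then (alpha' T n μ k.natAbs : ℤ) else 0) + (w k - w' k)) := by
    rw [hak]
    rcases lt_trichotomy k 0 with hk | rfl | hk
    · rw [hw0 k hk.le, hw0' k hk.le, if_neg (by omega), sub_self, add_zero,
        hs.hookCount_of_nonpos (x := k - _) (by omega), hs.hookCount_of_nonpos hk.le,
        hs.partCount_of_nonpos (x := k - _) (by omega)]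
      split_ifs with h
      · rw [two_mul_alpha' hT, Int.ofNat_natAbs_of_nonpos hk.le, sub_neg_eq_add, add_comm k]
        ring
      · rw [hs.hookCount_of_nonpos (x := k + _) (by omega),
          hs.partCount_of_nonpos (x := k + _) (by omega)]
        ring
    · rw [hw0 0 le_rfl, hw0' 0 le_rfl, if_neg (by omega), if_neg (by omega), zero_add, zero_sub,
        hs.hookCount_of_nonpos le_rfl, hs.hookCount_of_nonpos (x := -_) (by omega),
        hs.partCount_of_nonpos (x := -_) (by omega)]
      linarith
    · have e1 := hC μ n _ hD k hk
      have e2 := hC ⊥ n _ hD' k hk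
      simp only [hookCount_bot, partCount_bot, add_zero, ite_self] at e2
      have e3 := hw1 k hk
      have e4 := hw1' k hk
      rw [pairCount_signed (t := t) hη hrt, absCount_signed (t := t) hη hrt,
        absCount_signed (t := t) hη hrt] at e3
      change _ + partCount T.shift T.partSign T.doubleSign μ _ - partCount T.shift T.partSign _ _ _ +
        (if _ then _ + partCount T.shift T.partSign _ _ _ else _) = _ at e1
      have e5 := two_mul_alpha' hT n μ k.natAbs
      rw [Int.natAbs_of_nonneg hk.le] at e5
      rw [if_neg (by omega : ¬ (k < 0 ∧ _))]
      by_cases h : k < T.eta n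
      · rw [if_pos h] at e1
        rw [if_pos ⟨hk, h⟩]
        linarith
      · rw [if_neg h] at e1
        rw [if_neg (by omega)]
        linarith
  exact mul_left_cancel₀ two_ne_zero h2

end AffineHook

namespace AffineHook

variable {n : ℕ} {μ : YoungDiagram}

/-! ## The identity for the type `A` -/

theorem diff_of_corresponds_A {β : Fin n → ℤ} (hn : 0 < n) (hμ : IsCore n μ)
    (hc : ∀ j : Fin n, HasCharge n μ j (β j)) (z : ℤ) :
    letter μ (z - n) - letter μ z = pointCount (fun j : Fin n => n * β j + j) z := by
  have hz : z = z / n * n + z % n := by rw [mul_comm]; exact (Int.mul_ediv_add_emod z n).symm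
  have h0 := Int.emod_nonneg z (b := n) (by omega)
  have h1 := Int.emod_lt_of_pos z (b := n) (by omega)
  generalize z / n = k, z % n = i at hz h0 h1
  subst hz
  obtain ⟨j, hj⟩ : ∃ j : Fin n, (j : ℤ) = i := ⟨⟨i.toNat, by omega⟩, by simp; omega⟩
  have hd := diff_of_hasCharge (hc j) (fun l hl => by
    have e : (l - 1) * n + (j : ℤ) = l * n + j - n := by ring
    rw [e]
    exact letter_sub_of_isCore hn hμ hl) k
  rw [hj] at hd
  rw [hd, pointCount_eq_ite (fun j => ⟨by omega, by omega⟩)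
    (fun j l hjl => Fin.ext (by simpa using hjl)) hj]

/-- The second difference of the hook length counts of an `n`-core. -/
theorem second_diff_corr_A {β : Fin n → ℤ} (hn : 0 < n) (hμ : IsCore n μ)
    (hc : ∀ j : Fin n, HasCharge n μ j (β j)) (k : ℤ) :
    corr (letter μ) (k + n) + corr (letter μ) (k - n) - 2 * corr (letter μ) k =
      ∑ i : Fin n, ∑ j : Fin n, if ((n : ℤ) * β i + i) - (n * β j + j) = k then 1 else 0 := by
  have hd := diff_of_corresponds_A hn hμ hc
  have e : ∀ z, letter μ (z - k - n) - letter μ (z - k) =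
      pointCount (fun j : Fin n => n * β j + j) (z - k) := fun z => hd (z - k)
  rw [corr_second_diff (isMaya_letter μ)]
  simp only [hd]
  rw [finsum_pointCount_mul]
  refine Finset.sum_congr rfl fun i _ => Finset.sum_congr rfl fun j _ => if_congr_prop ?_
  constructor <;> intro h <;> linarith

theorem mult_hooks_of_nonpos {x : ℤ} (hx : x ≤ 0) : mult (hooks μ) x = 0 := by
  refine mult_eq_zero_of_notMem fun m hm h => ?_
  obtain ⟨⟨i, j⟩, hc, rfl⟩ := Multiset.mem_map.1 hm
  have h1 := hookLength_eq hc
  have h2 := (colPos_lt_rowPos_iff μ).2 hc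
  omega

/-- The exponents of `∏_{i<j} X_{r_i - r_j}`. -/
theorem exists_exponents_weylNum_A {r : V n} (hr : StrictAnti r) {τ : Fin n → ℤ} {q : ℚ}
    (σ : Equiv.Perm (Fin n)) (hτ : ∀ i, r i = q - τ (σ i)) :
    ∃ a, HasExponents (weylNum .A r) a ∧ (∀ k ≤ 0, a k = 0) ∧
      ∀ k > 0, a k = ∑ i, ∑ j, if τ i - τ j = k then 1 else 0 := by
  refine ⟨_, HasExponents.prod fun i _ => HasExponents.prod fun j _ =>
    hasExponents_Xq (m := τ (σ j) - τ (σ i)) (by rw [hτ, hτ]; push_cast; ring),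
    fun k hk => ?_, fun k hk => ?_⟩
  · have hk' : (k : ℚ) ≤ 0 := by exact_mod_cast hk
    refine Finset.sum_eq_zero fun i _ => Finset.sum_eq_zero fun j hj => ite_eq_zero_of_gt ?_
    have h1 := hr (Finset.mem_Ioi.1 hj)
    linarith
  · have hk' : (0 : ℚ) < k := by exact_mod_cast hk
    rw [Finset.sum_comm]
    refine Eq.trans ?_ (Equiv.sum_comp σ fun j => ∑ i, if τ i - τ j = k then (1 : ℤ) else 0)
    refine Finset.sum_congr rfl fun i _ => ?_
    refine Eq.trans ?_ (Equiv.sum_comp σ fun j => if τ j - τ (σ i) = k then (1 : ℤ) else 0)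
    have e : ∀ j, (if τ (σ j) - τ (σ i) = k then (1 : ℤ) else 0) =
        if r i - r j = k then 1 else 0 := fun j => if_congr_prop (by
      rw [hτ, hτ, ← Int.cast_inj (α := ℚ)]
      push_cast
      constructor <;> intro h <;> linarith)
    rw [Finset.sum_congr rfl fun j _ => e j]
    -- For j ≤ i the difference r_i - r_j is at most 0 < k, so the sum over j > i extends to all j.
    refine Finset.sum_subset (Finset.subset_univ _) fun j _ hj => ite_eq_zero_of_lt ?_
    have h1 : r i ≤ r j := hr.antitone (by simpa using hj)
    linarith

theorem hookProduct_eq_A (hn : 2 ≤ n) {β : Fin n → ℤ} (hμ : IsCore n μ)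
    (hc : ∀ j : Fin n, HasCharge n μ j (β j)) {r : V n} (hr : StrictAnti r)
    (σ : Equiv.Perm (Fin n)) (hrt : ∀ i, r i = rho .A n (σ i) - n * β (σ i)) :
    hookProduct .A n μ =
      (∏ i ∈ Finset.Icc 1 (n - 1), (X (-(i : ℤ)) / X i) ^ alpha' .A n μ i) *
        weylProduct .A r := by
  have hL : HasExponents (hookProduct .A n μ) fun k =>
      mult (hooks μ) (k + n) + mult (hooks μ) (k - n) - 2 * mult (hooks μ) k := by
    rw [hookProduct, map_do_cast, map_do_cast]
    have h := hasExponents_hooks (hooks μ) n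
    simp only [parts, Multiset.map_zero, Multiset.prod_zero, one_mul]
    exact h
  have hρ : ∀ i, rho .A n i = ((n : ℚ) - 1) / 2 - ((i : ℕ) : ℤ) := fun i => by simp [rho]
  obtain ⟨w, hw, hw0, hw1⟩ := exists_exponents_weylNum_A hr (τ := fun j => n * β j + j)
    (q := ((n : ℚ) - 1) / 2) σ (fun i => by rw [hrt, hρ]; push_cast; ring)
  obtain ⟨w', hw', hw0', hw1'⟩ := exists_exponents_weylNum_A (r := rho .A n)
    (τ := fun j => n * 0 + j) (q := ((n : ℚ) - 1) / 2)
    (fun i j hij => by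
      have : ((i : ℕ) : ℚ) < (j : ℕ) := by exact_mod_cast hij
      rw [hρ, hρ]; push_cast; linarith) (Equiv.refl _)
    (fun i => by rw [hρ, Equiv.refl_apply]; push_cast; ring)
  have hα : ∀ i, (alpha' .A n μ i : ℤ) = mult (hooks μ) (n - i) := fun i =>
    countP_eq_mult _ fun m => by simp only [AffType.eta]; omega
  have hc' : ∀ j : Fin n, HasCharge n ⊥ j 0 := fun j => hasCharge_bot (by omega) (by omega)
  have hμ' : IsCore n ⊥ := inFamily_bot .A n
  have hmb : ∀ x, 0 < x → corr (letter ⊥) x = 0 := fun x hx => by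
    rw [← mult_hooks hx]; rfl
  rw [weylProduct_eq (T := .A) hn]
  have hR := (hasExponents_prefactor n (alpha' .A n μ)).mul (hw.div hw')
  refine hL.eq (Eq.subst (motive := HasExponents _) (funext fun k => ?_) hR)
  refine Eq.symm ?_
  rcases lt_trichotomy k 0 with hk | rfl | hk
  · rw [hw0 k hk.le, hw0' k hk.le, if_neg (by omega), sub_self, add_zero,
      mult_hooks_of_nonpos (x := k - _) (by omega), mult_hooks_of_nonpos hk.le]
    split_ifs with h
    · rw [hα, Int.ofNat_natAbs_of_nonpos hk.le, sub_neg_eq_add, add_comm k]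
      ring
    · rw [mult_hooks_of_nonpos (x := k + _) (by omega)]
      ring
  · rw [hw0 0 le_rfl, hw0' 0 le_rfl, if_neg (by omega), if_neg (by omega), zero_add, zero_sub,
      mult_hooks_of_nonpos le_rfl, mult_hooks_of_nonpos (x := -_) (by omega),
      notMem_iff_mult_eq_zero.1 hμ]
    ring
  · have e1 := second_diff_corr_A (by omega) hμ hc k
    have e2 := second_diff_corr_A (by omega) hμ' hc' k
    rw [← hw1 k hk] at e1
    rw [← hw1' k hk, hmb k hk, hmb (k + n) (by omega)] at e2
    rw [if_neg (by omega : ¬ (k < 0 ∧ _)), mult_hooks (h := k + n) (by omega), mult_hooks hk]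
    -- For k < n the value at k - n is traded for the number α'(k) of hooks of length n - k; the
    -- constant of the exchange cancels against the empty partition.
    rcases lt_trichotomy k n with h | rfl | h
    · have e3 := corr_neg_sub (isMaya_letter μ) (isMaya_letter ⊥) (n - k)
      rw [hmb (n - k) (by omega), neg_sub] at e3
      rw [if_pos ⟨hk, h⟩, hα, Int.natAbs_of_nonneg hk.le, mult_hooks (h := n - k) (by omega),
        mult_hooks_of_nonpos (x := k - n) (by omega)]
      linarith
    · rw [sub_self, corr_zero (isMaya_letter _)] at e1 e2
      rw [if_neg (by omega), sub_self, mult_hooks_of_nonpos le_rfl]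
      linarith
    · rw [hmb (k - n) (by omega)] at e2
      rw [if_neg (by omega), mult_hooks (h := k - n) (by omega)]
      linarith

end AffineHook

open AffineHook
theorem mainTheorem3 (T : AffType) (n : ℕ) (hn : T.RankOK n)
    (c : Equiv.Perm (V n)) (hc : c ∈ affineGrassmannian T n)
    (u : Equiv.Perm (V n)) (ν : V n) (hcu : c = u * translation ν)
    (hν : ν ∈ translationLattice T n) (hν' : Antidominant T ν) (hu : IsMinimalCosetRep T u ν)
    (β : Fin n → ℤ) (hβ : ∀ i, c 0 i = β i)
    (μ : YoungDiagram) (hμ : InFamily T n μ) (hcμ : Corresponds T β μ) :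
    hookProduct T n μ =
      (∏ i ∈ Finset.Icc 1 (T.eta n - 1), (X (-(i : ℤ)) / X i) ^ alpha' T n μ i) *
        weylProduct T (rVector T u ν) := by
  obtain ⟨σ, η, hη, hA, hr⟩ := rVector_signed hu.1 hcu hβ
  by_cases hT : T = .A
  · subst hT
    refine hookProduct_eq_A hn hμ hcμ (rVector_strictAnti hn hν hν' hu) σ fun i => ?_
    rw [hr, hA rfl, Int.cast_one, one_mul]
    rfl
  · exact hookProduct_eq_of_ne hT hn hμ hcμ (isRegular_rVector hT hn hcu hν hν' hu hβ) hη hr
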